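/- \textbf{Theorem.} There exist a finite alphabet $S$ and a two-dimensional subshift of finite type $X \subseteq S^{\mathbb{Z}^2}$ (that is, the set of all configurations in which none of finitely many given finite patterns occurs at any translate) with the following properties. \begin{enumerate} \item $X$ is a countable set. \item $X$ is deterministic in the southwest direction $(-1,-1)$: whenever $x, y \in X$ satisfy $x_{(a,b)} = y_{(a,b)}$ for all $(a,b) \in \mathbb{Z}^2$ with $a + b \geq 1$, then $x = y$. \item There is an order-embedding of $-\omega$ (the natural numbers with the reversed order, an infinite descending chain) into the subpattern poset $\mathrm{SP}(X)$. Here $\mathrm{SP}(X)$ is the partially ordered set of equivalence classes of the preorder on $X$ in which $x \leq y$ if and only if every finite pattern that occurs in $x$ also occurs in $y$. \end{enumerate} -/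

import Mathlib

open SymbolicDynamics.FullShift

namespace PlanarShift

/-- The subshift `X` is of finite type: it is defined by a finite set of forbidden patterns. -/
def IsSFT {S : Type*} [TopologicalSpace S] [Inhabited S] (X : Subshift S (ℤ × ℤ)) : Prop :=
  ∃ F : Set (Pattern S (ℤ × ℤ)), F.Finite ∧ X.carrier = forbidden F

/-- `x` and `y` carry the same symbols on the open upper half plane `{(a, b) | 1 ≤ b}`. -/
def AgreeAbove {S : Type*} (x y : ℤ × ℤ → S) : Prop :=
  ∀ n : ℤ × ℤ, 1 ≤ n.2 → x n = y n

/-- Southward determinism: a half plane `{(a, b) | 1 ≤ b}` filled with symbols has at most one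
extension in `X`. (A filling in which a forbidden pattern occurs has none, so it suffices to
compare elements of `X`.) -/
def SouthDeterministic {S : Type*} (X : Set (ℤ × ℤ → S)) : Prop :=
  ∀ x ∈ X, ∀ y ∈ X, AgreeAbove x y → x = y

/-- The linear action of `SL₂(ℤ)` on `ℤ²`, vectors being columns. -/
def linAct (A : Matrix.SpecialLinearGroup (Fin 2) ℤ) (n : ℤ × ℤ) : ℤ × ℤ :=
  (A 0 0 * n.1 + A 0 1 * n.2, A 1 0 * n.1 + A 1 1 * n.2)

/-- The configuration `A(x)`, given by `A(x)_n = x_{A⁻¹ n}`. -/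
def transform {S : Type*} (A : Matrix.SpecialLinearGroup (Fin 2) ℤ) (x : ℤ × ℤ → S) :
    ℤ × ℤ → S :=
  fun n => x (linAct A⁻¹ n)

/-- Counterclockwise rotation of the plane by a right angle. -/
def quarterTurn (n : ℤ × ℤ) : ℤ × ℤ := (-n.2, n.1)

/-- Determinism in the direction `d`: some `A ∈ SL₂(ℤ)` mapping the vector `quarterTurn d` to
`(1, 0)`, and hence the lattice lines parallel to it to horizontal lines with `d` pointing
southward, makes `A(X)` southward deterministic. The choice of such an `A` is immaterial, because
any two differ by a horizontal shear, which preserves the half plane `{(a, b) | 1 ≤ b}`. -/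
def DeterministicInDirection {S : Type*} (d : ℤ × ℤ) (X : Set (ℤ × ℤ → S)) : Prop :=
  ∃ A : Matrix.SpecialLinearGroup (Fin 2) ℤ,
    linAct A (quarterTurn d) = (1, 0) ∧ SouthDeterministic (transform A '' X)

/-- The set of patterns (finite arrays of symbols) that occur in the configuration `x`. -/
def patterns {S : Type*} [Inhabited S] (x : ℤ × ℤ → S) : Set (Pattern S (ℤ × ℤ)) :=
  {p | ∃ n : ℤ × ℤ, p.occursInAt x n}

/-- The configurations of `X`, as a type of its own that carries the subpattern preorder. -/
def Point {S : Type*} [TopologicalSpace S] (X : Subshift S (ℤ × ℤ)) : Type _ :=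
  {x : ℤ × ℤ → S // x ∈ X.carrier}

/-- The subpattern preorder: `x ≤ y` if every pattern of `x` occurs in `y`. -/
instance {S : Type*} [TopologicalSpace S] [Inhabited S] (X : Subshift S (ℤ × ℤ)) :
    Preorder (Point X) where
  le x y := patterns x.1 ⊆ patterns y.1
  le_refl _ := subset_rfl
  le_trans _ _ _ := subset_trans

/-- The subpattern poset of `X`: the partially ordered set of equivalence classes of the subpattern
preorder on `X`. -/
abbrev SubpatternPoset {S : Type*} [TopologicalSpace S] [Inhabited S]
    (X : Subshift S (ℤ × ℤ)) : Type _ :=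
  Antisymmetrization (Point X) (· ≤ ·)

end PlanarShift

/-!
The shift consists of space-time diagrams of signals. With the coordinates `x = a` and `h = a + b`,
time runs downwards, from row `h + 1` to row `h`. The signals entering a cell from above determine
the cell, the background colours in a row are determined by the signals in it, and in empty rows the
colour is preserved (`Valid.eq_of_eq_above`). This is determinism in the southwest direction.

The signals draw triangles. A triangle of height `H` has the corners `(a, 0)` and `(a + 3 * H, 0)`
and the apex `(a + H, H)`. If `3` divides `H = 3 * G`, a vertical line, called `d`-line, drops from
the apex to the base, and it has a triangle of height `G` on its left, below the left side of the
large triangle, and one of height `2 * G` on its right, below the right side. The apexes of these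
two are found by signals: from the apex of the large triangle one signal runs to the `d`-line that
ends at its left corner and one to the `d`-line that ends at its right corner. There they are
reflected, and the speeds are such that they reach the sides again at the heights `G` and `2 * G`.
On the way back they count their steps modulo `3`. In this way it is known at the new apex whether
its height is divisible by `3`, and so whether the new triangle is divided again.

*The descending chain.* The configuration `conf g` is the union of the triangles of heights
`3 ^ k * g` with left corner `(0, 0)`. Its lowest apexes have height `g`, which is not divisible by
`3`. The triangle of height `3 ^ (k + 1) * g` is divided into one of height `3 ^ k * g` and one of
height `3 ^ k * (2 * g)`, and in a large window around the corner that these have in common,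
`conf g` agrees with `conf (2 * g)` (`conf_double`). So all patterns of `conf (2 * g)` occur in
`conf g`. The converse fails, as no apex of `conf (2 * g)` has height `g` (`le_of_patterns_conf`).

*Countability* (`countable_setOf_valid`). A triangle of height `t` that lies between two `d`-lines
is part of a triangle of height `3 * t` or `3 * t / 2`, by following the signals that meet at its
apex back to where they come from (`Valid.node_step`). The power of `2` in the height decreases in
the second case and is kept in the first one. Hence, from some triangle on, each is the left part of
the next, and all of them have the same left corner (`Valid.exists_chain`). The vertical line through
this corner comes from infinity. The cells on its right are determined by the position of the
triangles, and on its left no signals meet above a certain row (`Tame`), so that the configuration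
is determined by the left part of this row (`Tame.eq`). If there is no such triangle, then no signals
meet at all above a certain row (`Valid.exists_no_event`), and this row determines the configuration
(`Valid.eq_of_row_eq`). In both cases the row is constant far away, so that there are countably many
possibilities for it.
-/


namespace TriangleShift

/-! ### The local rule -/

/-- The two sides of a vertical `d`-line. -/
inductive Side
  | L
  | R
  deriving DecidableEq

instance : Fintype Side := ⟨{Side.L, Side.R}, by rintro (_ | _) <;> simp⟩

/-- Background colours. `E` is the colour of the empty regions (below the base row and inside the
smallest triangles); `near s` and `far s` are the two colours used on side `s` of a `d`-line. -/
inductive Col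
  | E
  | near (s : Side)
  | far (s : Side)
  deriving DecidableEq, Fintype

/-- The signals. `d` is the vertical line. On side `s` of it run `sep s` (or `lsep s`, below the
last apex), the line closing the region of the `d`-line on that side, and between the two a signal
bouncing back and forth: `inw s` runs towards the `d`-line and `outw s k` away from it, `k` being
the number of steps made so far, modulo `3`. -/
inductive Par
  | d
  | sep (s : Side)
  | lsep (s : Side)
  | inw (s : Side)
  | outw (s : Side) (k : ZMod 3)
  deriving DecidableEq, Fintype

/-- The alphabet: background colours, cells with one signal passing, and the meeting points of
signals. At `apex s k` the signals `sep s` and `outw s k` meet, at `hit s` the signal `inw s` is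
reflected at a `d`-line, and at `mark` a `d`-line meets the two lines `lsep`, and all three end. -/
inductive Cell
  | bg (k : Col)
  | par (p : Par)
  | apex (s : Side) (k : ZMod 3)
  | hit (s : Side)
  | mark
  deriving DecidableEq, Fintype

open Side Col Par Cell

/-- The other side. -/
def Side.opp : Side → Side
  | L => R
  | R => L

/-- The sign of the direction pointing to side `s`. -/
def Side.sg : Side → ℤ
  | L => -1
  | R => 1

/-- The horizontal displacement of a signal when the height decreases by one. -/
def Par.vel : Par → ℤ
  | .d => 0
  | .sep R => -1
  | .sep L => 2
  | .lsep R => -1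
  | .lsep L => 2
  | .inw R => -3
  | .inw L => 12
  | .outw R _ => 1
  | .outw L _ => -8

/-- The direction in which a signal moves when the height decreases. -/
def Par.dir : Par → ℤ
  | .d => 0
  | .sep s => -s.sg
  | .lsep s => -s.sg
  | .inw s => -s.sg
  | .outw s _ => s.sg

/-- The rate at which a signal approaches the line it will meet next. A signal has to keep at least
this distance from everything in front of it. -/
def Par.sweep : Par → ℤ
  | .d => 1
  | .sep R => 1
  | .sep L => 2
  | .lsep R => 1
  | .lsep L => 2
  | .inw R => 3
  | .inw L => 12
  | .outw R _ => 2
  | .outw L _ => 10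

/-- The cell carries no signal. -/
def Cell.blank : Cell → Bool
  | .bg _ => true
  | _ => false

/-- The cell is a meeting point of signals. -/
def Cell.event : Cell → Bool
  | .bg _ => false
  | .par _ => false
  | _ => true

/-- The signals entering a cell from above. -/
def Cell.inn : Cell → Par → Bool
  | .bg _, _ => false
  | .par p, q => p = q
  | .apex s k, q => q = .sep s ∨ q = .outw s k
  | .hit s, q => q = .d ∨ q = .inw s
  | .mark, q => q = .d ∨ q = .lsep L ∨ q = .lsep R

/-- The signals leaving a cell downwards. -/
def Cell.out : Cell → Par → Bool
  | .bg _, _ => false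
  | .par (.outw s k), q => q = .outw s (k + 1)
  | .par p, q => p = q
  | .apex _ k, q => if k = 0 then
      q = .d ∨ q = .sep L ∨ q = .sep R ∨ q = .inw L ∨ q = .inw R
      else q = .lsep L ∨ q = .lsep R
  | .hit s, q => q = .d ∨ q = .outw s 1
  | .mark, _ => false

/-- The background colour next to a cell on side `s`. -/
def Cell.col (s : Side) : Cell → Col
  | .bg k => k
  | .par .d => .near s
  | .par (.sep t) => if s = t then .near t.opp else .far t
  | .par (.lsep t) => if s = t then .E else .near t
  | .par (.inw t) => if s = t then .far t else .near t
  | .par (.outw t _) => if s = t then .far t else .near t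
  | .apex _ _ => .near s.opp
  | .hit t => if s = t then .far t else .near s
  | .mark => .E

/-- The local rule for the movement of signals at the cell in column `x` and row `h`: the background
colours of neighbouring cells fit together, the signals entering a cell are those sent to it by the
row above, and in front of a signal there is background up to the distance `sweep`. -/
structure Coherent (c : ℤ → ℤ → Cell) (x h : ℤ) : Prop where
  color : (c x h).col R = (c (x + 1) h).col L
  vert : ∀ p : Par, (c x h).inn p = (c (x - p.vel) (h + 1)).out p
  clear : ∀ p : Par, (c x h).out p → ∀ j : ℤ, 0 < j → j < p.sweep →
    (c (x + p.dir * j) h).blank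

/-- The local rule at the cell in column `x` and row `h`. Where no signal comes near, the background
does not change, except that a mark may have been in this place. -/
structure Admissible (c : ℤ → ℤ → Cell) (x h : ℤ) : Prop extends Coherent c x h where
  calm : (∀ i : ℤ, -12 ≤ i → i ≤ 12 → (c (x + i) h).blank) →
    c x (h + 1) = c x h ∨ (c x (h + 1) = .mark ∧ c x h = .bg .E)

/-- The configurations in which signals move according to the rules. -/
def Lawful (c : ℤ → ℤ → Cell) : Prop := ∀ x h, Coherent c x h

/-- The configurations of the shift, in coordinates in which time runs downwards. -/
def Valid (c : ℤ → ℤ → Cell) : Prop := ∀ x h, Admissible c x h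

theorem Valid.lawful {c : ℤ → ℤ → Cell} (hc : Valid c) : Lawful c := fun x h =>
  (hc x h).toCoherent

/-- The signals entering a cell determine it, up to the background colour. -/
theorem inn_injective : ∀ s t : Cell, (∀ p, s.inn p = t.inn p) → s = t ∨ (s.blank ∧ t.blank) := by
  decide +kernel

theorem exists_inn : ∀ s : Cell, s.blank = false → ∃ p, s.inn p = true := by decide +kernel

theorem exists_out : ∀ s : Cell, s.blank = false → s = .mark ∨ ∃ p, s.out p = true := by
  decide +kernel

theorem not_blank_of_inn : ∀ (s : Cell) (p : Par), s.inn p = true → s.blank = false := by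
  decide +kernel

theorem not_blank_of_out : ∀ (s : Cell) (p : Par), s.out p = true → s.blank = false := by
  decide +kernel

theorem col_of_blank : ∀ (s : Cell), s.blank = true → s.col L = s.col R := by decide +kernel

theorem eq_of_blank : ∀ (s : Cell) (t : Side), s.blank = true → s = .bg (s.col t) := by
  decide +kernel

theorem vel_le_sweep : ∀ p : Par, p.vel ≤ p.sweep ∧ - p.vel ≤ p.sweep ∧ 1 ≤ p.sweep ∧
  p.vel ≤ 12 ∧ - p.vel ≤ 8 := by
  decide +kernel

theorem dir_of_vel_pos : ∀ p : Par, 0 < p.vel → p.dir = 1 := by decide +kernel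

theorem dir_of_vel_neg : ∀ p : Par, p.vel < 0 → p.dir = -1 := by decide +kernel

/-- When two signals run towards each other across a background of a single colour, one of the two
has a `sweep` that is at least the speed at which they approach each other. -/
theorem facing : ∀ s t : Cell, s.col R = t.col L → ∀ p q : Par, s.out p → t.out q →
    0 < p.vel → q.vel < 0 → p.vel - q.vel ≤ p.sweep ∨ p.vel - q.vel ≤ q.sweep := by
  decide +kernel

/-! ### Neighbouring signals and determinism -/

variable {c c' : ℤ → ℤ → Cell}

theorem Lawful.pred (hc : Lawful c) {x h : ℤ} {p : Par} (hp : (c x h).inn p = true) :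
    (c (x - p.vel) (h + 1)).out p = true := by
  rw [← (hc x h).vert p]; exact hp

theorem Lawful.succ (hc : Lawful c) {x h : ℤ} {p : Par} (hp : (c x (h + 1)).out p = true) :
    (c (x + p.vel) h).inn p = true := by
  rw [(hc (x + p.vel) h).vert p]; simpa using hp

/-- In row `h` there are only background cells strictly between `x` and `y`, where `y` lies on side
`s` of `x`. -/
def Clear (c : ℤ → ℤ → Cell) (h : ℤ) (s : Side) (x y : ℤ) : Prop :=
  ∀ z, 0 < s.sg * (z - x) → 0 < s.sg * (y - z) → (c z h).blank = true

/-- In row `h` there are only background cells on side `s` of `x`. -/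
def ClearRay (c : ℤ → ℤ → Cell) (h : ℤ) (s : Side) (x : ℤ) : Prop :=
  ∀ z, 0 < s.sg * (z - x) → (c z h).blank = true

theorem Side.opp_opp (s : Side) : s.opp.opp = s := by cases s <;> rfl

theorem Side.sg_opp (s : Side) : s.opp.sg = -s.sg := by cases s <;> rfl

theorem Side.sg_mul_sg (s : Side) : s.sg * s.sg = 1 := by cases s <;> rfl

theorem Clear.symm {h : ℤ} {s : Side} {x y : ℤ} (hcl : Clear c h s x y) :
    Clear c h s.opp y x := by
  intro z h1 h2
  rw [Side.sg_opp] at h1 h2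
  exact hcl z (by linarith) (by linarith)

theorem Lawful.col_step (hc : Lawful c) (s : Side) (x h : ℤ) :
    (c x h).col s = (c (x + s.sg) h).col s.opp := by
  cases s
  · have := (hc (x - 1) h).color
    simp only [sub_add_cancel] at this
    exact this.symm
  · exact (hc x h).color

theorem col_of_blank' {t : Cell} (ht : t.blank = true) (s : Side) : t.col s = t.col s.opp := by
  have := col_of_blank t ht
  cases s <;> simp [Side.opp, this]

theorem Lawful.col_add (hc : Lawful c) (s : Side) (x h : ℤ) (n : ℕ)
    (hb : ∀ j : ℕ, 0 < j → j ≤ n → (c (x + s.sg * j) h).blank = true) :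
    (c x h).col s = (c (x + s.sg * (n + 1)) h).col s.opp := by
  induction n with
  | zero => simpa using hc.col_step s x h
  | succ n ih =>
    rw [ih fun j h1 h2 => hb j h1 (by omega)]
    have h1 := hc.col_step s (x + s.sg * (n + 1)) h
    have h2 := hb (n + 1) (by omega) le_rfl
    push_cast at h2
    rw [← col_of_blank' h2, h1]
    push_cast
    congr 2
    ring

theorem Side.exists_eq_add (s : Side) {x y : ℤ} (hxy : 0 < s.sg * (y - x)) :
    ∃ n : ℕ, y = x + s.sg * (n + 1) := by
  refine ⟨(s.sg * (y - x) - 1).toNat, ?_⟩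
  cases s <;> simp [Side.sg] at * <;> omega

/-- The background between two neighbouring signals has a single colour. -/
theorem Lawful.col_eq (hc : Lawful c) {s : Side} {x y h : ℤ} (hxy : 0 < s.sg * (y - x))
    (hcl : Clear c h s x y) : (c x h).col s = (c y h).col s.opp := by
  obtain ⟨n, rfl⟩ := s.exists_eq_add hxy
  refine hc.col_add s x h n fun j h1 h2 => hcl _ ?_ ?_
  · cases s <;> simp [Side.sg] <;> omega
  · cases s <;> simp [Side.sg] <;> omega

theorem Side.sg_mul_add (s : Side) (x k : ℤ) : s.sg * (x + s.sg * k) = s.sg * x + k := by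
  rw [mul_add, ← mul_assoc, s.sg_mul_sg, one_mul]

/-- The first cell that is not background, seen from `x` in direction `s`. -/
theorem exists_first {s : Side} {x y h : ℤ} (hxy : 0 < s.sg * (y - x))
    (hy : (c y h).blank = false) :
    ∃ z, 0 < s.sg * (z - x) ∧ s.sg * z ≤ s.sg * y ∧ (c z h).blank = false ∧ Clear c h s x z := by
  obtain ⟨n, rfl⟩ := s.exists_eq_add hxy
  have hex : ∃ n : ℕ, (c (x + s.sg * (n + 1)) h).blank = false := ⟨n, hy⟩
  classical
  have hs := Nat.find_spec hex
  have hle : (Nat.find hex : ℤ) ≤ n := by exact_mod_cast Nat.find_min' hex hy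
  refine ⟨_, ?_, ?_, hs, ?_⟩
  · rw [mul_sub, s.sg_mul_add]; omega
  · rw [s.sg_mul_add, s.sg_mul_add]; omega
  · intro z h1 h2
    obtain ⟨m, rfl⟩ := s.exists_eq_add h1
    have : m < Nat.find hex := by
      rw [mul_sub, s.sg_mul_add, s.sg_mul_add] at h2; omega
    simpa using Nat.find_min hex this

theorem clear_or_exists_first (s : Side) (x h : ℤ) :
    ClearRay c h s x ∨ ∃ z, 0 < s.sg * (z - x) ∧ (c z h).blank = false ∧ Clear c h s x z := by
  by_cases hcl : ClearRay c h s x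
  · exact .inl hcl
  · simp only [ClearRay, not_forall, Bool.not_eq_true] at hcl
    obtain ⟨y, hy, hb⟩ := hcl
    obtain ⟨z, h1, -, h2, h3⟩ := exists_first hy hb
    exact .inr ⟨z, h1, h2, h3⟩

/-- A signal moving to the right keeps the distance `sweep` from everything on its right. -/
theorem Lawful.gap_right (hc : Lawful c) {x z h : ℤ} {p : Par} (hp : (c x h).out p = true)
    (hv : 0 < p.vel) (hz : x < z) (hb : (c z h).blank = false) : p.sweep ≤ z - x := by
  by_contra! hlt
  have := (hc x h).clear p hp (z - x) (by omega) hlt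
  rw [dir_of_vel_pos p hv] at this
  simp [hb] at this

/-- A signal moving to the left keeps the distance `sweep` from everything on its left. -/
theorem Lawful.gap_left (hc : Lawful c) {x z h : ℤ} {p : Par} (hp : (c x h).out p = true)
    (hv : p.vel < 0) (hz : z < x) (hb : (c z h).blank = false) : p.sweep ≤ x - z := by
  by_contra! hlt
  have := (hc x h).clear p hp (x - z) (by omega) hlt
  rw [dir_of_vel_neg p hv] at this
  have e : x + -1 * (x - z) = z := by ring
  rw [e, hb] at this
  cases this

theorem Lawful.order_right (hc : Lawful c) {x y h : ℤ} {p q : Par} (hxy : x < y)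
    (hp : (c x h).out p = true) (hq : (c y h).out q = true) : x + p.vel ≤ y + q.vel := by
  have bx := not_blank_of_out _ _ hp
  have bY := not_blank_of_out _ _ hq
  have vp := vel_le_sweep p
  have vq := vel_le_sweep q
  -- A signal that stops short of a third cell between the two cannot meet the other one. Without
  -- such a cell, the two signals face each other across a single colour.
  by_cases hcl : ∃ z, x < z ∧ z < y ∧ (c z h).blank = false
  · obtain ⟨z, h1, h2, h3⟩ := hcl
    have e1 : p.vel ≤ z - x := by
      by_cases hv : 0 < p.vel
      · have := hc.gap_right hp hv h1 h3; omega
      · omega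
    have e2 : -q.vel ≤ y - z := by
      by_cases hv : q.vel < 0
      · have := hc.gap_left hq hv h2 h3; omega
      · omega
    omega
  · have hcol : (c x h).col R = (c y h).col L := by
      refine hc.col_eq (s := R) (by simpa [Side.sg] using hxy) ?_
      intro z h1 h2
      by_contra hb
      exact hcl ⟨z, by simpa [Side.sg] using h1, by simpa [Side.sg] using h2, by simpa using hb⟩
    by_cases hv : 0 < p.vel
    · have e1 := hc.gap_right hp hv hxy bY
      by_cases hw : q.vel < 0
      · have e2 := hc.gap_left hq hw hxy bx
        rcases facing _ _ hcol p q hp hq hv hw with h | h <;> omega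
      · omega
    · by_cases hw : q.vel < 0
      · have e2 := hc.gap_left hq hw hxy bx
        omega
      · omega

/-- Signals do not cross. -/
theorem Lawful.order (hc : Lawful c) {s : Side} {x y h : ℤ} {p q : Par} (hxy : 0 < s.sg * (y - x))
    (hp : (c x h).out p = true) (hq : (c y h).out q = true) :
    s.sg * (x + p.vel) ≤ s.sg * (y + q.vel) := by
  cases s
  · simp only [Side.sg] at *
    have := hc.order_right (by omega : y < x) hq hp
    omega
  · simp only [Side.sg] at *
    have := hc.order_right (by omega : x < y) hp hq
    omega

theorem Valid.pred (hc : Valid c) {x h : ℤ} {p : Par} (hp : (c x h).inn p = true) :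
    (c (x - p.vel) (h + 1)).out p = true := hc.lawful.pred hp

theorem Valid.succ (hc : Valid c) {x h : ℤ} {p : Par} (hp : (c x (h + 1)).out p = true) :
    (c (x + p.vel) h).inn p = true := hc.lawful.succ hp

theorem Valid.col_step (hc : Valid c) (s : Side) (x h : ℤ) :
    (c x h).col s = (c (x + s.sg) h).col s.opp := hc.lawful.col_step s x h

theorem Valid.col_eq (hc : Valid c) {s : Side} {x y h : ℤ} (hxy : 0 < s.sg * (y - x))
    (hcl : Clear c h s x y) : (c x h).col s = (c y h).col s.opp := hc.lawful.col_eq hxy hcl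

theorem Valid.order (hc : Valid c) {s : Side} {x y h : ℤ} {p q : Par} (hxy : 0 < s.sg * (y - x))
    (hp : (c x h).out p = true) (hq : (c y h).out q = true) :
    s.sg * (x + p.vel) ≤ s.sg * (y + q.vel) := hc.lawful.order hxy hp hq

/-- Two neighbouring signals are neighbours one row higher, unless they come from the same cell. The
last assumption excludes marks between them. -/
theorem Valid.clear_up (hc : Valid c) {s : Side} {x y h : ℤ} {p q : Par}
    (hp : (c x h).inn p = true) (hq : (c y h).inn q = true)
    (hx : ∀ r, (c x h).inn r = true → s.sg * (x - r.vel) ≤ s.sg * (x - p.vel) ∨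
      s.sg * (y - q.vel) ≤ s.sg * (x - r.vel))
    (hy : ∀ r, (c y h).inn r = true → s.sg * (y - r.vel) ≤ s.sg * (x - p.vel) ∨
      s.sg * (y - q.vel) ≤ s.sg * (y - r.vel))
    (hcl : Clear c h s x y)
    (hE : (c (x - p.vel) (h + 1)).col s ≠ .E ∨ (c (y - q.vel) (h + 1)).col s.opp ≠ .E) :
    Clear c (h + 1) s (x - p.vel) (y - q.vel) := by
  -- a signal leaving a cell between the two would enter row `h` between `x` and `y`
  have key : ∀ z, 0 < s.sg * (z - (x - p.vel)) → 0 < s.sg * (y - q.vel - z) →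
      (c z (h + 1)).blank = false → c z (h + 1) = .mark := by
    intro z h1 h2 hb
    rcases exists_out _ hb with h3 | ⟨r, hr⟩
    · exact h3
    exfalso
    have o1 := hc.order h1 (hc.pred hp) hr
    have o2 := hc.order h2 hr (hc.pred hq)
    simp only [sub_add_cancel] at o1 o2
    have hin := hc.succ hr
    rcases o1.lt_or_eq with o1 | o1
    · rcases o2.lt_or_eq with o2 | o2
      · have := hcl (z + r.vel) (by linarith) (by linarith)
        rw [not_blank_of_inn _ _ hin] at this
        cases this
      · have e : z + r.vel = y := by cases s <;> simp [Side.sg] at o2 <;> omega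
        have := hy r (e ▸ hin)
        rw [show y - r.vel = z by omega] at this
        rcases this with this | this <;> linarith
    · have e : z + r.vel = x := by cases s <;> simp [Side.sg] at o1 <;> omega
      have := hx r (e ▸ hin)
      rw [show x - r.vel = z by omega] at this
      rcases this with this | this <;> linarith
  intro z h1 h2
  by_contra hb
  rw [Bool.not_eq_true] at hb
  -- the cells next to a mark have colour `E`
  rcases hE with hE | hE
  · obtain ⟨w, w1, w2, w3, w4⟩ := exists_first h1 hb
    have hm := key w w1 (by linarith) w3
    have := hc.col_eq w1 w4
    rw [hm] at this
    exact hE this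
  · have h2' : 0 < s.opp.sg * (z - (y - q.vel)) := by rw [Side.sg_opp]; linarith
    obtain ⟨w, w1, w2, w3, w4⟩ := exists_first h2' hb
    rw [Side.sg_opp] at w1 w2
    have hm := key w (by linarith) (by linarith) w3
    have := hc.col_eq (s := s.opp) (by rw [Side.sg_opp]; linarith) w4
    rw [hm] at this
    exact hE this

/-- Two neighbouring signals are neighbours one row lower. -/
theorem Valid.clear_down (hc : Valid c) {s : Side} {x y h : ℤ} {p q : Par}
    (hp : (c x (h + 1)).out p = true) (hq : (c y (h + 1)).out q = true)
    (hx : ∀ r, (c x (h + 1)).out r = true → s.sg * (x + r.vel) ≤ s.sg * (x + p.vel) ∨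
      s.sg * (y + q.vel) ≤ s.sg * (x + r.vel))
    (hy : ∀ r, (c y (h + 1)).out r = true → s.sg * (y + r.vel) ≤ s.sg * (x + p.vel) ∨
      s.sg * (y + q.vel) ≤ s.sg * (y + r.vel))
    (hcl : Clear c (h + 1) s x y) :
    Clear c h s (x + p.vel) (y + q.vel) := by
  intro z h1 h2
  by_contra hb
  rw [Bool.not_eq_true] at hb
  obtain ⟨r, hr⟩ := exists_inn _ hb
  have ho := hc.pred hr
  set w := z - r.vel with hw
  have hz : z = w + r.vel := by omega
  rcases lt_trichotomy (s.sg * (w - x)) 0 with l | l | l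
  · have := hc.order (s := s) (by linarith) ho hp
    rw [← hz] at this; linarith
  · have e : w = x := by cases s <;> simp [Side.sg] at l <;> omega
    rw [e] at ho hz
    rw [hz] at h1 h2
    rcases hx r ho with h | h <;> linarith
  rcases lt_trichotomy (s.sg * (y - w)) 0 with m | m | m
  · have := hc.order (s := s) (by linarith) hq ho
    rw [← hz] at this; linarith
  · have e : w = y := by cases s <;> simp [Side.sg] at m <;> omega
    rw [e] at ho hz
    rw [hz] at h1 h2
    rcases hy r ho with h | h <;> linarith
  · have := hcl w l m
    rw [not_blank_of_out _ _ ho] at this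
    cases this

/-- Above background on side `s` of a signal there is only background on that side. -/
theorem Valid.clearRay_up (hc : Valid c) {s : Side} {x h : ℤ} {p : Par}
    (hp : (c x h).inn p = true)
    (hx : ∀ r, (c x h).inn r = true → s.sg * (x - r.vel) ≤ s.sg * (x - p.vel))
    (hcl : ClearRay c h s x) (hE : (c (x - p.vel) (h + 1)).col s ≠ .E) :
    ClearRay c (h + 1) s (x - p.vel) := by
  intro z h1
  by_contra hb
  rw [Bool.not_eq_true] at hb
  obtain ⟨w, w1, w2, w3, w4⟩ := exists_first h1 hb
  rcases exists_out _ w3 with h3 | ⟨r, hr⟩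
  · have := hc.col_eq w1 w4
    rw [h3] at this
    exact hE this
  have o1 := hc.order w1 (hc.pred hp) hr
  simp only [sub_add_cancel] at o1
  have hin := hc.succ hr
  rcases o1.lt_or_eq with o1 | o1
  · have := hcl (w + r.vel) (by linarith)
    rw [not_blank_of_inn _ _ hin] at this
    cases this
  · have e : w + r.vel = x := by cases s <;> simp [Side.sg] at o1 <;> omega
    have := hx r (e ▸ hin)
    rw [← e] at this w1
    cases s <;> simp [Side.sg] at * <;> omega

/-- A row determines the next one. -/
theorem Valid.row_eq_of_row_eq_above {c c' : ℤ → ℤ → Cell} (hc : Valid c) (hc' : Valid c') {h : ℤ}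
    (hrow : ∀ x, c x (h + 1) = c' x (h + 1)) (x : ℤ) : c x h = c' x h := by
  have hin : ∀ x p, (c x h).inn p = (c' x h).inn p := fun x p => by
    rw [(hc x h).vert p, (hc' x h).vert p, hrow]
  have hor := fun x => inn_injective _ _ (hin x)
  -- The background colours are inherited from any cell with a signal. In an empty row, the rule
  -- `calm` determines them.
  by_cases hex : ∃ z, (c z h).blank = false
  · obtain ⟨z, hz⟩ := hex
    have ez : c z h = c' z h := by
      rcases hor z with h1 | h1
      · exact h1
      · simp [hz] at h1
    have step : ∀ s : Side, ∀ n : ℕ, c (z + s.sg * n) h = c' (z + s.sg * n) h := by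
      intro s n
      induction n with
      | zero => simpa using ez
      | succ n ih =>
        have e1 := hc.col_step s (z + s.sg * n) h
        have e2 := hc'.col_step s (z + s.sg * n) h
        rw [ih] at e1
        have e : z + s.sg * n + s.sg = z + s.sg * ((n + 1 : ℕ) : ℤ) := by push_cast; ring
        rw [e] at e1 e2
        rcases hor (z + s.sg * ((n + 1 : ℕ) : ℤ)) with h1 | h1
        · exact h1
        · rw [eq_of_blank _ s.opp h1.1, eq_of_blank _ s.opp h1.2, ← e1, ← e2]
    rcases le_total z x with hle | hle
    · have := step R (x - z).toNat
      simp only [Side.sg, one_mul] at this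
      rwa [show z + ((x - z).toNat : ℤ) = x by omega] at this
    · have := step L (z - x).toNat
      simp only [Side.sg] at this
      rwa [show z + -1 * ((z - x).toNat : ℤ) = x by omega] at this
  · have hb : ∀ z, (c z h).blank = true := fun z => by
      by_contra hz; exact hex ⟨z, by simpa using hz⟩
    have hb' : ∀ z, (c' z h).blank = true := fun z => by
      rcases hor z with h1 | h1
      · rw [← h1]; exact hb z
      · exact h1.2
    have k1 := (hc x h).calm fun i _ _ => hb _
    have k2 := (hc' x h).calm fun i _ _ => hb' _
    rw [← hrow x] at k2
    rcases k1 with k1 | ⟨k1, k1'⟩ <;> rcases k2 with k2 | ⟨k2, k2'⟩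
    · rw [← k1, k2]
    · have := hb x; rw [← k1, k2] at this; cases this
    · have := hb' x; rw [← k2, k1] at this; cases this
    · rw [k1', k2']

/-- Determinism: the rows from some row upwards determine the configuration. -/
theorem Valid.eq_of_eq_above {c c' : ℤ → ℤ → Cell} (hc : Valid c) (hc' : Valid c') {h₀ : ℤ}
    (hrow : ∀ x h, h₀ ≤ h → c x h = c' x h) : c = c' := by
  have key : ∀ n : ℕ, ∀ x h, h₀ - n ≤ h → c x h = c' x h := by
    intro n
    induction n with
    | zero => simpa using hrow
    | succ n ih =>
      intro x h hh
      by_cases h1 : h₀ - n ≤ h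
      · exact ih x h h1
      · have e : h + 1 = h₀ - n := by push_cast at hh; omega
        exact hc.row_eq_of_row_eq_above hc' (fun z => ih z _ (by omega)) x
  funext x h
  exact key (h₀ - h).toNat x h (by omega)

theorem Side.sg_pos (s : Side) {x y : ℤ} (hn : x ≠ y) (h : 0 ≤ s.sg * (y - x)) :
    0 < s.sg * (y - x) := by
  cases s <;> simp only [Side.sg] at * <;> omega

/-- Among the signals leaving a cell there is one with the least displacement towards side `s`. -/
theorem exists_out_min : ∀ (s : Side) (t : Cell), t.blank = false → t = .mark ∨
    ∃ p, t.out p = true ∧ ∀ q, t.out q = true → s.sg * p.vel ≤ s.sg * q.vel := by decide +kernel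

/-- If the signal `p` is the outermost one both among those leaving `t` and among those entering
`u`, on the side opposite to `s`, then the colours on this side are the same. -/
theorem col_eq_of_out_inn : ∀ (s : Side) (t u : Cell) (p : Par), t.out p = true →
    u.inn p = true → (∀ q, t.out q = true → s.sg * p.vel ≤ s.sg * q.vel) →
    (∀ q, u.inn q = true → s.sg * q.vel ≤ s.sg * p.vel) → t.col s.opp = u.col s.opp := by
  decide +kernel

/-- The rule about the background follows from the others, except in empty rows and below marks. -/
theorem Lawful.calm (hc : Lawful c) {s : Side} {x y h : ℤ} (hxy : 0 < s.sg * (y - x))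
    (hy : (c y h).blank = false) (hm : ∀ z, c z (h + 1) ≠ .mark)
    (hb : ∀ i : ℤ, -12 ≤ i → i ≤ 12 → (c (x + i) h).blank = true) : c x (h + 1) = c x h := by
  have hbx : (c x h).blank = true := by simpa using hb 0
  have hbz : ∀ z, (c z h).blank = false → z < x - 12 ∨ x + 12 < z := by
    intro z hz
    by_contra! hlt
    have := hb (z - x) (by omega) (by omega)
    rw [add_sub_cancel] at this
    simp [this] at hz
  have hbx' : (c x (h + 1)).blank = true := by
    by_contra hb'
    rcases exists_out _ (by simpa using hb') with h1 | ⟨p, hp⟩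
    · exact hm _ h1
    · have := hbz _ (not_blank_of_inn _ _ (hc.succ hp))
      have := vel_le_sweep p
      omega
  -- The first cell `z` with a signal on side `s` of `x` in row `h`, and the first such cell `y` in
  -- the row above, are joined by a signal `p`. So the background next to them has the same colour.
  obtain ⟨z, z1, -, z3, z4⟩ := exists_first hxy hy
  obtain ⟨r, hr⟩ := exists_inn _ z3
  have hsrc : ∀ r, (c z h).inn r = true → 0 < s.sg * (z - r.vel - x) := by
    intro r hr
    have h1 := hbz z z3
    have h2 := vel_le_sweep r
    cases s <;> simp only [Side.sg] at * <;> omega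
  obtain ⟨y, y1, -, y3, y4⟩ := exists_first (hsrc r hr) (not_blank_of_out _ _ (hc.pred hr))
  obtain ⟨p, p1, p2⟩ := (exists_out_min s _ y3).resolve_left (hm y)
  have hi := hc.succ p1
  have hpos : 0 < s.sg * (y + p.vel - x) := by
    have h1 := hbz _ (not_blank_of_inn _ _ hi)
    have h2 := vel_le_sweep p
    cases s <;> simp only [Side.sg] at * <;> omega
  have hle : s.sg * z ≤ s.sg * (y + p.vel) := by
    by_contra! hlt
    have := z4 _ hpos (by linarith)
    rw [not_blank_of_inn _ _ hi] at this
    cases this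
  have hle' : ∀ r, (c z h).inn r = true → s.sg * y ≤ s.sg * (z - r.vel) := by
    intro r hr
    by_contra! hlt
    have := y4 _ (hsrc r hr) (by linarith)
    rw [not_blank_of_out _ _ (hc.pred hr)] at this
    cases this
  have hz : z = y + p.vel := by
    have : s.sg * (y + p.vel) ≤ s.sg * z := by
      by_cases he : z - r.vel = y
      · have h1 := hc.pred hr
        rw [he] at h1
        have h2 := p2 r h1
        rw [show z = y + r.vel by omega, mul_add, mul_add]
        omega
      · have h1 := hle' r hr
        have := hc.order (s := s) (s.sg_pos (Ne.symm he) (by linarith)) p1 (hc.pred hr)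
        simpa using this
    cases s <;> simp only [Side.sg] at * <;> omega
  rw [eq_of_blank _ s hbx, eq_of_blank _ s hbx', hc.col_eq z1 z4, hc.col_eq y1 y4,
    col_eq_of_out_inn s _ _ p p1 (hz ▸ hi) p2 fun q hq => ?_]
  have := hle' q hq
  rw [hz, mul_sub, mul_add] at this
  linarith

/-! ### Following signals upwards -/

/-- The speed at which `sep s` and `lsep s` approach their `d`-line. -/
def Side.slope : Side → ℤ
  | L => 2
  | R => 1

/-- The speed of `inw s`. -/
def Side.inSpeed : Side → ℤ
  | L => 12
  | R => 3

/-- The speed of `outw s`. -/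
def Side.outSpeed : Side → ℤ
  | L => 8
  | R => 1

/-- A cell of a `d`-line, neither its apex nor its mark, with the colour `near s` on side `s`. -/
def Dish (s : Side) (t : Cell) : Prop := t = .par .d ∨ t = .hit s.opp

theorem Dish.inn {s : Side} {t : Cell} (ht : Dish s t) : t.inn .d = true := by
  rcases ht with rfl | rfl <;> rfl

theorem Dish.not_blank {s : Side} {t : Cell} (ht : Dish s t) : t.blank = false := by
  rcases ht with rfl | rfl <;> rfl

theorem vel_d : Par.d.vel = 0 := rfl

theorem Dish.vel_le {s : Side} {t : Cell} (ht : Dish s t) {r : Par} (hr : t.inn r = true) :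
    0 ≤ s.sg * r.vel := by
  revert s t r; unfold Dish; decide +kernel

theorem dish_of_out : ∀ (s : Side) (t : Cell), t.out .d = true → t.col s = .near s → Dish s t := by
  unfold Dish; decide +kernel

theorem out_d_outw : ∀ (s : Side) (k : ZMod 3) (t : Cell), t.out .d = true →
    t.out (.outw s k) = true → t = .hit s := by decide +kernel

theorem out_outw : ∀ (s : Side) (k : ZMod 3) (t : Cell), t.out (.outw s k) = true →
    t = .par (.outw s (k - 1)) ∨ t = .hit s := by decide +kernel

theorem out_inw_sep : ∀ (s : Side) (t : Cell), t.out (.inw s) = true →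
    t.out (.sep s) = true → ∃ r, t = .apex r 0 := by decide +kernel

theorem out_inw : ∀ (s : Side) (t : Cell), t.out (.inw s) = true →
    t = .par (.inw s) ∨ ∃ r, t = .apex r 0 := by decide +kernel

theorem out_inw_facing : ∀ (s : Side) (t u : Cell), t.out (.inw s) = true →
    u.out (.sep s) = true → t.col s = u.col s.opp → t = .par (.inw s) ∧ u = .par (.sep s) := by
  decide +kernel

theorem out_outw_facing : ∀ (s : Side) (k : ZMod 3) (t u : Cell), t.out (.outw s k) = true →
    u.out (.sep s) = true → t.col s = u.col s.opp → u = .par (.sep s) := by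
  decide +kernel

theorem inn_par {p r : Par} (h : (Cell.par p).inn r = true) : r = p := by
  simpa [Cell.inn, eq_comm] using h

theorem inn_apex {s : Side} {k : ZMod 3} {r : Par} (h : (Cell.apex s k).inn r = true) :
    r = .sep s ∨ r = .outw s k := by simpa [Cell.inn] using h

theorem inn_hit {s : Side} {r : Par} (h : (Cell.hit s).inn r = true) :
    r = .d ∨ r = .inw s := by simpa [Cell.inn] using h

/-- One step up along a returning signal and the `d`-line next to it. -/
theorem Valid.dish_outw_up (hc : Valid c) {s : Side} {x y h : ℤ} {k : ZMod 3}
    (hx : Dish s (c x h)) (hy : c y h = .par (.outw s k) ∨ c y h = .apex s k)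
    (hxy : 0 < s.sg * (y - x)) (hcl : Clear c h s x y) :
    (y - s.sg * s.outSpeed = x ∧ c x (h + 1) = .hit s) ∨
    (c (y - s.sg * s.outSpeed) (h + 1) = .par (.outw s (k - 1)) ∧
      0 < s.sg * (y - s.sg * s.outSpeed - x) ∧
      Clear c (h + 1) s x (y - s.sg * s.outSpeed) ∧ Dish s (c x (h + 1))) := by
  have hiy : (c y h).inn (.outw s k) = true := by rcases hy with hy | hy <;> simp [hy, Cell.inn]
  have ev : (Par.outw s k).vel = s.sg * s.outSpeed := by cases s <;> rfl
  have od : (c x (h + 1)).out .d = true := by simpa [Par.vel] using hc.pred hx.inn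
  have oo := hc.pred hiy
  rw [ev] at oo
  by_cases he : x = y - s.sg * s.outSpeed
  · rw [← he] at oo
    exact .inl ⟨he.symm, out_d_outw _ _ _ od oo⟩
  right
  have hpos : 0 < s.sg * (y - s.sg * s.outSpeed - x) := by
    refine s.sg_pos he ?_
    by_contra! hlt
    have := hc.order (s := s) (by linarith) oo od
    rw [ev] at this
    simp only [Par.vel] at this
    linarith
  have ht : c (y - s.sg * s.outSpeed) (h + 1) = .par (.outw s (k - 1)) := by
    rcases out_outw _ _ _ oo with h1 | h1
    · exact h1
    · have := hc.succ (x := y - s.sg * s.outSpeed) (h := h) (p := .d) (by rw [h1]; rfl)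
      simp only [Par.vel, add_zero] at this
      have hb := hcl _ hpos (by cases s <;> simp [Side.sg, Side.outSpeed])
      rw [not_blank_of_inn _ _ this] at hb
      cases hb
  have hclu := hc.clear_up (s := s) (p := .d) (q := .outw s k) hx.inn hiy
    (fun r hr => .inl (by have := hx.vel_le hr; rw [vel_d]; linarith))
    (fun r hr => .inr (by
      rcases hy with hy | hy
      · rw [hy] at hr; rw [inn_par hr]
      · rw [hy] at hr
        rcases inn_apex hr with rfl | rfl
        · cases s <;> simp [Side.sg, Par.vel]
          omega
        · exact le_rfl)) hcl
    (.inr (by rw [ev, ht]; cases s <;> simp [Cell.col, Side.opp]))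
  rw [ev] at hclu
  simp only [Par.vel, sub_zero] at hclu
  refine ⟨ht, hpos, hclu, dish_of_out _ _ od ?_⟩
  rw [hc.col_eq hpos hclu, ht]
  cases s <;> simp [Cell.col, Side.opp]

/-- One step up along a returning signal and the line `sep s` in front of it. -/
theorem Valid.outw_sep_up (hc : Valid c) {s : Side} {x y h : ℤ} {k : ZMod 3}
    (hxy : (c x h = .par (.outw s k) ∧ c y h = .par (.sep s) ∧ 0 < s.sg * (y - x)) ∨
      (x = y ∧ c x h = .apex s k)) (hcl : Clear c h s x y) :
    (c (x - s.sg * s.outSpeed) (h + 1) = .par (.outw s (k - 1)) ∨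
      c (x - s.sg * s.outSpeed) (h + 1) = .hit s) ∧
    c (y + s.sg * s.slope) (h + 1) = .par (.sep s) ∧
    0 < s.sg * (y + s.sg * s.slope - (x - s.sg * s.outSpeed)) ∧
    Clear c (h + 1) s (x - s.sg * s.outSpeed) (y + s.sg * s.slope) := by
  have ev : (Par.outw s k).vel = s.sg * s.outSpeed := by cases s <;> rfl
  have ew : (Par.sep s).vel = - (s.sg * s.slope) := by cases s <;> rfl
  have hix : (c x h).inn (.outw s k) = true := by
    rcases hxy with hy | ⟨rfl, hy⟩ <;> simp [hy, Cell.inn]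
  have hiy : (c y h).inn (.sep s) = true := by
    rcases hxy with hy | ⟨rfl, hy⟩ <;> simp [hy, Cell.inn]
  have oo := hc.pred hix
  have os := hc.pred hiy
  rw [ev] at oo
  rw [ew, sub_neg_eq_add] at os
  have hpos : 0 < s.sg * (y + s.sg * s.slope - (x - s.sg * s.outSpeed)) := by
    have : 0 ≤ s.sg * (y - x) := by
      rcases hxy with hy | ⟨rfl, hy⟩
      · exact hy.2.2.le
      · simp
    cases s <;> simp only [Side.sg, Side.slope, Side.outSpeed] at * <;> omega
  have hclu := hc.clear_up (s := s) hix hiy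
    (fun r hr => by
      rcases hxy with hy | ⟨rfl, hy⟩
      · rw [hy.1] at hr; rw [inn_par hr]; exact .inl le_rfl
      · rw [hy] at hr
        rcases inn_apex hr with rfl | rfl
        · exact .inr le_rfl
        · exact .inl le_rfl)
    (fun r hr => by
      rcases hxy with hy | ⟨rfl, hy⟩
      · rw [hy.2.1] at hr; rw [inn_par hr]; exact .inr le_rfl
      · rw [hy] at hr
        rcases inn_apex hr with rfl | rfl
        · exact .inr le_rfl
        · exact .inl le_rfl) hcl
    (.inl (by
      rw [ev]
      rcases out_outw _ _ _ oo with h1 | h1 <;> rw [h1] <;> cases s <;> simp [Cell.col]))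
  rw [ev, ew, sub_neg_eq_add] at hclu
  exact ⟨out_outw _ _ _ oo, out_outw_facing _ _ _ _ oo os (hc.col_eq hpos hclu), hpos, hclu⟩

/-- One step up along an incoming signal and the line `sep s` from which it comes. -/
theorem Valid.inw_sep_up (hc : Valid c) {s : Side} {x y h : ℤ}
    (hx : c x h = .par (.inw s) ∨ c x h = .hit s) (hy : c y h = .par (.sep s))
    (hxy : 0 < s.sg * (y - x)) (hcl : Clear c h s x y) :
    (x + s.sg * s.inSpeed = y + s.sg * s.slope ∧
      ∃ r, c (x + s.sg * s.inSpeed) (h + 1) = .apex r 0) ∨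
    (c (x + s.sg * s.inSpeed) (h + 1) = .par (.inw s) ∧
      c (y + s.sg * s.slope) (h + 1) = .par (.sep s) ∧
      0 < s.sg * (y + s.sg * s.slope - (x + s.sg * s.inSpeed)) ∧
      Clear c (h + 1) s (x + s.sg * s.inSpeed) (y + s.sg * s.slope)) := by
  have ev : (Par.inw s).vel = - (s.sg * s.inSpeed) := by cases s <;> rfl
  have ew : (Par.sep s).vel = - (s.sg * s.slope) := by cases s <;> rfl
  have hix : (c x h).inn (.inw s) = true := by rcases hx with hx | hx <;> simp [hx, Cell.inn]
  have hiy : (c y h).inn (.sep s) = true := by simp [hy, Cell.inn]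
  have oi := hc.pred hix
  have os := hc.pred hiy
  rw [ev, sub_neg_eq_add] at oi
  rw [ew, sub_neg_eq_add] at os
  by_cases he : x + s.sg * s.inSpeed = y + s.sg * s.slope
  · rw [← he] at os
    exact .inl ⟨he, out_inw_sep _ _ oi os⟩
  right
  have hpos : 0 < s.sg * (y + s.sg * s.slope - (x + s.sg * s.inSpeed)) := by
    refine s.sg_pos he ?_
    by_contra! hlt
    have := hc.order (s := s) (by linarith) os oi
    rw [ev, ew] at this
    linarith
  have hclu := hc.clear_up (s := s) hix hiy
    (fun r hr => by
      rcases hx with hx | hx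
      · rw [hx] at hr; rw [inn_par hr]; exact .inl le_rfl
      · rw [hx] at hr
        rcases inn_hit hr with rfl | rfl
        · left; cases s <;> simp [Side.sg, Par.vel]
        · exact .inl le_rfl)
    (fun r hr => by rw [hy] at hr; rw [inn_par hr]; exact .inr le_rfl) hcl
    (.inl (by
      rw [ev, sub_neg_eq_add]
      rcases out_inw _ _ oi with h1 | ⟨r, h1⟩ <;> rw [h1] <;> cases s <;>
        simp [Cell.col]))
  rw [ev, ew, sub_neg_eq_add, sub_neg_eq_add] at hclu
  have := out_inw_facing _ _ _ oi os (hc.col_eq hpos hclu)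
  exact ⟨this.1, this.2, hpos, hclu⟩

/-- One step up along a `d`-line and the incoming signal next to it. -/
theorem Valid.dish_inw_up (hc : Valid c) {s : Side} {x y h : ℤ}
    (hxy : (Dish s (c x h) ∧ c y h = .par (.inw s) ∧ 0 < s.sg * (y - x)) ∨
      (x = y ∧ c x h = .hit s)) (hcl : Clear c h s x y) :
    Dish s (c x (h + 1)) ∧ Clear c (h + 1) s x (y + s.sg * s.inSpeed) := by
  have ev : (Par.inw s).vel = - (s.sg * s.inSpeed) := by cases s <;> rfl
  have hix : (c x h).inn .d = true := by
    rcases hxy with hy | hy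
    · exact hy.1.inn
    · simp [hy.2, Cell.inn]
  have hiy : (c y h).inn (.inw s) = true := by
    rcases hxy with hy | ⟨rfl, hy⟩ <;> simp [hy, Cell.inn]
  have od : (c x (h + 1)).out .d = true := by simpa [Par.vel] using hc.pred hix
  have oi := hc.pred hiy
  rw [ev, sub_neg_eq_add] at oi
  have hpos : 0 < s.sg * (y + s.sg * s.inSpeed - x) := by
    have : 0 ≤ s.sg * (y - x) := by
      rcases hxy with hy | ⟨rfl, hy⟩
      · exact hy.2.2.le
      · simp
    cases s <;> simp only [Side.sg, Side.inSpeed] at * <;> omega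
  have hclu := hc.clear_up (s := s) hix hiy
    (fun r hr => by
      rcases hxy with hy | ⟨rfl, hy⟩
      · left; have := hy.1.vel_le hr; rw [vel_d]; linarith
      · rw [hy] at hr
        rcases inn_hit hr with rfl | rfl
        · exact .inl le_rfl
        · exact .inr le_rfl)
    (fun r hr => by
      rcases hxy with hy | ⟨rfl, hy⟩
      · rw [hy.2.1] at hr; rw [inn_par hr]; exact .inr le_rfl
      · rw [hy] at hr
        rcases inn_hit hr with rfl | rfl
        · exact .inl le_rfl
        · exact .inr le_rfl) hcl
    (.inr (by
      rw [ev, sub_neg_eq_add]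
      rcases out_inw _ _ oi with h1 | ⟨r, h1⟩ <;> rw [h1] <;> cases s <;>
        simp [Cell.col, Side.opp]))
  rw [ev, sub_neg_eq_add] at hclu
  simp only [Par.vel, sub_zero] at hclu
  refine ⟨dish_of_out _ _ od ?_, hclu⟩
  rw [hc.col_eq hpos hclu]
  rcases out_inw _ _ oi with h1 | ⟨r, h1⟩ <;> rw [h1] <;> cases s <;> simp [Cell.col, Side.opp]

/-- A returning signal between a `d`-line and a line `sep s`, followed upwards to the point where it
was reflected. -/
theorem Valid.exists_hit (hc : Valid c) {s : Side} {x : ℤ} (m : ℕ) :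
    ∀ {y z h : ℤ} {k : ZMod 3}, s.sg * (y - x) ≤ m → Dish s (c x h) → 0 < s.sg * (y - x) →
    Clear c h s x y → ((c y h = .par (.outw s k) ∧ c z h = .par (.sep s) ∧ 0 < s.sg * (z - y)) ∨
      (y = z ∧ c y h = .apex s k)) → Clear c h s y z →
    ∃ n : ℕ, 1 ≤ n ∧ y = x + s.sg * (s.outSpeed * n) ∧ c x (h + n) = .hit s ∧
      Clear c (h + n) s x (z + s.sg * (s.slope * n)) ∧
      (∀ j : ℕ, j ≤ n → (c x (h + j)).inn .d = true) ∧
      (∀ j : ℕ, 1 ≤ j → j ≤ n → c (z + s.sg * (s.slope * j)) (h + j) = .par (.sep s)) := by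
  induction m with
  | zero => intro y z h k h1 _ h2; push_cast at h1; omega
  | succ m ih =>
    intro y z h k hm hd hpos hcl hyz hcl'
    obtain ⟨u1, u2, u3, u4⟩ := hc.outw_sep_up hyz hcl'
    have hy : c y h = .par (.outw s k) ∨ c y h = .apex s k := by
      rcases hyz with h1 | h1
      · exact .inl h1.1
      · exact .inr h1.2
    rcases hc.dish_outw_up hd hy hpos hcl with ⟨v1, v2⟩ | ⟨v1, v2, v3, v4⟩
    · refine ⟨1, le_rfl, by push_cast; linarith, by exact_mod_cast v2, ?_, ?_, ?_⟩
      · rw [v1] at u4; simpa using u4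
      · intro j hj
        interval_cases j
        · simpa using hd.inn
        · rw [Nat.cast_one, v2]; rfl
      · intro j h1 h2
        obtain rfl : j = 1 := by omega
        simpa using u2
    · obtain ⟨n, n1, n2, n3, n4, n5, n6⟩ := ih (y := y - s.sg * s.outSpeed)
        (z := z + s.sg * s.slope) (h := h + 1) (k := k - 1)
        (by cases s <;> simp only [Side.sg, Side.outSpeed] at * <;> push_cast at hm <;> omega)
        v4 v2 v3 (.inl ⟨v1, u2, u3⟩) u4
      have eh : ∀ j : ℕ, h + ((j + 1 : ℕ) : ℤ) = h + 1 + j := fun j => by push_cast; ring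
      have ez : ∀ j : ℕ, z + s.sg * (s.slope * ((j + 1 : ℕ) : ℤ)) =
        z + s.sg * s.slope + s.sg * (s.slope * j) := fun j => by push_cast; ring
      refine ⟨n + 1, by omega, by push_cast; linarith, by rw [eh]; exact n3,
        by rw [eh, ez]; exact n4, ?_, ?_⟩
      · rintro (_ | j) hj
        · simpa using hd.inn
        · rw [eh]; exact n5 j (by omega)
      · rintro (_ | j) h1 h2
        · omega
        · rw [eh, ez]
          rcases Nat.eq_zero_or_pos j with rfl | hj
          · simpa using u2
          · exact n6 j hj (by omega)

/-- An incoming signal between a `d`-line and a line `sep s`, followed upwards to the apex from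
which it comes. -/
theorem Valid.exists_apex (hc : Valid c) {s : Side} {x : ℤ} (m : ℕ) :
    ∀ {y z h : ℤ}, s.sg * (z - y) ≤ m → 0 < s.sg * (z - y) →
    ((Dish s (c x h) ∧ c y h = .par (.inw s) ∧ 0 < s.sg * (y - x)) ∨
      (x = y ∧ c x h = .hit s)) → Clear c h s x y → c z h = .par (.sep s) → Clear c h s y z →
    ∃ n : ℕ, 1 ≤ n ∧ y + s.sg * (s.inSpeed * n) = z + s.sg * (s.slope * n) ∧
      (∃ r, c (y + s.sg * (s.inSpeed * n)) (h + n) = .apex r 0) ∧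
      Dish s (c x (h + n)) ∧ Clear c (h + n) s x (y + s.sg * (s.inSpeed * n)) ∧
      (∀ j : ℕ, j ≤ n → (c x (h + j)).inn .d = true) ∧
      (∀ j : ℕ, j < n → c (z + s.sg * (s.slope * j)) (h + j) = .par (.sep s)) := by
  induction m with
  | zero => intro y z h h1 h2; push_cast at h1; omega
  | succ m ih =>
    intro y z h hm hpos hxy hcl hz hcl'
    obtain ⟨u1, u2⟩ := hc.dish_inw_up hxy hcl
    have hi : (c x h).inn .d = true := by
      rcases hxy with h1 | h1
      · exact h1.1.inn
      · rw [h1.2]; simp [Cell.inn]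
    have hy : c y h = .par (.inw s) ∨ c y h = .hit s := by
      rcases hxy with h1 | h1
      · exact .inl h1.2.1
      · rw [← h1.1]; exact .inr h1.2
    rcases hc.inw_sep_up hy hz hpos hcl' with ⟨v1, r, v2⟩ | ⟨v1, v2, v3, v4⟩
    · refine ⟨1, le_rfl, by push_cast; linarith, ⟨r, by simpa using v2⟩, by exact_mod_cast u1,
        by simpa using u2, ?_, ?_⟩
      · intro j hj
        interval_cases j
        · simpa using hi
        · exact_mod_cast u1.inn
      · intro j hj
        obtain rfl : j = 0 := by omega
        simpa using hz
    · have hpos' : 0 < s.sg * (y + s.sg * s.inSpeed - x) := by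
        have : 0 ≤ s.sg * (y - x) := by
          rcases hxy with hy | ⟨rfl, hy⟩
          · exact hy.2.2.le
          · simp
        cases s <;> simp only [Side.sg, Side.inSpeed] at * <;> omega
      obtain ⟨n, n1, n2, ⟨r, n3⟩, n4, n5, n6, n7⟩ := ih (y := y + s.sg * s.inSpeed)
        (z := z + s.sg * s.slope) (h := h + 1)
        (by cases s <;> simp only [Side.sg, Side.inSpeed, Side.slope] at * <;> push_cast at hm <;>
              omega)
        v3 (.inl ⟨u1, v1, hpos'⟩) u2 v2 v4
      have eh : ∀ j : ℕ, h + ((j + 1 : ℕ) : ℤ) = h + 1 + j := fun j => by push_cast; ring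
      have ez : ∀ j : ℕ, z + s.sg * (s.slope * ((j + 1 : ℕ) : ℤ)) =
        z + s.sg * s.slope + s.sg * (s.slope * j) := fun j => by push_cast; ring
      have ey : ∀ j : ℕ, y + s.sg * (s.inSpeed * ((j + 1 : ℕ) : ℤ)) =
        y + s.sg * s.inSpeed + s.sg * (s.inSpeed * j) := fun j => by push_cast; ring
      refine ⟨n + 1, by omega, by rw [ey, ez]; exact n2, ⟨r, by rw [ey, eh]; exact n3⟩,
        by rw [eh]; exact n4, by rw [eh, ey]; exact n5, ?_, ?_⟩
      · rintro (_ | j) hj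
        · simpa using hi
        · rw [eh]; exact n6 j (by omega)
      · rintro (_ | j) h1
        · simpa using hz
        · rw [eh, ez]; exact n7 j (by omega)

/-- An apex with a `d`-line on its inner side has a parent: the apex at which the signal arriving at
it has been sent out. -/
theorem Valid.exists_parent (hc : Valid c) {s : Side} {x y h : ℤ} {k : ZMod 3}
    (hy : c y h = .apex s k) (hx : Dish s (c x h)) (hxy : 0 < s.sg * (y - x))
    (hcl : Clear c h s x y) :
    ∃ n : ℕ, 1 ≤ n ∧ y = x + s.sg * (s.outSpeed * n) ∧
      (∃ r, c (x + s.sg * (s.inSpeed * n)) (h + 2 * n) = .apex r 0) ∧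
      Dish s (c x (h + 2 * n)) ∧ Clear c (h + 2 * n) s x (x + s.sg * (s.inSpeed * n)) ∧
      (∀ j : ℕ, j ≤ 2 * n → (c x (h + j)).inn .d = true) ∧
      (∀ j : ℕ, 1 ≤ j → j < 2 * n →
        c (y + s.sg * (s.slope * j)) (h + j) = .par (.sep s)) := by
  -- The signal `outw s k` that ends at the apex starts at the `d`-line `n` rows higher, where the
  -- signal `inw s` arrives that was sent out by the parent, another `m = n` rows higher.
  obtain ⟨n, n1, n2, n3, n4, n5, n6⟩ := hc.exists_hit (s.sg * (y - x)).toNat (z := y) (k := k)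
    (by omega) hx hxy hcl (.inr ⟨rfl, hy⟩) (fun z h1 h2 => by linarith)
  have hn : (1 : ℤ) ≤ n := by exact_mod_cast n1
  have hpos : 0 < s.sg * (y + s.sg * (s.slope * n) - x) := by
    cases s <;> simp only [Side.sg, Side.slope, Side.outSpeed] at * <;> omega
  obtain ⟨m, m1, m2, ⟨r, m3⟩, m4, m5, m6, m7⟩ := hc.exists_apex (x := x) (y := x)
    (z := y + s.sg * (s.slope * n)) (h := h + n) _ (Int.self_le_toNat _) hpos
    (.inr ⟨rfl, n3⟩) (fun z h1 h2 => by linarith) (n6 n n1 le_rfl) n4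
  obtain rfl : m = n := by
    rw [n2] at m2
    cases s <;> simp only [Side.sg, Side.slope, Side.outSpeed, Side.inSpeed] at m2 <;> omega
  have eh : h + m + m = h + 2 * m := by ring
  rw [eh] at m3 m4 m5
  refine ⟨m, n1, n2, ⟨r, m3⟩, m4, m5, ?_, ?_⟩
  · intro j hj
    by_cases hle : j ≤ m
    · exact n5 j hle
    · have := m6 (j - m) (by omega)
      rwa [show h + (m : ℤ) + ((j - m : ℕ) : ℤ) = h + j by omega] at this
  · intro j h1 hj
    by_cases hle : j ≤ m
    · exact n6 j h1 hle
    · have := m7 (j - m) (by omega)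
      rw [show h + (m : ℤ) + ((j - m : ℕ) : ℤ) = h + j by omega] at this
      rw [← this]
      congr 1
      rw [show ((j - m : ℕ) : ℤ) = j - m by omega]
      ring

/-! ### Apexes between two `d`-lines -/

theorem dish_of_col_eq_near : ∀ (s : Side) (t : Cell), t.blank = false → t.col s = .near s →
    Dish s t := by
  unfold Dish; decide +kernel

theorem Dish.out_d : ∀ {s : Side} {t : Cell}, Dish s t → t.out .d = true := by
  unfold Dish; decide +kernel

theorem Par.vel_sep (s : Side) : (Par.sep s).vel = - (s.sg * s.slope) := by cases s <;> rfl

theorem Par.vel_outw (s : Side) (k : ZMod 3) : (Par.outw s k).vel = s.sg * s.outSpeed := by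
  cases s <;> rfl

theorem Side.slope_pos (s : Side) : 0 < s.slope := by cases s <;> decide

theorem Side.outSpeed_pos (s : Side) : 0 < s.outSpeed := by cases s <;> decide

/-- The neighbours of an apex are `d`-lines. -/
theorem Valid.apex_neighbour (hc : Valid c) {y h : ℤ} {r : Side} {k : ZMod 3}
    (hy : c y h = .apex r k) (s : Side) :
    ClearRay c h s y ∨ ∃ x, 0 < s.sg * (x - y) ∧ Dish s.opp (c x h) ∧ Clear c h s y x := by
  rcases clear_or_exists_first s y h (c := c) with h1 | ⟨x, h1, h2, h3⟩
  · exact .inl h1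
  · refine .inr ⟨x, h1, dish_of_col_eq_near _ _ h2 ?_, h3⟩
    rw [← hc.col_eq h1 h3, hy]
    rfl

/-- One step down along a line `sep s` and the `d`-line towards which it is directed at its upper
end. -/
theorem Valid.sep_dish_down (hc : Valid c) {s : Side} {x y h : ℤ}
    (hxy : (c x (h + 1) = .par (.sep s) ∧ Dish s.opp (c y (h + 1)) ∧ 0 < s.sg * (y - x)) ∨
      (x = y ∧ ∃ r, c y (h + 1) = .apex r 0)) (hcl : Clear c (h + 1) s x y) :
    (c y h).inn .d = true ∧ Clear c h s (x - s.sg * s.slope) y := by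
  have od : (c y (h + 1)).out .d = true := by
    rcases hxy with h1 | ⟨-, r, h1⟩
    · exact h1.2.1.out_d
    · rw [h1]; rfl
  have os : (c x (h + 1)).out (.sep s) = true := by
    rcases hxy with h1 | ⟨rfl, r, h1⟩
    · rw [h1.1]; simp [Cell.out]
    · rw [h1]; cases s <;> rfl
  refine ⟨by simpa [Par.vel] using hc.succ od, ?_⟩
  have aux : ∀ (r s : Side) (p : Par), (Cell.apex r 0).out p = true →
      s.sg * p.vel ≤ -s.slope ∨ 0 ≤ s.sg * p.vel := by decide +kernel
  have aux' : ∀ (s : Side) (t : Cell) (p : Par), Dish s.opp t → t.out p = true →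
      0 ≤ s.sg * p.vel := by unfold Dish; decide +kernel
  have := hc.clear_down (s := s) (p := .sep s) (q := .d) os od ?_ ?_ hcl
  · simpa [Par.vel_sep, vel_d, sub_eq_add_neg] using this
  · intro r hr
    rw [Par.vel_sep, vel_d]
    rcases hxy with h1 | ⟨rfl, u, h1⟩
    · rw [h1.1] at hr
      have : r = .sep s := by simpa [Cell.out, eq_comm] using hr
      rw [this, Par.vel_sep]
      exact .inl le_rfl
    · rw [h1] at hr
      rcases aux _ s _ hr with h2 | h2
      · left; cases s <;> simp only [Side.sg, Side.slope] at * <;> omega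
      · right; linarith
  · intro r hr
    rw [Par.vel_sep, vel_d]
    rcases hxy with h1 | ⟨rfl, u, h1⟩
    · right
      have := aux' s _ _ h1.2.1 hr
      linarith
    · rw [h1] at hr
      rcases aux _ s _ hr with h2 | h2
      · left; cases s <;> simp only [Side.sg, Side.slope] at * <;> omega
      · right; linarith

/-- The `d`-line at the upper end of a line `sep s` goes down at least as far as this line, and is
its neighbour. -/
theorem Valid.dish_of_sep (hc : Valid c) {s : Side} {X y h : ℤ} {N : ℕ}
    (hX : X = y + s.sg * (s.slope * N)) (htop : ∃ r, c X (h + N) = .apex r 0)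
    (hsep : ∀ j : ℕ, 1 ≤ j → j < N → c (y + s.sg * (s.slope * j)) (h + j) = .par (.sep s))
    (j : ℕ) (hj : j < N) :
    (c X (h + j)).inn .d = true ∧ Clear c (h + j) s (y + s.sg * (s.slope * j)) X := by
  obtain ⟨i, rfl⟩ : ∃ i, N = j + (i + 1) := ⟨N - j - 1, by omega⟩
  clear hj
  have e1 : ∀ j : ℕ, y + s.sg * (s.slope * ((j + 1 : ℕ) : ℤ)) - s.sg * s.slope =
    y + s.sg * (s.slope * j) := fun j => by push_cast; ring
  have e2 : ∀ j : ℕ, h + ((j + 1 : ℕ) : ℤ) = h + j + 1 := fun j => by push_cast; ring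
  induction i generalizing j with
  | zero =>
    have := hc.sep_dish_down (s := s) (x := X) (y := X) (h := h + j) (.inr ⟨rfl, by
      rw [← e2]; exact htop⟩) (fun z h1 h2 => by linarith)
    rw [zero_add] at hX
    nth_rw 2 [hX] at this
    rwa [e1] at this
  | succ i ih =>
    have e3 : j + (i + 1 + 1) = j + 1 + (i + 1) := by omega
    rw [e3] at hX htop hsep
    obtain ⟨h1, h2⟩ := ih (j + 1) hX htop hsep
    have hs := hsep (j + 1) (by omega) (by omega)
    have hpos : 0 < s.sg * (X - (y + s.sg * (s.slope * ((j + 1 : ℕ) : ℤ)))) := by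
      rw [hX]; push_cast
      cases s <;> simp only [Side.sg, Side.slope] <;> omega
    have hd : Dish s.opp (c X (h + ((j + 1 : ℕ) : ℤ))) := by
      refine dish_of_col_eq_near _ _ (not_blank_of_inn _ _ h1) ?_
      rw [← hc.col_eq hpos h2, hs]
      simp [Cell.col]
    have := hc.sep_dish_down (s := s) (h := h + j) (.inl ⟨by rw [← e2]; exact hs,
      by rw [← e2]; exact hd, hpos⟩) (by rw [← e2]; exact h2)
    rwa [e1] at this

/-- An apex, in column `x` and row `h`, that lies between two neighbouring `d`-lines, at distances
`t` to the left and `2 * t` to the right. It is the apex of a triangle of height `t`, which has its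
base in row `h - t` and its corners on these `d`-lines. -/
structure Node (c : ℤ → ℤ → Cell) (x h t : ℤ) : Prop where
  pos : 0 < t
  apex : ∃ s k, c x h = .apex s k
  left : Dish R (c (x - t) h)
  left_clear : Clear c h L x (x - t)
  right : Dish L (c (x + 2 * t) h)
  right_clear : Clear c h R x (x + 2 * t)

theorem Clear.unique {s : Side} {x y z h : ℤ} (h1 : Clear c h s x y) (h2 : Clear c h s x z)
    (hy : 0 < s.sg * (y - x)) (hz : 0 < s.sg * (z - x)) (by_ : (c y h).blank = false)
    (bz : (c z h).blank = false) : y = z := by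
  by_contra hne
  rcases lt_or_ge (s.sg * y) (s.sg * z) with h3 | h3
  · have := h2 y hy (by linarith)
    simp [this] at by_
  · have := h1 z hz (by have := s.sg_pos (Ne.symm hne) (by linarith); linarith)
    simp [this] at bz

/-- The height of a node is determined by its place. -/
theorem Node.unique {x h t t' : ℤ} (h1 : Node c x h t) (h2 : Node c x h t') : t = t' := by
  have p1 := h1.pos
  have p2 := h2.pos
  have := h1.left_clear.unique h2.left_clear (by simp only [Side.sg]; omega)
    (by simp only [Side.sg]; omega) h1.left.not_blank h2.left.not_blank
  omega

theorem sub_pos_of_sg {s : Side} {x k : ℤ} (hk : 0 < k) : 0 < s.sg * (x + s.sg * k - x) := by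
  rw [mul_sub, s.sg_mul_add]; linarith

/-- An apex with a `d`-line on its inner side lies between two `d`-lines. -/
theorem Valid.exists_node (hc : Valid c) {s : Side} {x y h : ℤ} {k : ZMod 3}
    (hy : c y h = .apex s k) (hx : Dish s (c x h)) (hxy : 0 < s.sg * (y - x))
    (hcl : Clear c h s x y) :
    ∃ n : ℕ, 1 ≤ n ∧ y = x + s.sg * (s.outSpeed * n) ∧
      Dish s.opp (c (x + s.sg * (s.inSpeed * n)) h) ∧
      Clear c h s y (x + s.sg * (s.inSpeed * n)) ∧
      (∃ r, c (x + s.sg * (s.inSpeed * n)) (h + 2 * n) = .apex r 0) ∧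
      Dish s (c x (h + 2 * n)) ∧ Clear c (h + 2 * n) s x (x + s.sg * (s.inSpeed * n)) ∧
      (∀ j : ℕ, j ≤ 2 * n → (c x (h + j)).inn .d = true) ∧
      (∀ j : ℕ, j < 2 * n → (c (x + s.sg * (s.inSpeed * n)) (h + j)).inn .d = true) := by
  obtain ⟨n, n1, n2, n3, n4, n5, n6, n7⟩ := hc.exists_parent hy hx hxy hcl
  have e : y + s.sg * (s.slope * ((2 * n : ℕ) : ℤ)) = x + s.sg * (s.inSpeed * n) := by
    rw [n2]
    cases s <;> simp only [Side.sg, Side.slope, Side.outSpeed, Side.inSpeed] <;> push_cast <;> ring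
  have hd := hc.dish_of_sep (s := s) (N := 2 * n) e.symm (by exact_mod_cast n3) n7
  have h0 := hd 0 (by omega)
  simp only [Nat.cast_zero, mul_zero, add_zero] at h0
  refine ⟨n, n1, n2, dish_of_col_eq_near _ _ (not_blank_of_inn _ _ h0.1) ?_, h0.2, n3, n4, n5, n6,
    fun j hj => (hd j hj).1⟩
  rw [← hc.col_eq ?_ h0.2, hy]
  · rfl
  · rw [← e]
    apply sub_pos_of_sg
    have := s.slope_pos
    positivity

/-! ### Parents of triangles -/

theorem event_of_blank : ∀ t : Cell, t.blank = true → t.event = false := by decide +kernel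

/-- The signals meeting at an apex whose inner side is empty have come from infinity. -/
theorem Valid.outw_sep_ray (hc : Valid c) {s : Side} {y h : ℤ} {k : ZMod 3}
    (hy : c y h = .apex s k) (hcl : ClearRay c h s.opp y) (n : ℕ) :
    (c (y - s.sg * (s.outSpeed * (n + 1))) (h + (n + 1)) =
      .par (.outw s (k - ((n + 1 : ℕ) : ZMod 3))) ∧
    c (y + s.sg * (s.slope * (n + 1))) (h + (n + 1)) = .par (.sep s)) ∧
    Clear c (h + (n + 1)) s (y - s.sg * (s.outSpeed * (n + 1)))
      (y + s.sg * (s.slope * (n + 1))) ∧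
    ClearRay c (h + (n + 1)) s.opp (y - s.sg * (s.outSpeed * (n + 1))) := by
  have key : ∀ {x z h : ℤ} {k : ZMod 3},
      (c x h = .par (.outw s k) ∧ c z h = .par (.sep s) ∧ 0 < s.sg * (z - x)) ∨
      (x = z ∧ c x h = .apex s k) → Clear c h s x z → ClearRay c h s.opp x →
      (c (x - s.sg * s.outSpeed) (h + 1) = .par (.outw s (k - 1)) ∧
      c (z + s.sg * s.slope) (h + 1) = .par (.sep s)) ∧
      Clear c (h + 1) s (x - s.sg * s.outSpeed) (z + s.sg * s.slope) ∧
      ClearRay c (h + 1) s.opp (x - s.sg * s.outSpeed) := by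
    intro x z h k hxz h1 h2
    obtain ⟨u1, u2, u3, u4⟩ := hc.outw_sep_up hxz h1
    have hx : c x h = .par (.outw s k) ∨ c x h = .apex s k := by
      rcases hxz with h1 | h1
      · exact .inl h1.1
      · exact .inr h1.2
    have u1' : c (x - s.sg * s.outSpeed) (h + 1) = .par (.outw s (k - 1)) := by
      refine u1.resolve_right fun hh => ?_
      have := hc.succ (p := .d) (h := h) (x := x - s.sg * s.outSpeed) (by rw [hh]; rfl)
      rw [vel_d, add_zero] at this
      have hb := h2 (x - s.sg * s.outSpeed) (by cases s <;> simp [Side.opp, Side.sg, Side.outSpeed])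
      rw [not_blank_of_inn _ _ this] at hb
      cases hb
    refine ⟨⟨u1', u2⟩, u4, ?_⟩
    have := hc.clearRay_up (s := s.opp) (x := x) (h := h) (p := .outw s k)
      (by rcases hx with h1 | h1 <;> rw [h1] <;> simp [Cell.inn]) ?_ h2
      (by rw [Par.vel_outw, u1']; cases s <;> simp [Cell.col, Side.opp])
    · rwa [Par.vel_outw] at this
    · intro r hr
      rcases hx with h1 | h1
      · rw [h1] at hr
        rw [inn_par hr]
      · rw [h1] at hr
        rcases inn_apex hr with rfl | rfl
        · cases s <;> simp [Side.opp, Side.sg, Par.vel]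
          omega
        · exact le_rfl
  induction n with
  | zero =>
    have := key (.inr ⟨rfl, hy⟩) (fun z h1 h2 => by linarith) hcl
    simpa using this
  | succ n ih =>
    obtain ⟨h1, h2, h3⟩ := ih
    have := key (.inl ⟨h1.1, h1.2, ?_⟩) h2 h3
    · have e1 : y - s.sg * (s.outSpeed * (((n + 1 : ℕ) : ℤ) + 1)) =
        y - s.sg * (s.outSpeed * (n + 1)) - s.sg * s.outSpeed := by push_cast; ring
      have e2 : y + s.sg * (s.slope * (((n + 1 : ℕ) : ℤ) + 1)) =
        y + s.sg * (s.slope * (n + 1)) + s.sg * s.slope := by push_cast; ring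
      have e3 : h + (((n + 1 : ℕ) : ℤ) + 1) = h + (n + 1) + 1 := by push_cast; ring
      have e4 : k - ((n + 1 + 1 : ℕ) : ZMod 3) = k - ((n + 1 : ℕ) : ZMod 3) - 1 := by
        push_cast; ring
      rw [e1, e2, e3, e4]
      exact this
    · cases s <;> simp only [Side.sg, Side.slope, Side.outSpeed] <;> omega

/-- If the inner side of an apex is empty, then so is its outer side, and there are no events
above. -/
theorem Valid.no_event_above (hc : Valid c) {s : Side} {y h : ℤ} {k : ZMod 3}
    (hy : c y h = .apex s k) (hcl : ClearRay c h s.opp y) :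
    ClearRay c h s y ∧ ∀ h' z, h < h' → (c z h').event = false := by
  have hray := hc.outw_sep_ray hy hcl
  -- a `d`-line on side `s` would meet the line `sep s`, which comes from infinity
  have hcl' : ClearRay c h s y := by
    refine (hc.apex_neighbour hy s).resolve_right ?_
    rintro ⟨x, x1, x2, x3⟩
    have key : ∀ n : ℕ, (∀ r, (c (y + s.sg * (s.slope * n)) (h + n)).inn r = true →
          s.sg * (y + s.sg * (s.slope * n) - r.vel) ≤
            s.sg * (y + s.sg * (s.slope * n) + s.sg * s.slope)) ∧
        (c (y + s.sg * (s.slope * n)) (h + n)).inn (.sep s) = true ∧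
        Dish s.opp (c x (h + n)) ∧ 0 < s.sg * (x - (y + s.sg * (s.slope * n))) ∧
        Clear c (h + n) s (y + s.sg * (s.slope * n)) x := by
      intro n
      induction n with
      | zero =>
        simp only [Nat.cast_zero, mul_zero, add_zero]
        refine ⟨fun r hr => ?_, by rw [hy]; simp [Cell.inn], x2, x1, x3⟩
        rw [hy] at hr
        rcases inn_apex hr with rfl | rfl <;> cases s <;>
          simp [Side.sg, Par.vel, Side.slope]
        omega
      | succ n ih =>
        obtain ⟨i1, i2, i3, i4, i5⟩ := ih
        obtain ⟨⟨-, h2⟩, -⟩ := hray n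
        have e1 : y + s.sg * (s.slope * ((n + 1 : ℕ) : ℤ)) =
          y + s.sg * (s.slope * n) + s.sg * s.slope := by push_cast; ring
        have e2 : h + ((n + 1 : ℕ) : ℤ) = h + n + 1 := by push_cast; ring
        have e3 : y + s.sg * (s.slope * (n + 1)) =
          y + s.sg * (s.slope * n) + s.sg * s.slope := by ring
        rw [e3, ← add_assoc] at h2
        rw [e1, e2, h2]
        have od : (c x (h + n + 1)).out .d = true := by simpa [vel_d] using hc.pred i3.inn
        have hpos : 0 < s.sg * (x - (y + s.sg * (s.slope * n) + s.sg * s.slope)) := by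
          refine s.sg_pos ?_ ?_
          · intro he
            rw [← he, h2] at od
            simp [Cell.out] at od
          · by_contra! hlt
            have := hc.order (s := s) (q := .sep s)
              (y := y + s.sg * (s.slope * n) + s.sg * s.slope) (by linarith) od
              (by rw [h2]; simp [Cell.out])
            rw [vel_d, Par.vel_sep] at this
            linarith
        have hclu := hc.clear_up (s := s) (p := .sep s) (q := .d) i2 i3.inn
          (fun r hr => .inl (by
            rw [Par.vel_sep, sub_neg_eq_add]; exact i1 r hr))
          (fun r hr => .inr (by
            have := i3.vel_le hr
            rw [Side.sg_opp] at this
            rw [vel_d]; linarith)) i5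
          (.inl (by rw [Par.vel_sep, sub_neg_eq_add, h2]; simp [Cell.col]))
        rw [Par.vel_sep, sub_neg_eq_add, vel_d, sub_zero] at hclu
        refine ⟨fun r hr => ?_, by simp [Cell.inn], dish_of_out _ _ od ?_, hpos, hclu⟩
        · rw [inn_par hr, Par.vel_sep, sub_neg_eq_add]
        · rw [← hc.col_eq hpos hclu, h2]; simp [Cell.col]
    have h4 := (key (s.sg * (x - y)).toNat).2.2.2.1
    have := s.slope_pos
    have e : s.sg * (x - (y + s.sg * (s.slope * (s.sg * (x - y)).toNat))) =
      s.sg * (x - y) - s.slope * (s.sg * (x - y)).toNat := by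
      rw [← sub_sub, mul_sub _ (x - y), ← mul_assoc, s.sg_mul_sg, one_mul]
    rw [e] at h4
    nlinarith [Int.self_le_toNat (s.sg * (x - y))]
  refine ⟨hcl', ?_⟩
  have key : ∀ n : ℕ, ClearRay c (h + (n + 1)) s (y + s.sg * (s.slope * (n + 1))) := by
    intro n
    induction n with
    | zero =>
      have h2 := (hray 0).1.2
      simp only [Nat.cast_zero, zero_add, mul_one] at h2 ⊢
      have := hc.clearRay_up (p := .sep s) (by rw [hy]; simp [Cell.inn]) ?_ hcl' ?_
      · rwa [Par.vel_sep, sub_neg_eq_add] at this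
      · intro r hr
        rw [hy] at hr
        rcases inn_apex hr with rfl | rfl <;> cases s <;>
          simp [Side.sg, Par.vel]
        omega
      · rw [Par.vel_sep, sub_neg_eq_add, h2]; simp [Cell.col]
    | succ n ih =>
      have h1 := (hray n).1.2
      have h2 := (hray (n + 1)).1.2
      have e1 : y + s.sg * (s.slope * (((n + 1 : ℕ) : ℤ) + 1)) =
          y + s.sg * (s.slope * (n + 1)) + s.sg * s.slope := by push_cast; ring
      have e2 : h + (((n + 1 : ℕ) : ℤ) + 1) = h + (n + 1) + 1 := by push_cast; ring
      rw [e1, e2] at h2 ⊢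
      have := hc.clearRay_up (p := .sep s) (by rw [h1]; simp [Cell.inn]) ?_ ih ?_
      · rwa [Par.vel_sep, sub_neg_eq_add] at this
      · intro r hr
        rw [h1] at hr
        rw [inn_par hr]
      · rw [Par.vel_sep, sub_neg_eq_add, h2]; simp [Cell.col]
  intro h' z hlt
  obtain ⟨n, rfl⟩ : ∃ n : ℕ, h' = h + (n + 1) := ⟨(h' - h - 1).toNat, by omega⟩
  obtain ⟨⟨h1, h2⟩, h3, h4⟩ := hray n
  have h5 := key n
  set a := y - s.sg * (s.outSpeed * (n + 1))
  set b := y + s.sg * (s.slope * (n + 1))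
  by_cases ha : z = a
  · rw [ha, h1]; rfl
  by_cases hb : z = b
  · rw [hb, h2]; rfl
  apply event_of_blank
  rcases le_or_gt (s.sg * z) (s.sg * a) with l | l
  · refine h4 z ?_
    rw [Side.sg_opp]
    have := s.sg_pos ha (by linarith)
    linarith
  · rcases le_or_gt (s.sg * b) (s.sg * z) with m | m
    · exact h5 z (s.sg_pos (Ne.symm hb) (by linarith))
    · exact h3 z (by linarith) (by linarith)

/-- An apex with anything on its side `s` lies between two `d`-lines. -/
theorem Valid.exists_dish (hc : Valid c) {s r : Side} {y h : ℤ} {k : ZMod 3}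
    (hy : c y h = .apex r k) (hs : ¬ ClearRay c h s y) (u : Side) :
    ∃ x, 0 < u.sg * (x - y) ∧ Dish u.opp (c x h) ∧ Clear c h u y x := by
  have hin : ¬ ClearRay c h r.opp y := by
    intro hr
    have := (hc.no_event_above hy hr).1
    cases r <;> cases s <;> simp_all [Side.opp]
  obtain ⟨x, x1, x2, x3⟩ := (hc.apex_neighbour hy r.opp).resolve_left hin
  rw [Side.sg_opp] at x1
  rw [Side.opp_opp] at x2
  obtain ⟨n, n1, n2, n3, n4, -⟩ := hc.exists_node hy x2 (by linarith)
    (by simpa [Side.opp_opp] using x3.symm)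
  by_cases hu : u = r
  · subst hu
    refine ⟨_, ?_, n3, n4⟩
    rw [n2]
    have : (1 : ℤ) ≤ n := by exact_mod_cast n1
    cases u <;> simp only [Side.sg, Side.inSpeed, Side.outSpeed] <;> omega
  · obtain rfl : u = r.opp := by cases u <;> cases r <;> simp_all [Side.opp]
    refine ⟨x, by rw [Side.sg_opp]; linarith, by rwa [Side.opp_opp], x3⟩

/-- An apex with anything on one of its sides is a node. -/
theorem Valid.node_of_apex (hc : Valid c) {s r : Side} {x h : ℤ} {k : ZMod 3}
    (hx : c x h = .apex r k) (hs : ¬ ClearRay c h s x) :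
    ∃ t, Node c x h t := by
  obtain ⟨a, a1, a2, a3⟩ := hc.exists_dish hx hs r.opp
  rw [Side.sg_opp] at a1
  rw [Side.opp_opp] at a2
  obtain ⟨n, n1, n2, n3, n4, -⟩ := hc.exists_node hx a2 (by linarith)
    (by simpa [Side.opp_opp] using a3.symm)
  have n1' : (1 : ℤ) ≤ n := by exact_mod_cast n1
  cases r
  · simp only [Side.sg, Side.outSpeed, Side.inSpeed, Side.opp] at *
    refine ⟨4 * n, by omega, ⟨L, k, hx⟩, ?_, ?_, ?_, ?_⟩
    · rwa [show x - 4 * (n : ℤ) = a + -1 * (12 * n) by omega]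
    · rwa [show x - 4 * (n : ℤ) = a + -1 * (12 * n) by omega]
    · rwa [show x + 2 * (4 * (n : ℤ)) = a by omega]
    · rwa [show x + 2 * (4 * (n : ℤ)) = a by omega]
  · simp only [Side.sg, Side.outSpeed, Side.inSpeed, Side.opp] at *
    refine ⟨n, by omega, ⟨R, k, hx⟩, ?_, ?_, ?_, ?_⟩
    · rwa [show x - (n : ℤ) = a by omega]
    · rwa [show x - (n : ℤ) = a by omega]
    · rwa [show x + 2 * (n : ℤ) = a + 1 * (3 * n) by omega]
    · rwa [show x + 2 * (n : ℤ) = a + 1 * (3 * n) by omega]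

theorem Dish.not_clearRay {s r : Side} {x y h : ℤ} (hy : Dish r (c y h))
    (hxy : 0 < s.sg * (y - x)) : ¬ ClearRay c h s x := fun hcl => by
  have := hcl y hxy
  simp [hy.not_blank] at this

/-- The parent of a node of height `t`. If the node lies on the left side of its parent (the apex is
of kind `R`), the parent has height `3 * t`. If it lies on the right side (kind `L`), then `t` is
divisible by `4` and the parent has height `6 * (t / 4)`. -/
theorem Valid.node_step (hc : Valid c) {x h t : ℤ} (hn : Node c x h t) :
    ((∃ k, c x h = .apex R k) ∧ (∃ r, c (x + 2 * t) (h + 2 * t) = .apex r 0) ∧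
      Node c (x + 2 * t) (h + 2 * t) (3 * t) ∧
      (∀ g, h ≤ g → g ≤ h + 2 * t → (c (x - t) g).inn .d = true) ∧
      (∀ g, h ≤ g → g < h + 2 * t → (c (x + 2 * t) g).inn .d = true)) ∨
    (∃ n, t = 4 * n ∧ (∃ k, c x h = .apex L k) ∧
      Node c (x - t) (h + 2 * n) (6 * n) ∧
      (∀ g, h ≤ g → g ≤ h + 2 * n → (c (x + 2 * t) g).inn .d = true)) := by
  obtain ⟨r, k, hx⟩ := hn.apex
  have ht := hn.pos
  cases r
  · right
    obtain ⟨n, n1, n2, n3, n4, ⟨r, n5⟩, n6, n7, n8, n9⟩ := hc.exists_node (s := L) hx hn.right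
      (by simp only [Side.sg]; omega) hn.right_clear.symm
    have n1' : (1 : ℤ) ≤ n := by exact_mod_cast n1
    simp only [Side.sg, Side.outSpeed, Side.inSpeed, Side.opp] at *
    have e : x + 2 * t + -1 * (12 * n) = x - t := by omega
    rw [e] at n5 n7
    refine ⟨n, by omega, ⟨k, hx⟩, ?_, ?_⟩
    · obtain ⟨t', ht'⟩ := hc.node_of_apex (s := R) n5 (n6.not_clearRay (by simp [Side.sg]; omega))
      have h1 := ht'.right_clear.unique n7.symm (by have := ht'.pos; simp only [Side.sg]; omega)
        (by simp [Side.sg]; omega) ht'.right.not_blank n6.not_blank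
      obtain rfl : t' = 6 * n := by omega
      exact ht'
    · intro g g1 g2
      have := n8 (g - h).toNat (by omega)
      rwa [show h + ((g - h).toNat : ℤ) = g by omega] at this
  · left
    obtain ⟨n, n1, n2, n3, n4, ⟨r, n5⟩, n6, n7, n8, n9⟩ := hc.exists_node (s := R) hx hn.left
      (by simp only [Side.sg]; omega) hn.left_clear.symm
    have n1' : (1 : ℤ) ≤ n := by exact_mod_cast n1
    simp only [Side.sg, Side.outSpeed, Side.inSpeed, Side.opp] at *
    obtain rfl : t = n := by omega
    have e : x - (n : ℤ) + 1 * (3 * n) = x + 2 * n := by omega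
    rw [e] at n5 n7 n9
    refine ⟨⟨k, hx⟩, ⟨r, n5⟩, ?_, ?_, ?_⟩
    · obtain ⟨t', ht'⟩ := hc.node_of_apex (s := L) n5 (n6.not_clearRay (by simp [Side.sg]; omega))
      have h1 := ht'.left_clear.unique n7.symm (by have := ht'.pos; simp only [Side.sg]; omega)
        (by simp [Side.sg]; omega) ht'.left.not_blank n6.not_blank
      obtain rfl : t' = 3 * n := by omega
      exact ht'
    · intro g g1 g2
      have := n8 (g - h).toNat (by omega)
      rwa [show h + ((g - h).toNat : ℤ) = g by omega] at this
    · intro g g1 g2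
      have := n9 (g - h).toNat (by omega)
      rwa [show h + ((g - h).toNat : ℤ) = g by omega] at this

/-! ### Chains of triangles and lines from infinity -/

/-- A sequence of nodes, each the parent of the preceding one, all of which lie on the left side of
the triangle of their parent. Their triangles have the left corner `(a, b)` in common. -/
structure Chain (c : ℤ → ℤ → Cell) (a b t : ℤ) : Prop where
  pos : 0 < t
  node : ∀ k : ℕ, Node c (a + 3 ^ k * t) (b + 3 ^ k * t) (3 ^ k * t)
  apex : ∀ k : ℕ, ∃ κ, c (a + 3 ^ k * t) (b + 3 ^ k * t) = .apex R κ

theorem two_pow_dvd_of_dvd_three_mul {n : ℕ} {t : ℤ} (h : (2 : ℤ) ^ n ∣ 3 * t) : (2 : ℤ) ^ n ∣ t :=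
  (IsCoprime.pow_left (by norm_num : IsCoprime (2 : ℤ) 3)).dvd_of_dvd_mul_left h

theorem not_two_pow_dvd_six_mul {n : ℕ} {m : ℤ} (h : ¬ (2 : ℤ) ^ (n + 1) ∣ 4 * m) :
    ¬ (2 : ℤ) ^ n ∣ 6 * m := fun hd => h <| two_pow_dvd_of_dvd_three_mul <| by
  rw [pow_succ, show 3 * (4 * m) = 6 * m * 2 by ring]
  exact mul_dvd_mul_right hd 2

theorem exists_not_two_pow_dvd {t : ℤ} (ht : 0 < t) : ∃ n : ℕ, ¬ (2 : ℤ) ^ n ∣ t := by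
  refine ⟨t.toNat + 1, fun hd => ?_⟩
  have h1 := Int.le_of_dvd ht hd
  have h2 : t.toNat + 1 < 2 ^ (t.toNat + 1) := Nat.lt_two_pow_self
  have h3 : ((t.toNat + 1 : ℕ) : ℤ) < 2 ^ (t.toNat + 1) := by exact_mod_cast h2
  omega

/-- The parent of a node of height `t` has height `3 * t` or `6 * (t / 4)`. As the power of `2` in
`t` decreases in the second case, it occurs only finitely often. -/
theorem Valid.exists_chain (hc : Valid c) (n : ℕ) : ∀ {x h t : ℤ}, Node c x h t →
    ¬ (2 : ℤ) ^ n ∣ t → ∃ a b t, Chain c a b t := by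
  induction n with
  | zero => intro x h t _ ht; simp at ht
  | succ n ih =>
    intro x h t hn ht
    by_cases hL : ∃ x h t, Node c x h t ∧ ¬ (2 : ℤ) ^ (n + 1) ∣ t ∧ ∃ k, c x h = .apex L k
    · obtain ⟨x, h, t, hn, ht, k, hk⟩ := hL
      rcases hc.node_step hn with ⟨⟨k', hk'⟩, -⟩ | ⟨m, rfl, -, h2, -⟩
      · rw [hk] at hk'; cases hk'
      · exact ih h2 (not_two_pow_dvd_six_mul ht)
    · have hR : ∀ {x h t}, Node c x h t → ¬ (2 : ℤ) ^ (n + 1) ∣ t →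
          (∃ k, c x h = .apex R k) ∧ Node c (x + 2 * t) (h + 2 * t) (3 * t) := by
        intro x h t hn ht
        rcases hc.node_step hn with ⟨h1, -, h2, -⟩ | ⟨n, h1, h2, -⟩
        · exact ⟨h1, h2⟩
        · exact absurd ⟨x, h, t, hn, ht, h2⟩ hL
      have hnode : ∀ k : ℕ, Node c (x - t + 3 ^ k * t) (h - t + 3 ^ k * t) (3 ^ k * t) ∧
          ¬ (2 : ℤ) ^ (n + 1) ∣ 3 ^ k * t := by
        intro k
        induction k with
        | zero => simpa using ⟨hn, by simpa using ht⟩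
        | succ k ih =>
          have e : (3 : ℤ) ^ (k + 1) * t = 3 * (3 ^ k * t) := by ring
          rw [e]
          generalize (3 : ℤ) ^ k * t = u at ih
          refine ⟨?_, fun hd => ih.2 (two_pow_dvd_of_dvd_three_mul hd)⟩
          have := (hR ih.1 ih.2).2
          convert this using 1 <;> ring
      exact ⟨x - t, h - t, t, hn.pos, fun k => (hnode k).1,
        fun k => (hR (hnode k).1 (hnode k).2).1⟩

/-- Where the colours change from those on the right of a `d`-line to others, there is one of the
lines `sep L`, `sep R` and `lsep R`. -/
theorem sep_of_col : ∀ t : Cell, (t.col L = .near R ∨ t.col L = .far R) →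
    ¬ (t.col R = .near R ∨ t.col R = .far R) →
    t.inn (.sep L) = true ∨ t.inn (.sep R) = true ∨ t.inn (.lsep R) = true := by decide +kernel

theorem col_of_inn_out_d : ∀ (s : Side) (t : Cell), t.inn .d = true → t.out .d = true →
    t.col s = .near s ∨ t.col s = .far s := by decide +kernel

theorem sep_out_cases : ∀ (s : Side) (t : Cell) (p : Par), p = .sep s ∨ p = .lsep s →
    t.out p = true → t.inn .d = false ∧ (t.inn p = true ∨ ∃ r k, t = .apex r k) := by
  decide +kernel

theorem not_inn_d_apex (s : Side) (k : ZMod 3) : (Cell.apex s k).inn .d ≠ true := by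
  simp [Cell.inn]

/-- A line `sep s` or `lsep s` between two `d`-lines that come from infinity starts at an apex, as
it cannot cross the `d`-line towards which it leads when followed upwards. -/
theorem Valid.exists_apex_of_sep (hc : Valid c) {s : Side} {p : Par} (hp : p = .sep s ∨ p = .lsep s)
    (n : ℕ) : ∀ {x y z h : ℤ}, 0 < s.sg * (z - x) → 0 < s.sg * (y - z) → s.sg * (y - z) ≤ n →
    (∀ g, h ≤ g → (c x g).inn .d = true) → (∀ g, h ≤ g → (c y g).inn .d = true) →
    (c z h).inn p = true → ∃ z g, 0 < s.sg * (z - x) ∧ 0 < s.sg * (y - z) ∧ h < g ∧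
      ∃ r k, c z g = .apex r k := by
  have ev : p.vel = -(s.sg * s.slope) := by rcases hp with rfl | rfl <;> cases s <;> rfl
  have hs := s.slope_pos
  induction n with
  | zero => intro x y z h _ h1 h2; push_cast at h2; linarith
  | succ n ih =>
    intro x y z h h1 h2 hle hx hy hz
    have o := hc.pred hz
    have hxo : (c x (h + 1)).out .d = true := by
      simpa [vel_d] using hc.pred (hx h le_rfl)
    have hyo : (c y (h + 1)).out .d = true := by
      simpa [vel_d] using hc.pred (hy h le_rfl)
    rw [ev, sub_neg_eq_add] at o
    obtain ⟨o1, o2⟩ := sep_out_cases s _ p hp o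
    have e : s.sg * (y - (z + s.sg * s.slope)) = s.sg * (y - z) - s.slope := by
      rw [← sub_sub, mul_sub _ (y - z), ← mul_assoc, s.sg_mul_sg, one_mul]
    have e' : s.sg * (z + s.sg * s.slope - x) = s.sg * (z - x) + s.slope := by
      rw [add_sub_right_comm, mul_add, ← mul_assoc, s.sg_mul_sg, one_mul]
    have p2 : 0 < s.sg * (y - (z + s.sg * s.slope)) := by
      refine s.sg_pos ?_ ?_
      · intro he
        rw [he, hy _ (by omega)] at o1
        cases o1
      · by_contra! hlt
        have := hc.order (s := s) (by linarith) hyo o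
        rw [vel_d, ev] at this
        linarith
    rcases o2 with o2 | o2
    · obtain ⟨z', g, i1, i2, i3, i4⟩ := ih (x := x) (y := y) (z := z + s.sg * s.slope) (h := h + 1)
        (by linarith) p2 (by push_cast at hle; linarith)
        (fun g hg => hx g (by omega)) (fun g hg => hy g (by omega)) o2
      exact ⟨z', g, i1, i2, by omega, i4⟩
    · exact ⟨_, _, by linarith, p2, by omega, o2⟩

/-- Between two `d`-lines that come from infinity there is an apex. -/
theorem Valid.exists_apex_between (hc : Valid c) {x y h : ℤ} (hxy : x < y)
    (hx : ∀ g, h ≤ g → (c x g).inn .d = true) (hy : ∀ g, h ≤ g → (c y g).inn .d = true) :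
    ∃ z g, x < z ∧ z < y ∧ h ≤ g ∧ ∃ r k, c z g = .apex r k := by
  have hxo : (c x (h + 1)).out .d = true := by simpa [vel_d] using hc.pred (hx h le_rfl)
  have hyo : (c y (h + 1)).out .d = true := by simpa [vel_d] using hc.pred (hy h le_rfl)
  have hcx := col_of_inn_out_d R _ (hx (h + 1) (by omega)) hxo
  have hcy := col_of_inn_out_d L _ (hy (h + 1) (by omega)) hyo
  -- next to `x` the colour belongs to the right of a `d`-line, and next to `y` to the left of one
  obtain ⟨z, z1, z2, z3, z4⟩ : ∃ z, x < z ∧ z < y ∧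
      ((c z (h + 1)).col L = .near R ∨ (c z (h + 1)).col L = .far R) ∧
      ¬ ((c z (h + 1)).col R = .near R ∨ (c z (h + 1)).col R = .far R) := by
    by_contra! hno
    have key : ∀ n : ℕ, x + n < y →
        (c (x + n) (h + 1)).col R = .near R ∨ (c (x + n) (h + 1)).col R = .far R := by
      intro n
      induction n with
      | zero => intro; simpa using hcx
      | succ n ih =>
        intro hn
        push_cast at hn ⊢
        rw [← add_assoc]
        have h1 := ih (by omega)
        rw [(hc _ _).color] at h1
        exact hno _ (by omega) (by omega) h1
    have := key (y - 1 - x).toNat (by omega)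
    rw [(hc _ _).color, show x + ((y - 1 - x).toNat : ℤ) + 1 = y by omega] at this
    rcases this with h1 | h1 <;> rcases hcy with h2 | h2 <;> rw [h1] at h2 <;> cases h2
  have hx' : ∀ g, h + 1 ≤ g → (c x g).inn .d = true := fun g hg => hx g (by omega)
  have hy' : ∀ g, h + 1 ≤ g → (c y g).inn .d = true := fun g hg => hy g (by omega)
  rcases sep_of_col _ z3 z4 with h1 | h1 | h1
  · obtain ⟨z, g, i1, i2, i3, i4⟩ := hc.exists_apex_of_sep (s := L) (.inl rfl) (z - x).toNat
      (x := y) (y := x) (by simp only [Side.sg]; omega) (by simp only [Side.sg]; omega)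
      (by simp only [Side.sg]; omega) hy' hx' h1
    simp only [Side.sg] at i1 i2
    exact ⟨z, g, by omega, by omega, by omega, i4⟩
  · obtain ⟨z, g, i1, i2, i3, i4⟩ := hc.exists_apex_of_sep (s := R) (.inl rfl) (y - z).toNat
      (by simp only [Side.sg]; omega) (by simp only [Side.sg]; omega)
      (by simp only [Side.sg]; omega) hx' hy' h1
    simp only [Side.sg] at i1 i2
    exact ⟨z, g, by omega, by omega, by omega, i4⟩
  · obtain ⟨z, g, i1, i2, i3, i4⟩ := hc.exists_apex_of_sep (s := R) (.inr rfl) (y - z).toNat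
      (by simp only [Side.sg]; omega) (by simp only [Side.sg]; omega)
      (by simp only [Side.sg]; omega) hx' hy' h1
    simp only [Side.sg] at i1 i2
    exact ⟨z, g, by omega, by omega, by omega, i4⟩

theorem not_inn_outw_inw : ∀ (s : Side) (k : ZMod 3) (t : Cell), t.inn (.outw s k) = true →
    t.inn (.inw s) = true → False := by decide +kernel

theorem inn_outw_cases : ∀ (s : Side) (k : ZMod 3) (t : Cell), t.inn (.outw s k) = true →
    t.out (.outw s (k + 1)) = true ∨ ∃ r k, t = .apex r k := by decide +kernel

/-- If no apex occurs on side `s` of a `d`-line, then there is at most one hit on that side: the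
signal reflected at the upper one would have to cross the signal arriving at the lower one. -/
theorem Valid.hit_unique (hc : Valid c) {s : Side} {x h : ℤ} {n : ℕ} (h1 : c x h = .hit s)
    (h2 : c x (h + (n + 1)) = .hit s)
    (hno : ∀ z g, h ≤ g → 0 < s.sg * (z - x) → ∀ r k, c z g ≠ .apex r k) : False := by
  have ev : (Par.inw s).vel = - (s.sg * s.inSpeed) := by cases s <;> rfl
  have hs : 0 < s.inSpeed := by cases s <;> decide
  have ho := s.outSpeed_pos
  -- the signal arriving at the lower hit comes from infinity
  have hin : ∀ j : ℕ, (c (x + s.sg * (s.inSpeed * (j + 1))) (h + (j + 1))) = .par (.inw s) := by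
    have key : ∀ {z g : ℤ}, (c z g).inn (.inw s) = true → 0 ≤ s.sg * (z - x) → h ≤ g →
        c (z + s.sg * s.inSpeed) (g + 1) = .par (.inw s) := by
      intro z g hz hpos hg
      have := hc.pred hz
      rw [ev, sub_neg_eq_add] at this
      rcases out_inw _ _ this with h3 | ⟨r, h3⟩
      · exact h3
      · refine absurd h3 (hno _ _ (by omega) ?_ r 0)
        rw [add_sub_right_comm, mul_add, ← mul_assoc, s.sg_mul_sg, one_mul]
        omega
    intro j
    induction j with
    | zero => simpa using key (z := x) (g := h) (by rw [h1]; simp [Cell.inn]) (by simp) le_rfl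
    | succ j ih =>
      have := key (z := x + s.sg * (s.inSpeed * (j + 1))) (g := h + (j + 1))
        (by rw [ih]; simp [Cell.inn])
        (by rw [mul_sub, s.sg_mul_add, add_sub_cancel_left]; positivity) (by omega)
      rw [← this]
      push_cast
      congr 1 <;> ring
  have hin' : ∀ j : ℕ, (c (x + s.sg * (s.inSpeed * j)) (h + j)).inn (.inw s) = true := by
    rintro (_ | j)
    · simp [h1, Cell.inn]
    · have := hin j
      push_cast
      rw [this]; simp [Cell.inn]
  -- the signal reflected at the upper hit stays between the `d`-line and the former signal
  have key : ∀ i j : ℕ, i + j = n → ∃ k, (c (x + s.sg * (s.outSpeed * (i + 1))) (h + j)).inn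
      (.outw s k) = true ∧ s.outSpeed * (i + 1) < s.inSpeed * j := by
    have step : ∀ {z : ℤ} {j : ℕ} {k : ZMod 3}, 0 < s.sg * (x + s.sg * (s.inSpeed * (j + 1)) - z) →
        (c z (h + j + 1)).out (.outw s k) = true →
        (c (z + s.sg * s.outSpeed) (h + j)).inn (.outw s k) = true ∧
        s.sg * (z - x) + s.outSpeed < s.inSpeed * j := by
      intro z j k hpos hz
      have hi := hc.succ hz
      have hw := hin j
      rw [← add_assoc] at hw
      have := hc.order hpos hz (q := .inw s) (by rw [hw]; simp [Cell.out])
      rw [Par.vel_outw] at this hi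
      rw [ev, show x + s.sg * (s.inSpeed * (j + 1)) + -(s.sg * s.inSpeed) =
        x + s.sg * (s.inSpeed * j) by ring] at this
      refine ⟨hi, ?_⟩
      have e : s.sg * (x + s.sg * (s.inSpeed * j) - (z + s.sg * s.outSpeed)) =
        s.inSpeed * j - (s.sg * (z - x) + s.outSpeed) := by
        rw [mul_sub, s.sg_mul_add, s.sg_mul_add]; ring
      have h3 := s.sg_pos (x := z + s.sg * s.outSpeed) (y := x + s.sg * (s.inSpeed * j)) ?_
        (by rw [mul_sub]; linarith)
      · rw [e] at h3; linarith
      · intro he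
        rw [he] at hi
        exact not_inn_outw_inw _ _ _ hi (hin' j)
    intro i
    induction i with
    | zero =>
      intro j hj
      obtain rfl : j = n := by omega
      refine ⟨1, ?_⟩
      have := step (z := x) (j := j) (k := 1) ?_ (by rw [add_assoc, h2]; simp [Cell.out])
      · simpa using this
      · rw [add_sub_cancel_left, ← mul_assoc, s.sg_mul_sg, one_mul]
        positivity
    | succ i ih =>
      intro j hj
      obtain ⟨k, k1, k2⟩ := ih (j + 1) (by omega)
      push_cast at k1 k2
      have e : s.sg * (x + s.sg * (s.outSpeed * (i + 1)) - x) = s.outSpeed * (i + 1) := by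
        rw [add_sub_cancel_left, ← mul_assoc, s.sg_mul_sg, one_mul]
      rcases inn_outw_cases _ _ _ k1 with k3 | ⟨r, k', k3⟩
      · have := step (j := j) (z := x + s.sg * (s.outSpeed * (i + 1))) (k := k + 1) ?_
          (by rw [add_assoc]; exact k3)
        · refine ⟨k + 1, ?_, ?_⟩
          · rw [← this.1]
            push_cast
            congr 2; ring
          · have h3 := this.2
            rw [e] at h3
            push_cast; linarith
        · rw [mul_sub, s.sg_mul_add, s.sg_mul_add]; linarith
      · refine absurd k3 (hno _ _ (by omega) ?_ r k')
        rw [e]; positivity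
  obtain ⟨k, -, h3⟩ := key n 0 rfl
  simp only [Nat.cast_zero, mul_zero] at h3
  have : 0 < s.outSpeed * ((n : ℤ) + 1) := by positivity
  linarith

/-! ### Absence of events -/

theorem exists_le_three_pow_mul {t : ℤ} (ht : 0 < t) (m : ℤ) : ∃ k : ℕ, m ≤ 3 ^ k * t := by
  refine ⟨m.toNat, ?_⟩
  have h1 : m.toNat < 3 ^ m.toNat := Nat.lt_pow_self (by norm_num)
  have h2 : (m.toNat : ℤ) < 3 ^ m.toNat := by exact_mod_cast h1
  nlinarith [Int.self_le_toNat m]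

/-- What is known about the `d`-lines on both sides of a node of a chain, from this node up to its
parent. -/
theorem Chain.step (hc : Valid c) {a b t : ℤ} (hch : Chain c a b t) (k : ℕ) :
    (∃ r, c (a + 3 ^ (k + 1) * t) (b + 3 ^ (k + 1) * t) = .apex r 0) ∧
    (∀ g, b + 3 ^ k * t ≤ g → g ≤ b + 3 ^ (k + 1) * t → (c a g).inn .d = true) ∧
    (∀ g, b + 3 ^ k * t ≤ g → g < b + 3 ^ (k + 1) * t →
      (c (a + 3 ^ (k + 1) * t) g).inn .d = true) := by
  have e : (3 : ℤ) ^ (k + 1) * t = 3 ^ k * t + 2 * (3 ^ k * t) := by ring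
  obtain ⟨κ, hκ⟩ := hch.apex k
  rcases hc.node_step (hch.node k) with ⟨-, h1, -, h2, h3⟩ | ⟨n, -, ⟨κ', h1⟩, -⟩
  · rw [e, ← add_assoc, ← add_assoc]
    refine ⟨h1, ?_, h3⟩
    rwa [add_sub_cancel_right] at h2
  · rw [hκ] at h1; cases h1

/-- The `d`-line through the common corner of a chain comes from infinity. -/
theorem Chain.inn_d (hc : Valid c) {a b t : ℤ} (hch : Chain c a b t) {g : ℤ} (hg : b + t ≤ g) :
    (c a g).inn .d = true := by
  have key : ∀ k : ℕ, ∀ g, b + t ≤ g → g ≤ b + 3 ^ k * t → (c a g).inn .d = true := by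
    intro k
    induction k with
    | zero =>
      intro g h1 h2
      refine (hch.step hc 0).2.1 g (by simpa using h1) (h2.trans ?_)
      have := hch.pos
      rw [pow_succ]; linarith
    | succ k ih =>
      intro g h1 h2
      rcases le_total g (b + 3 ^ k * t) with h3 | h3
      · exact ih g h1 h3
      · exact (hch.step hc k).2.1 g h3 h2
  obtain ⟨k, hk⟩ := exists_le_three_pow_mul hch.pos (g - b)
  exact key k g hg (by linarith)

theorem Node.right_le {x h t a : ℤ} (hn : Node c x h t) (ha : (c a h).inn .d = true)
    (hxa : x < a) : x + 2 * t ≤ a := by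
  by_contra! hlt
  have := hn.right_clear a (by simp only [Side.sg]; omega) (by simp only [Side.sg]; omega)
  rw [not_blank_of_inn _ _ ha] at this
  cases this

/-- There are no nodes on the left of a `d`-line that comes from infinity: their ancestors would
have to cross it. -/
theorem Valid.no_node_left (hc : Valid c) {a h₀ : ℤ} (ha : ∀ g, h₀ ≤ g → (c a g).inn .d = true)
    (n : ℕ) : ∀ {x h t : ℤ}, Node c x h t → ¬ (2 : ℤ) ^ n ∣ t → h₀ ≤ h → a ≤ x := by
  induction n with
  | zero => intro x h t _ ht; simp at ht
  | succ n ih =>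
    have key : ∀ m : ℕ, ∀ {x h t : ℤ}, Node c x h t → ¬ (2 : ℤ) ^ (n + 1) ∣ t → h₀ ≤ h →
        a ≤ x + m → a ≤ x := by
      intro m
      induction m with
      | zero => simp
      | succ m ihm =>
        intro x h t hn ht hh hm
        by_contra! hlt
        have hr := hn.right_le (ha h hh) hlt
        have hpos := hn.pos
        rcases hc.node_step hn with ⟨-, ⟨r, h1⟩, h2, -⟩ | ⟨m, rfl, -, h2, -⟩
        · have := ihm h2 (fun hd => ht (two_pow_dvd_of_dvd_three_mul hd)) (by omega)
            (by push_cast at hm; omega)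
          rw [show x + 2 * t = a by omega] at h1
          have h3 := ha (h + 2 * t) (by omega)
          rw [h1] at h3
          exact not_inn_d_apex _ _ h3
        · have := ih h2 (not_two_pow_dvd_six_mul ht) (by omega)
          omega
    intro x h t hn ht hh
    exact key (a - x).toNat hn ht hh (by omega)

theorem Valid.no_apex_left (hc : Valid c) {a h₀ : ℤ} (ha : ∀ g, h₀ ≤ g → (c a g).inn .d = true)
    {x h : ℤ} (hx : x < a) (hh : h₀ ≤ h) (r : Side) (k : ZMod 3) : c x h ≠ .apex r k := by
  intro hap
  obtain ⟨t, ht⟩ := hc.node_of_apex (s := R) hap (fun hcl => by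
    have := hcl a (by simp only [Side.sg]; omega)
    rw [not_blank_of_inn _ _ (ha h hh)] at this
    cases this)
  obtain ⟨n, hn⟩ := exists_not_two_pow_dvd ht.pos
  have := hc.no_node_left ha n ht hn hh
  omega

theorem out_d_cases : ∀ t : Cell, t.out .d = true → t.inn .d = true ∨ ∃ r k, t = .apex r k := by
  decide +kernel

theorem event_cases : ∀ t : Cell, t.event = true → t.inn .d = true ∨ ∃ r k, t = .apex r k := by
  decide +kernel

theorem inn_d_cases : ∀ t : Cell, t.inn .d = true → t = .mark ∨ t = .par .d ∨ ∃ s, t = .hit s := by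
  decide +kernel

/-- A `d`-line on which there is no apex comes from infinity. -/
theorem Valid.inn_d_above (hc : Valid c) {x h : ℤ} (hx : (c x h).inn .d = true)
    (hno : ∀ g, h ≤ g → ∀ r k, c x g ≠ .apex r k) {g : ℤ} (hg : h ≤ g) :
    (c x g).inn .d = true := by
  obtain ⟨n, rfl⟩ : ∃ n : ℕ, g = h + n := ⟨(g - h).toNat, by omega⟩
  clear hg
  induction n with
  | zero => simpa using hx
  | succ n ih =>
    have := hc.pred ih
    rw [vel_d, sub_zero] at this
    push_cast
    rw [← add_assoc]
    rcases out_d_cases _ this with h1 | ⟨r, k, h1⟩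
    · exact h1
    · exact absurd h1 (hno _ (by omega) r k)

/-- There are no `d`-lines on the left of one that comes from infinity: between two of them there
would be an apex. -/
theorem Valid.no_d_left (hc : Valid c) {a h₀ : ℤ} (ha : ∀ g, h₀ ≤ g → (c a g).inn .d = true)
    {x h : ℤ} (hx : x < a) (hh : h₀ ≤ h) : (c x h).inn .d = false := by
  by_contra hd
  rw [Bool.not_eq_false] at hd
  obtain ⟨z, g, h1, h2, h3, r, k, h4⟩ := hc.exists_apex_between hx
    (fun g hg => hc.inn_d_above hd (fun g hg => hc.no_apex_left ha hx (by omega)) hg)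
    (fun g hg => ha g (by omega))
  exact hc.no_apex_left ha h2 (by omega) r k h4

theorem Valid.no_event_left (hc : Valid c) {a h₀ : ℤ}
    (ha : ∀ g, h₀ ≤ g → (c a g).inn .d = true) {x h : ℤ} (hx : x < a) (hh : h₀ ≤ h) :
    (c x h).event = false := by
  by_contra he
  rw [Bool.not_eq_false] at he
  rcases event_cases _ he with h1 | ⟨r, k, h1⟩
  · rw [hc.no_d_left ha hx hh] at h1; cases h1
  · exact hc.no_apex_left ha hx hh r k h1

/-- Hits on a side free of apexes occur only below some row. -/
theorem Valid.exists_no_hit (hc : Valid c) (s : Side) {x h₀ : ℤ}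
    (hno : ∀ z g, h₀ ≤ g → 0 < s.sg * (z - x) → ∀ r k, c z g ≠ .apex r k) :
    ∃ h₁, h₀ ≤ h₁ ∧ ∀ g, h₁ ≤ g → c x g ≠ .hit s := by
  by_cases hex : ∃ h, h₀ ≤ h ∧ c x h = .hit s
  · obtain ⟨h, h1, h2⟩ := hex
    refine ⟨h + 1, by omega, fun g hg h3 => ?_⟩
    obtain ⟨n, rfl⟩ : ∃ n : ℕ, g = h + (n + 1) := ⟨(g - h - 1).toNat, by omega⟩
    exact hc.hit_unique h2 h3 fun z g hg => hno z g (by omega)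
  · exact ⟨h₀, le_rfl, fun g hg h3 => hex ⟨g, hg, h3⟩⟩

/-- Without nodes, there are no events above a certain row. -/
theorem Valid.exists_no_event (hc : Valid c) (hn : ∀ x h t, ¬ Node c x h t) :
    ∃ h₀, ∀ x h, h₀ ≤ h → (c x h).event = false := by
  by_cases hap : ∃ x h r k, c x h = .apex r k
  · obtain ⟨x, h, r, k, hx⟩ := hap
    refine ⟨h + 1, fun z g hg => ?_⟩
    by_cases hcl : ClearRay c h r.opp x
    · exact (hc.no_event_above hx hcl).2 g z (by omega)
    · obtain ⟨t, ht⟩ := hc.node_of_apex hx hcl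
      exact absurd ht (hn _ _ _)
  · replace hap : ∀ x h r k, c x h ≠ .apex r k := fun x h r k hx => hap ⟨x, h, r, k, hx⟩
    by_cases hd : ∃ x h, (c x h).inn .d = true
    · obtain ⟨x, h, hx⟩ := hd
      have habove : ∀ {x h}, (c x h).inn .d = true → ∀ g, h ≤ g → (c x g).inn .d = true :=
        fun hx g hg => hc.inn_d_above hx (fun g _ => hap _ _) hg
      have huniq : ∀ {y g}, h ≤ g → (c y g).inn .d = true → y = x := by
        intro y g hg hy
        by_contra hne
        rcases lt_or_gt_of_ne hne with hlt | hlt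
        · obtain ⟨z, g, -, -, -, r, k, h4⟩ := hc.exists_apex_between hlt (habove hy)
            (fun g' hg' => habove hx g' (by omega))
          exact hap _ _ _ _ h4
        · obtain ⟨z, g, -, -, -, r, k, h4⟩ := hc.exists_apex_between hlt
            (fun g' hg' => habove hx g' (by omega)) (habove hy)
          exact hap _ _ _ _ h4
      obtain ⟨h₁, i1, i2⟩ := hc.exists_no_hit L (x := x) (h₀ := h) fun z g _ _ => hap z g
      obtain ⟨h₂, j1, j2⟩ := hc.exists_no_hit R (x := x) (h₀ := h₁) fun z g _ _ => hap z g
      refine ⟨h₂ + 1, fun y g hg => ?_⟩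
      by_contra he
      rw [Bool.not_eq_false] at he
      rcases event_cases _ he with h1 | ⟨r, k, h1⟩
      · obtain rfl := huniq (by omega) h1
        have hod : (c y g).out .d = true := by
          have := hc.pred (habove hx (g - 1) (by omega))
          simpa [vel_d] using this
        rcases inn_d_cases _ h1 with h2 | h2 | ⟨s, h2⟩
        · rw [h2] at hod; cases hod
        · rw [h2] at he; cases he
        · cases s
          · exact i2 g (by omega) h2
          · exact j2 g (by omega) h2
      · exact hap _ _ _ _ h1
    · refine ⟨0, fun x h _ => ?_⟩
      by_contra he
      rw [Bool.not_eq_false] at he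
      rcases event_cases _ he with h1 | ⟨r, k, h1⟩
      · exact hd ⟨x, h, h1⟩
      · exact hap _ _ _ _ h1

theorem out_lsep_cases : ∀ t : Cell, t.out (.lsep L) = true →
    t = .par (.lsep L) ∨ ∃ r k, t = .apex r k := by decide +kernel

/-- One step up along a line `lsep L` and the `d`-line on its right. -/
theorem Valid.lsep_dish_up (hc : Valid c) {x y h : ℤ}
    (hxy : (c x h = .par (.lsep L) ∧ Dish L (c y h) ∧ x < y) ∨ (x = y ∧ c y h = .mark))
    (hcl : Clear c h R x y) :
    (c (x - 2) (h + 1)).out (.lsep L) = true ∧ Dish L (c y (h + 1)) ∧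
      Clear c (h + 1) R (x - 2) y := by
  have hix : (c x h).inn (.lsep L) = true := by
    rcases hxy with h1 | ⟨rfl, h1⟩
    · rw [h1.1]; rfl
    · rw [h1]; rfl
  have hiy : (c y h).inn .d = true := by
    rcases hxy with h1 | ⟨rfl, h1⟩
    · exact h1.2.1.inn
    · rw [h1]; rfl
  have hle : x ≤ y := by
    rcases hxy with h1 | ⟨rfl, h1⟩
    · exact h1.2.2.le
    · exact le_rfl
  have o := hc.pred hix
  have od := hc.pred hiy
  rw [vel_d, sub_zero] at od
  have hcol : (c (x - 2) (h + 1)).col R = .near L := by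
    rcases out_lsep_cases _ o with h1 | ⟨r, k, h1⟩ <;>
      rw [show x - 2 = x - (Par.lsep L).vel from rfl, h1] <;> rfl
  have v2 : (Par.lsep L).vel = 2 := rfl
  have aux' : ∀ {r}, Cell.mark.inn r = true → r.vel = 2 ∨ r.vel ≤ 0 := by decide +kernel
  have hclu := hc.clear_up (s := R) hix hiy
    (fun r hr => by
      rcases hxy with h1 | ⟨rfl, h1⟩
      · rw [h1.1] at hr; rw [inn_par hr]; exact .inl le_rfl
      · rw [h1] at hr
        simp only [Side.sg, one_mul, v2, vel_d]
        have := aux' hr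
        omega)
    (fun r hr => by
      rcases hxy with h1 | ⟨rfl, h1⟩
      · have := h1.2.1.vel_le hr
        simp only [Side.sg, vel_d] at *
        omega
      · rw [h1] at hr
        simp only [Side.sg, one_mul, v2, vel_d]
        have := aux' hr
        omega) hcl
    (.inl (by rw [show x - (Par.lsep L).vel = x - 2 from rfl, hcol]; simp))
  rw [vel_d, sub_zero] at hclu
  refine ⟨o, dish_of_out _ _ od ?_, hclu⟩
  rw [← hcol]
  exact (hc.col_eq (s := R) (by simp only [Side.sg, v2]; omega) hclu).symm

/-- The node on the left side of the triangle that ends at a mark. -/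
theorem Valid.exists_node_of_mark (hc : Valid c) {a x h : ℤ} (hx : c x h = .mark) (hax : a < x)
    (ha : ∀ g, h ≤ g → (c a g).inn .d = true) :
    ∃ t, Node c (x - 2 * t) (h + t) t ∧ ∀ g, h ≤ g → g ≤ h + t → (c x g).inn .d = true := by
  have key : ∀ m : ℕ, ∀ j : ℤ, 0 ≤ j → a < x - 2 * j → x - 2 * j ≤ a + m →
      (∀ g, h ≤ g → g ≤ h + j → (c x g).inn .d = true) →
      ((c (x - 2 * j) (h + j) = .par (.lsep L) ∧ Dish L (c x (h + j)) ∧ x - 2 * j < x) ∨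
        (x - 2 * j = x ∧ c x (h + j) = .mark)) → Clear c (h + j) R (x - 2 * j) x →
      ∃ t, Node c (x - 2 * t) (h + t) t ∧ ∀ g, h ≤ g → g ≤ h + t → (c x g).inn .d = true := by
    intro m
    induction m with
    | zero => intro j _ h1 h2; push_cast at h2; omega
    | succ m ih =>
      intro j hj h1 h2 hd hxy hcl
      obtain ⟨u1, u2, u3⟩ := hc.lsep_dish_up hxy hcl
      rw [show x - 2 * j - 2 = x - 2 * (j + 1) by ring, add_assoc] at u1 u3
      rw [add_assoc] at u2
      have hd' : ∀ g, h ≤ g → g ≤ h + (j + 1) → (c x g).inn .d = true := by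
        intro g g1 g2
        by_cases hg : g ≤ h + j
        · exact hd g g1 hg
        · rw [show g = h + (j + 1) by omega]; exact u2.inn
      rcases out_lsep_cases _ u1 with h3 | ⟨r, k, h3⟩
      · refine ih (j + 1) (by omega) ?_ (by push_cast at h2; omega) hd'
          (.inl ⟨h3, u2, by omega⟩) u3
        by_contra! hlt
        have hne : x - 2 * (j + 1) ≠ a := by
          intro he
          have := ha (h + (j + 1)) (by omega)
          rw [← he, h3] at this
          cases this
        have hod : (c a (h + (j + 1))).out .d = true := by
          have := hc.pred (ha (h + j) (by omega))
          rwa [vel_d, sub_zero, add_assoc] at this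
        have := hc.order (s := R) (h := h + (j + 1)) (x := x - 2 * (j + 1)) (y := a)
          (by simp only [Side.sg]; omega) u1 hod
        simp only [Side.sg, Par.vel] at this
        omega
      · obtain ⟨t, ht⟩ := hc.node_of_apex (s := R) h3 (u2.not_clearRay
          (by simp only [Side.sg]; omega))
        have := ht.right_clear.unique u3 (by have := ht.pos; simp only [Side.sg]; omega)
          (by simp only [Side.sg]; omega) ht.right.not_blank u2.not_blank
        obtain rfl : t = j + 1 := by omega
        exact ⟨j + 1, ht, hd'⟩
  refine key (x - a).toNat 0 le_rfl (by omega) (by omega) ?_ (.inr ⟨by ring, by simpa using hx⟩)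
    (fun z h1 h2 => by linarith)
  intro g g1 g2
  rw [show g = h by omega, hx]; rfl

/-- The `d`-line at the right of a node goes up to a node whose triangle has the same base row. -/
theorem Valid.exists_top (hc : Valid c) (n : ℕ) : ∀ {x h t : ℤ}, Node c x h t →
    ¬ (2 : ℤ) ^ n ∣ t → ∃ u, Node c (x + 2 * t) (h - t + u) u ∧
      ∀ g, h ≤ g → g < h - t + u → (c (x + 2 * t) g).inn .d = true := by
  induction n with
  | zero => intro x h t _ ht; simp at ht
  | succ n ih =>
    intro x h t hn ht
    rcases hc.node_step hn with ⟨-, -, h1, -, h2⟩ | ⟨m, rfl, -, h1, h2⟩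
    · refine ⟨3 * t, ?_, ?_⟩
      · convert h1 using 1; ring
      · intro g g1 g2
        exact h2 g g1 (by omega)
    · obtain ⟨u, u1, u2⟩ := ih h1 (not_two_pow_dvd_six_mul ht)
      have e1 : x - 4 * m + 2 * (6 * m) = x + 2 * (4 * m) := by ring
      have e2 : h + 2 * m - 6 * m + u = h - 4 * m + u := by ring
      rw [e1, e2] at u1 u2
      refine ⟨u, u1, fun g g1 g2 => ?_⟩
      by_cases hg : g ≤ h + 2 * m
      · exact h2 g g1 hg
      · exact u2 g (by omega) g2

/-- The `d`-line at the right of a node of a chain goes down to the common base row. -/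
theorem Chain.inn_d_right (hc : Valid c) {a b t : ℤ} (hch : Chain c a b t) (k : ℕ) {g : ℤ}
    (h1 : b + t ≤ g) (h2 : g ≤ b + 3 ^ k * t) : (c (a + 3 ^ (k + 1) * t) g).inn .d = true := by
  have hp : 0 < 3 ^ k * t := by have := hch.pos; positivity
  have e : (3 : ℤ) ^ (k + 1) * t = 3 ^ k * t + 2 * (3 ^ k * t) := by ring
  obtain ⟨n, hn⟩ : ∃ n : ℕ, g = b + 3 ^ k * t - n := ⟨(b + 3 ^ k * t - g).toNat, by omega⟩
  induction n using Nat.strong_induction_on generalizing g with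
  | _ n ih =>
    rcases Nat.eq_zero_or_pos n with rfl | hpos
    · have := (hch.node k).right.inn
      rwa [add_assoc, ← e, ← sub_zero (b + 3 ^ k * t), ← Nat.cast_zero, ← hn] at this
    · have hi := ih (n - 1) (by omega) (g := g + 1) (by omega) (by omega) (by omega)
      have hod : (c (a + 3 ^ (k + 1) * t) (g + 1)).out .d = true := by
        rcases inn_d_cases _ hi with h3 | h3 | ⟨s, h3⟩
        -- A mark at height `g + 1` would be the right corner of a triangle with base row `g + 1`.
        -- The next apex on the `d`-line above it belongs to a triangle with this base row and some
        -- height `v`, but it is also a node of the chain, with base row `b`.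
        · exfalso
          obtain ⟨u, u1, u2⟩ := hc.exists_node_of_mark h3 (a := a) (by omega)
            (fun g' hg' => hch.inn_d hc (by omega))
          obtain ⟨m, hm⟩ := exists_not_two_pow_dvd u1.pos
          obtain ⟨v, v1, v2⟩ := hc.exists_top m u1 hm
          rw [show a + 3 ^ (k + 1) * t - 2 * u + 2 * u = a + 3 ^ (k + 1) * t by ring,
            show g + 1 + u - u + v = g + 1 + v by ring] at v1 v2
          have w1 : ∀ g', g + 1 ≤ g' → g' < b + 3 ^ (k + 1) * t →
              (c (a + 3 ^ (k + 1) * t) g').inn .d = true := by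
            intro g' g1 g2
            rcases le_total g' (b + 3 ^ k * t) with g3 | g3
            · exact ih (b + 3 ^ k * t - g').toNat (by omega) (by omega) g3 (by omega)
            · exact (hch.step hc k).2.2 g' g3 g2
          have w2 : ∀ g', g + 1 ≤ g' → g' < g + 1 + v →
              (c (a + 3 ^ (k + 1) * t) g').inn .d = true := by
            intro g' g1 g2
            rcases le_total g' (g + 1 + u) with g3 | g3
            · exact u2 g' g1 g3
            · exact v2 g' g3 g2
          have hN := hch.node (k + 1)
          obtain ⟨s1, κ1, x1⟩ := hN.apex
          obtain ⟨s2, κ2, x2⟩ := v1.apex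
          have vp := v1.pos
          have heq : g + 1 + v = b + 3 ^ (k + 1) * t := by
            rcases lt_trichotomy (g + 1 + v) (b + 3 ^ (k + 1) * t) with hlt | hlt | hlt
            · have := w1 _ (by omega) hlt
              rw [x2] at this
              exact absurd this (not_inn_d_apex _ _)
            · exact hlt
            · have := w2 _ (by omega) hlt
              rw [x1] at this
              exact absurd this (not_inn_d_apex _ _)
          rw [heq] at v1
          have := v1.unique hN
          have := hch.pos
          omega
        · rw [h3]; rfl
        · rw [h3]; simp [Cell.out]
      have := hc.succ hod
      rwa [vel_d, add_zero] at this

/-! ### Configurations with a row in common -/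

/-- Two rows with the same signals on side `s` of `z`, and with the same colour there next to `z`,
are equal on that side. -/
theorem Valid.eq_on_side (hc : Valid c) (hc' : Valid c') {s : Side} {z h : ℤ}
    (hz : (c z h).col s = (c' z h).col s) (n : ℕ)
    (hor : ∀ j : ℕ, j ≤ n → c (z + s.sg * (j + 1)) h = c' (z + s.sg * (j + 1)) h ∨
      ((c (z + s.sg * (j + 1)) h).blank = true ∧ (c' (z + s.sg * (j + 1)) h).blank = true)) :
    c (z + s.sg * (n + 1)) h = c' (z + s.sg * (n + 1)) h := by
  have step : ∀ {w}, (c w h).col s = (c' w h).col s → (c (w + s.sg) h = c' (w + s.sg) h ∨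
      ((c (w + s.sg) h).blank = true ∧ (c' (w + s.sg) h).blank = true)) →
      c (w + s.sg) h = c' (w + s.sg) h := by
    intro w h1 h2
    rcases h2 with h2 | h2
    · exact h2
    · rw [eq_of_blank _ s.opp h2.1, eq_of_blank _ s.opp h2.2, ← hc.col_step, ← hc'.col_step, h1]
  induction n with
  | zero => simpa using step hz (by simpa using hor 0 le_rfl)
  | succ n ih =>
    have e : z + s.sg * (((n + 1 : ℕ) : ℤ) + 1) = z + s.sg * (n + 1) + s.sg := by push_cast; ring
    have := hor (n + 1) le_rfl
    rw [e] at this ⊢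
    exact step (by rw [ih fun j hj => hor j (by omega)]) this

theorem Valid.eq_right (hc : Valid c) (hc' : Valid c') {z x h : ℤ} (hzx : z < x)
    (hz : (c z h).col R = (c' z h).col R)
    (hor : ∀ w, z < w → w ≤ x → c w h = c' w h ∨ ((c w h).blank = true ∧ (c' w h).blank = true)) :
    c x h = c' x h := by
  have := hc.eq_on_side hc' hz (x - z - 1).toNat fun j hj =>
    hor _ (by simp only [Side.sg]; omega) (by simp only [Side.sg]; omega)
  simp only [Side.sg] at this
  rwa [show z + 1 * (((x - z - 1).toNat : ℤ) + 1) = x by omega] at this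

theorem Valid.eq_left (hc : Valid c) (hc' : Valid c') {z x h : ℤ} (hxz : x < z)
    (hz : (c z h).col L = (c' z h).col L)
    (hor : ∀ w, w < z → x ≤ w → c w h = c' w h ∨ ((c w h).blank = true ∧ (c' w h).blank = true)) :
    c x h = c' x h := by
  have := hc.eq_on_side hc' hz (z - x - 1).toNat fun j hj =>
    hor _ (by simp only [Side.sg]; omega) (by simp only [Side.sg]; omega)
  simp only [Side.sg] at this
  rwa [show z + -1 * (((z - x - 1).toNat : ℤ) + 1) = x by omega] at this

/-- Away from events, the signals leaving a cell determine it, up to the background colour. -/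
theorem eq_of_out : ∀ t t' : Cell, t.event = false → t'.event = false →
    (∀ p, t.out p = t'.out p) → t = t' ∨ (t.blank = true ∧ t'.blank = true) := by decide +kernel

theorem Valid.out_eq (hc : Valid c) (hc' : Valid c') {x h : ℤ}
    (heq : ∀ p : Par, c (x + p.vel) h = c' (x + p.vel) h) (p : Par) :
    (c x (h + 1)).out p = (c' x (h + 1)).out p := by
  have h1 := (hc (x + p.vel) h).vert p
  have h2 := (hc' (x + p.vel) h).vert p
  rw [add_sub_cancel_right] at h1 h2
  rw [← h1, ← h2, heq]

/-- In the absence of events, a row determines the rows above it. -/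
theorem Valid.eq_of_row_eq (hc : Valid c) (hc' : Valid c') {h₀ : ℤ}
    (he : ∀ x h, h₀ ≤ h → (c x h).event = false) (he' : ∀ x h, h₀ ≤ h → (c' x h).event = false)
    (hrow : ∀ x, c x h₀ = c' x h₀) : c = c' := by
  have key : ∀ n : ℕ, ∀ x, c x (h₀ + n) = c' x (h₀ + n) := by
    intro n
    induction n with
    | zero => simpa using hrow
    | succ n ih =>
      push_cast
      rw [← add_assoc]
      have hor : ∀ x, c x (h₀ + n + 1) = c' x (h₀ + n + 1) ∨ ((c x (h₀ + n + 1)).blank = true ∧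
          (c' x (h₀ + n + 1)).blank = true) := fun x =>
        eq_of_out _ _ (he _ _ (by omega)) (he' _ _ (by omega)) (hc.out_eq hc' fun p => ih _)
      by_cases hex : ∃ z, (c z (h₀ + n + 1)).blank = false
      · obtain ⟨z, hz⟩ := hex
        have ez : c z (h₀ + n + 1) = c' z (h₀ + n + 1) := by
          rcases hor z with h1 | h1
          · exact h1
          · simp [hz] at h1
        intro x
        rcases lt_trichotomy x z with hlt | rfl | hlt
        · exact hc.eq_left hc' hlt (by rw [ez]) fun w _ _ => hor w
        · exact ez
        · exact hc.eq_right hc' hlt (by rw [ez]) fun w _ _ => hor w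
      -- two empty rows in succession have the same colour
      · have hb : ∀ z, (c z (h₀ + n + 1)).blank = true := fun z => by
          by_contra hz; exact hex ⟨z, by simpa using hz⟩
        have hb0 : ∀ z, (c z (h₀ + n)).blank = true := by
          intro z
          by_contra hz
          obtain ⟨p, hp⟩ := exists_inn _ (by simpa using hz)
          have := not_blank_of_out _ _ (hc.pred hp)
          rw [hb] at this
          cases this
        intro x
        have h1 := (hc x (h₀ + n)).calm fun i _ _ => hb0 _
        have h2 := (hc' x (h₀ + n)).calm fun i _ _ => by rw [← ih]; exact hb0 _
        rcases hor x with h3 | ⟨h3, h4⟩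
        · exact h3
        · rcases h1 with h1 | h1
          · rcases h2 with h2 | h2
            · rw [h1, h2, ih]
            · rw [h2.1] at h4; cases h4
          · rw [h1.1] at h3; cases h3
  refine hc.eq_of_eq_above hc' (h₀ := h₀) fun x h hh => ?_
  have := key (h - h₀).toNat x
  rwa [show h₀ + ((h - h₀).toNat : ℤ) = h by omega] at this

theorem Dish.eq_d {t : Cell} (h1 : Dish L t) (h2 : Dish R t) : t = .par .d := by
  revert t; unfold Dish; decide +kernel

/-- A configuration with a chain such that from row `h₀` on nothing happens on the left of its
corner. -/
structure Tame (c : ℤ → ℤ → Cell) (a b t h₀ : ℤ) : Prop where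
  valid : Valid c
  chain : Chain c a b t
  le : b + t ≤ h₀
  dish : ∀ h, h₀ ≤ h → Dish L (c a h)
  calm : ∀ x h, x < a → h₀ ≤ h → (c x h).event = false

theorem dish_of_inn_out_d : ∀ t : Cell, t.inn .d = true → t.out .d = true → t ≠ .hit L →
    Dish L t := by unfold Dish; decide +kernel

theorem Chain.exists_tame (hc : Valid c) {a b t : ℤ} (hch : Chain c a b t) :
    ∃ h₀, Tame c a b t h₀ := by
  have ha : ∀ g, b + t ≤ g → (c a g).inn .d = true := fun g hg => hch.inn_d hc hg
  obtain ⟨h₀, h1, h2⟩ := hc.exists_no_hit L (x := a) (h₀ := b + t) fun z g hg hz r k =>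
    hc.no_apex_left ha (by simp only [Side.sg] at hz; omega) hg r k
  refine ⟨h₀ + 1, hc, hch, by omega, fun h hh => ?_, fun x h hx hh =>
    hc.no_event_left ha hx (by omega)⟩
  refine dish_of_inn_out_d _ (ha h (by omega)) ?_ (h2 h (by omega))
  have := hc.pred (ha (h - 1) (by omega))
  simpa [vel_d] using this

theorem Tame.out_d {a b t h₀ : ℤ} (hc : Tame c a b t h₀) {h : ℤ} (hh : h₀ ≤ h) :
    (c a h).out .d = true := (hc.dish h hh).out_d

/-- No signal crosses the `d`-line in column `a` from the left. -/
theorem Tame.not_out {a b t h₀ : ℤ} (hc : Tame c a b t h₀) {h w : ℤ} {p : Par} (hh : h₀ ≤ h)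
    (hw : w < a) (hp : a ≤ w + p.vel) : (c w (h + 1)).out p = false := by
  by_contra ho
  rw [Bool.not_eq_false] at ho
  have h1 := hc.valid.order (s := R) (by simp only [Side.sg]; omega) ho
    (hc.out_d (h := h + 1) (by omega))
  simp only [Side.sg, vel_d] at h1
  have h2 := hc.valid.succ ho
  rw [show w + p.vel = a by omega] at h2
  have h3 := (hc.dish h hh).vel_le h2
  simp only [Side.sg] at h3
  omega

/-- On the left of column `a`, row `h₀` determines the rows above it. -/
theorem Tame.eq_left {a b t h₀ : ℤ} (hc : Tame c a b t h₀) (hc' : Tame c' a b t h₀)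
    (hrow : ∀ x, x < a → c x h₀ = c' x h₀) {x h : ℤ} (hx : x < a) (hh : h₀ ≤ h) :
    c x h = c' x h := by
  obtain ⟨n, rfl⟩ : ∃ n : ℕ, h = h₀ + n := ⟨(h - h₀).toNat, by omega⟩
  clear hh
  induction n generalizing x with
  | zero => simpa using hrow x hx
  | succ n ih =>
    push_cast
    rw [← add_assoc]
    have hcol : ∀ {t : Cell}, Dish L t → t.col L = .near L := by
      unfold Dish; decide +kernel
    refine hc.valid.eq_left hc'.valid hx ?_ fun w hw _ => ?_
    · rw [hcol (hc.dish _ (by omega)), hcol (hc'.dish _ (by omega))]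
    · refine eq_of_out _ _ (hc.calm _ _ hw (by omega)) (hc'.calm _ _ hw (by omega)) fun p => ?_
      by_cases hp : w + p.vel < a
      · have h1 := (hc.valid (w + p.vel) (h₀ + n)).vert p
        have h2 := (hc'.valid (w + p.vel) (h₀ + n)).vert p
        rw [add_sub_cancel_right] at h1 h2
        rw [← h1, ← h2, ih hp]
      · rw [hc.not_out (by omega) hw (by omega), hc'.not_out (by omega) hw (by omega)]

theorem out_eq_of_col : ∀ t t' : Cell, t.inn .d = true → t'.inn .d = true → t.col L = t'.col L →
    ∀ p : Par, p.vel < 0 → t.out p = t'.out p := by decide +kernel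

theorem apex_zero : ∀ {t : Cell} {r : Side} {k : ZMod 3}, t = .apex R k → t = .apex r 0 →
    t = .apex R 0 := by
  rintro t r k rfl h
  cases h
  rfl

/-- Two configurations with the same chain and the same cells on the left of its corner agree on
the left of the `d`-line at the right of each node of the chain: they agree in the row of this
node, and this `d`-line shields them from what is on its right. -/
theorem Tame.eq_of_lt {a b t h₀ : ℤ} (hc : Tame c a b t h₀) (hc' : Tame c' a b t h₀)
    (hrow : ∀ x, x < a → c x h₀ = c' x h₀) (k : ℕ) {x h : ℤ}
    (hx : x < a + 3 ^ (k + 1 + 1) * t) (hh : h₀ ≤ h) (hk : h ≤ b + 3 ^ (k + 1) * t) :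
    c x h = c' x h := by
  have hpos : 0 < 3 ^ (k + 1) * t := by have := hc.chain.pos; positivity
  have e : (3 : ℤ) ^ (k + 1 + 1) * t = 3 ^ (k + 1) * t + 2 * (3 ^ (k + 1) * t) := by ring
  have hle := hc.le
  have ht := hc.chain.pos
  have hX : ∀ {c}, Tame c a b t h₀ → ∀ g, h₀ ≤ g → g ≤ b + 3 ^ (k + 1) * t →
      (c (a + 3 ^ (k + 1 + 1) * t) g).inn .d = true := fun hc g h1 h2 =>
    hc.chain.inn_d_right hc.valid (k + 1) (by omega) h2
  obtain ⟨n, hn⟩ : ∃ n : ℕ, h = b + 3 ^ (k + 1) * t - n :=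
    ⟨(b + 3 ^ (k + 1) * t - h).toNat, by omega⟩
  induction n generalizing x h with
  | zero =>
    rw [Nat.cast_zero, sub_zero] at hn
    subst hn
    have hap : ∀ {c}, Tame c a b t h₀ →
        c (a + 3 ^ (k + 1) * t) (b + 3 ^ (k + 1) * t) = .apex R 0 := fun hc => by
      obtain ⟨r, h1⟩ := (hc.chain.step hc.valid k).1
      obtain ⟨κ, h2⟩ := hc.chain.apex (k + 1)
      exact apex_zero h2 h1
    have had : ∀ {c}, Tame c a b t h₀ → c a (b + 3 ^ (k + 1) * t) = .par .d := fun hc => by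
      have := (hc.chain.node (k + 1)).left
      rw [add_sub_cancel_right] at this
      exact (hc.dish _ (by omega)).eq_d this
    have hbl : ∀ {c}, Tame c a b t h₀ → ∀ w, a < w → w < a + 3 ^ (k + 1) * t →
        (c w (b + 3 ^ (k + 1) * t)).blank = true := fun hc w h1 h2 =>
      (hc.chain.node (k + 1)).left_clear w (by simp only [Side.sg]; omega)
        (by simp only [Side.sg]; omega)
    have hbr : ∀ {c}, Tame c a b t h₀ → ∀ w, a + 3 ^ (k + 1) * t < w →
        w < a + 3 ^ (k + 1 + 1) * t → (c w (b + 3 ^ (k + 1) * t)).blank = true := fun hc w h1 h2 =>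
      (hc.chain.node (k + 1)).right_clear w (by simp only [Side.sg]; omega)
        (by simp only [Side.sg]; omega)
    rcases lt_trichotomy x (a + 3 ^ (k + 1) * t) with h1 | h1 | h1
    · rcases lt_trichotomy x a with h2 | rfl | h2
      · exact hc.eq_left hc' hrow h2 hh
      · rw [had hc, had hc']
      · exact hc.valid.eq_left hc'.valid h1 (by rw [hap hc, hap hc'])
          fun w h3 h4 => .inr ⟨hbl hc w (by omega) h3, hbl hc' w (by omega) h3⟩
    · rw [h1, hap hc, hap hc']
    · exact hc.valid.eq_right hc'.valid h1 (by rw [hap hc, hap hc'])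
          fun w h3 h4 => .inr ⟨hbr hc w h3 (by omega), hbr hc' w h3 (by omega)⟩
  | succ n ih =>
    have ih' : ∀ x, x < a + 3 ^ (k + 1 + 1) * t → c x (h + 1) = c' x (h + 1) := fun x hx =>
      ih hx (by omega) (by omega) (by push_cast at hn; omega)
    -- The signals that the `d`-line on the right sends to the left are the same in both
    -- configurations, because the colour on its left is.
    have hbar : ∀ p : Par, p.vel < 0 → (c (a + 3 ^ (k + 1 + 1) * t) (h + 1)).out p =
        (c' (a + 3 ^ (k + 1 + 1) * t) (h + 1)).out p := by
      refine out_eq_of_col _ _ (hX hc _ (by omega) (by push_cast at hn; omega))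
        (hX hc' _ (by omega) (by push_cast at hn; omega)) ?_
      have h1 := (hc.valid (a + 3 ^ (k + 1 + 1) * t - 1) (h + 1)).color
      have h2 := (hc'.valid (a + 3 ^ (k + 1 + 1) * t - 1) (h + 1)).color
      rw [sub_add_cancel] at h1 h2
      rw [← h1, ← h2, ih' _ (by omega)]
    have hno : ∀ {c}, Tame c a b t h₀ → ∀ (x : ℤ) (p : Par), x < a + 3 ^ (k + 1 + 1) * t →
        a + 3 ^ (k + 1 + 1) * t < x - p.vel → (c (x - p.vel) (h + 1)).out p = false := by
      intro c hc x p h1 h2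
      by_contra ho
      rw [Bool.not_eq_false] at ho
      have hod := hc.valid.pred (hX hc h hh hk)
      have := hc.valid.order (s := R) (by simp only [Side.sg, vel_d]; omega) hod ho
      simp only [Side.sg, vel_d] at this
      omega
    have hor : ∀ x, x < a + 3 ^ (k + 1 + 1) * t → c x h = c' x h ∨
        ((c x h).blank = true ∧ (c' x h).blank = true) := by
      intro x hx
      refine inn_injective _ _ fun p => ?_
      rw [(hc.valid x h).vert, (hc'.valid x h).vert]
      rcases lt_trichotomy (x - p.vel) (a + 3 ^ (k + 1 + 1) * t) with h1 | h1 | h1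
      · rw [ih' _ h1]
      · rw [h1]; exact hbar p (by omega)
      · rw [hno hc x p hx h1, hno hc' x p hx h1]
    have hea : c a h = c' a h := by
      rcases hor a (by omega) with h1 | h1
      · exact h1
      · rw [(hc.dish h hh).not_blank] at h1
        cases h1.1
    rcases lt_trichotomy x a with h2 | rfl | h2
    · exact hc.eq_left hc' hrow h2 hh
    · exact hea
    · exact hc.valid.eq_right hc'.valid h2 (by rw [hea]) fun w _ h3 => hor w (by omega)

/-- The chain and the part of row `h₀` on its left determine the configuration. -/
theorem Tame.eq {a b t h₀ : ℤ} (hc : Tame c a b t h₀) (hc' : Tame c' a b t h₀)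
    (hrow : ∀ x, x < a → c x h₀ = c' x h₀) : c = c' := by
  refine hc.valid.eq_of_eq_above hc'.valid (h₀ := h₀) fun x h hh => ?_
  obtain ⟨k, hk⟩ := exists_le_three_pow_mul hc.chain.pos (max (x - a + 1) (h - b))
  have h1 := hc.chain.pos
  have h2 : (3 : ℤ) ^ k * t ≤ 3 ^ (k + 1) * t := by
    rw [pow_succ]; nlinarith [pow_pos (show (0 : ℤ) < 3 by norm_num) k]
  have h3 : (3 : ℤ) ^ (k + 1) * t ≤ 3 ^ (k + 1 + 1) * t := by
    rw [pow_succ _ (k + 1)]; nlinarith [pow_pos (show (0 : ℤ) < 3 by norm_num) (k + 1)]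
  exact hc.eq_of_lt hc' hrow k (by omega) hh (by omega)

/-! ### Countability -/

/-- Without events and `d`-lines, this number does not decrease when going to side `s`, and it
increases at every signal. -/
def Side.rank : Side → Col → Fin 3
  | R, .near R => 0
  | R, .near L => 2
  | L, .near L => 0
  | L, .near R => 2
  | _, _ => 1

theorem rank_lt : ∀ (s : Side) (t : Cell), t.event = false → t.inn .d = false → t.blank = false →
    s.rank (t.col s.opp) < s.rank (t.col s) := by decide +kernel

/-- A row without events and `d`-lines on side `s` of `x` is constant far away on this side. -/
theorem Valid.eventually_const (hc : Valid c) {s : Side} {x h : ℤ}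
    (he : ∀ z, 0 < s.sg * (z - x) → (c z h).event = false ∧ (c z h).inn .d = false) :
    ∃ (n : ℕ) (k : Cell), ∀ z, (n : ℤ) ≤ s.sg * (z - x) → c z h = k := by
  have hpos : ∀ n : ℕ, 0 < s.sg * (x + s.sg * (n + 1) - x) := fun n => by
    rw [mul_sub, s.sg_mul_add]; omega
  set f : ℕ → Cell := fun n => c (x + s.sg * (n + 1)) h with hf
  have hstep : ∀ n, (f n).col s = (f (n + 1)).col s.opp := fun n => by
    have := hc.col_step s (x + s.sg * (n + 1)) h
    simp only [hf]
    rw [this]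
    congr 2
    push_cast; ring
  have hrank : ∀ n, (f n).blank = false → s.rank ((f n).col s.opp) < s.rank ((f n).col s) :=
    fun n hb => rank_lt s _ (he _ (hpos n)).1 (he _ (hpos n)).2 hb
  have hmono : Monotone fun n => s.rank ((f n).col s.opp) := by
    refine monotone_nat_of_le_succ fun n => ?_
    rw [← hstep]
    by_cases hb : (f n).blank = true
    · rw [← col_of_blank' hb]
    · exact (hrank n (by simpa using hb)).le
  obtain ⟨N, hN⟩ := WellFoundedGT.monotone_chain_condition ⟨_, hmono⟩
  simp only [OrderHom.coe_mk] at hN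
  have hb : ∀ n, N ≤ n → (f n).blank = true := by
    intro n hn
    by_contra hb
    have := hrank n (by simpa using hb)
    rw [hstep n, ← hN n hn, ← hN (n + 1) (by omega)] at this
    exact this.false
  have hconst : ∀ n, f (N + n) = f N := by
    intro n
    induction n with
    | zero => rfl
    | succ n ih =>
      rw [← ih, ← add_assoc, eq_of_blank _ s.opp (hb (N + n + 1) (by omega)), ← hstep,
        ← eq_of_blank _ s (hb (N + n) (by omega))]
  refine ⟨N + 1, f N, fun z hz => ?_⟩
  obtain ⟨n, rfl⟩ := s.exists_eq_add (x := x) (y := z) (by push_cast at hz; omega)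
  rw [mul_sub, s.sg_mul_add] at hz
  rw [← hconst (n - N)]
  simp only [hf]
  congr 3
  push_cast at hz
  omega

/-- The rows that are constant far to the left and far to the right. -/
def tailConst : Set (ℤ → Cell) :=
  {f | ∃ (n : ℕ) (k k' : Cell), ∀ z, ((n : ℤ) ≤ z → f z = k) ∧ (z ≤ -n → f z = k')}

theorem countable_tailConst : tailConst.Countable := by
  have : tailConst ⊆ ⋃ (n : ℕ) (k : Cell) (k' : Cell),
      Set.range fun (g : Finset.Icc (-(n : ℤ)) n → Cell) (z : ℤ) =>
        if hz : z ∈ Finset.Icc (-(n : ℤ)) n then g ⟨z, hz⟩ else if 0 ≤ z then k else k' := by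
    rintro f ⟨n, k, k', hf⟩
    simp only [Set.mem_iUnion, Set.mem_range]
    refine ⟨n, k, k', fun z => f z, ?_⟩
    funext z
    split_ifs with h1 h2
    · rfl
    · rw [Finset.mem_Icc] at h1
      exact ((hf z).1 (by omega)).symm
    · rw [Finset.mem_Icc] at h1
      exact ((hf z).2 (by omega)).symm
  refine Set.Countable.mono this ?_
  exact Set.countable_iUnion fun n => Set.countable_iUnion fun k => Set.countable_iUnion fun k' =>
    Set.countable_range _

/-- Where no events occur any more, the rows are constant far away on both sides. -/
theorem Valid.row_mem_tailConst (hc : Valid c) {h₀ : ℤ}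
    (he : ∀ x h, h₀ ≤ h → (c x h).event = false) : (fun x => c x h₀) ∈ tailConst := by
  have hd : ∀ {x}, (c x h₀).inn .d = true → ∀ g, h₀ ≤ g → (c x g).inn .d = true :=
    fun {x} hx g hg => hc.inn_d_above hx (fun g' hg' r k hap => by
      have := he x g' hg'
      rw [hap] at this
      cases this) hg
  have huniq : ∀ {x y}, (c x h₀).inn .d = true → (c y h₀).inn .d = true → x = y := by
    have : ∀ {x y}, (c x h₀).inn .d = true → (c y h₀).inn .d = true → ¬ x < y := by
      intro x y hx hy hlt
      obtain ⟨z, g, -, -, h3, r, k, hap⟩ := hc.exists_apex_between hlt (hd hx) (hd hy)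
      have := he z g h3
      rw [hap] at this
      cases this
    intro x y hx hy
    have h1 := this hx hy
    have h2 := this hy hx
    omega
  obtain ⟨x, hx⟩ : ∃ x, ∀ z, z ≠ x → (c z h₀).inn .d = false := by
    by_cases hex : ∃ x, (c x h₀).inn .d = true
    · obtain ⟨x, hx⟩ := hex
      refine ⟨x, fun z hz => ?_⟩
      by_contra hzd
      exact hz (huniq (by simpa using hzd) hx)
    · exact ⟨0, fun z _ => by by_contra hz; exact hex ⟨z, by simpa using hz⟩⟩
  obtain ⟨n, k, h1⟩ := hc.eventually_const (s := R) (x := x) (h := h₀) fun z hz =>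
    ⟨he z h₀ le_rfl, hx z (by rintro rfl; simp at hz)⟩
  obtain ⟨m, k', h2⟩ := hc.eventually_const (s := L) (x := x) (h := h₀) fun z hz =>
    ⟨he z h₀ le_rfl, hx z (by rintro rfl; simp at hz)⟩
  simp only [Side.sg] at h1 h2
  exact ⟨n + m + (x.toNat + (-x).toNat), k, k', fun z =>
    ⟨fun hz => h1 z (by push_cast at hz; omega),
    fun hz => h2 z (by push_cast at hz; omega)⟩⟩

theorem Tame.row_mem_tailConst {a b t h₀ : ℤ} (hc : Tame c a b t h₀) :
    (fun x => if x < a then c x h₀ else .mark) ∈ tailConst := by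
  have hle := hc.le
  obtain ⟨m, k', h2⟩ := hc.valid.eventually_const (s := L) (x := a) (h := h₀) fun z hz =>
    ⟨hc.calm z h₀ (by simp only [Side.sg] at hz; omega) le_rfl,
      hc.valid.no_d_left (h₀ := h₀) (fun g hg => hc.chain.inn_d hc.valid (by omega))
        (by simp only [Side.sg] at hz; omega) le_rfl⟩
  simp only [Side.sg] at h2
  refine ⟨m + (a.toNat + (-a).toNat) + 1, .mark, k', fun z => ⟨fun hz => ?_, fun hz => ?_⟩⟩
  · exact if_neg (by push_cast at hz; omega)
  · push_cast at hz
    rw [← h2 z (by omega)]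
    exact if_pos (by omega)

/-- There are countably many valid configurations. -/
theorem countable_setOf_valid : {c : ℤ → ℤ → Cell | Valid c}.Countable := by
  have hsub : {c | Valid c} ⊆
      (⋃ (h₀ : ℤ), ⋃ f ∈ tailConst, {c | (Valid c ∧ ∀ x h, h₀ ≤ h → (c x h).event = false) ∧
        (fun x => c x h₀) = f}) ∪
      ⋃ (a : ℤ) (b : ℤ) (t : ℤ) (h₀ : ℤ), ⋃ f ∈ tailConst, {c | Tame c a b t h₀ ∧
        (fun x => if x < a then c x h₀ else .mark) = f} := by
    intro c (hc : Valid c)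
    by_cases hn : ∃ x h t, Node c x h t
    · right
      obtain ⟨x, h, t, hn⟩ := hn
      obtain ⟨n, hn'⟩ := exists_not_two_pow_dvd hn.pos
      obtain ⟨a, b, t, hch⟩ := hc.exists_chain n hn hn'
      obtain ⟨h₀, hT⟩ := hch.exists_tame hc
      simp only [Set.mem_iUnion]
      exact ⟨a, b, t, h₀, _, hT.row_mem_tailConst, hT, rfl⟩
    · left
      obtain ⟨h₀, he⟩ := hc.exists_no_event fun x h t hxt => hn ⟨x, h, t, hxt⟩
      simp only [Set.mem_iUnion]
      exact ⟨h₀, _, hc.row_mem_tailConst he, ⟨hc, he⟩, rfl⟩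
  refine Set.Countable.mono hsub (Set.Countable.union ?_ ?_)
  · refine Set.countable_iUnion fun h₀ => countable_tailConst.biUnion fun f _ => ?_
    refine Set.Subsingleton.countable ?_
    rintro c ⟨⟨hc, he⟩, rfl⟩ c' ⟨⟨hc', he'⟩, hf⟩
    exact hc.eq_of_row_eq hc' he he' fun x => (congrFun hf x).symm
  · refine Set.countable_iUnion fun a => Set.countable_iUnion fun b => Set.countable_iUnion fun t =>
      Set.countable_iUnion fun h₀ => countable_tailConst.biUnion fun f _ => ?_
    refine Set.Subsingleton.countable ?_
    rintro c ⟨hc, rfl⟩ c' ⟨hc', hf⟩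
    refine hc.eq hc' fun x hx => ?_
    have := congrFun hf x
    simp only [hx, if_true] at this
    exact this.symm

/-! ### The right side of a `d`-line -/

/-- The side of the `d`-line on which a signal runs. -/
def Par.side : Par → Option Side
  | .d => none
  | .sep s => s
  | .lsep s => s
  | .inw s => s
  | .outw s _ => s

/-- The heights `3 ^ j * g` with `j < k`, at which there are apexes on the left side of a triangle
of height `3 ^ k * g`. -/
def LevR : ℕ → ℤ → ℤ → Prop
  | 0, _, _ => False
  | k + 1, g, S => S = 3 ^ k * g ∨ LevR k g S

/-- The numbers `S = 3 ^ j * 2 ^ (k - 1 - j) * g` with `j < k`. On the right side of a triangle of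
height `3 ^ k * g` there are apexes at the heights `2 * S`. -/
def LevL : ℕ → ℤ → ℤ → Prop
  | 0, _, _ => False
  | k + 1, g, S => S = 3 ^ k * g ∨ LevL k (2 * g) S

/-- The left side of a triangle of height `3 ^ k * g`, at height `h`. -/
def lineR : ℕ → ℤ → ℤ → Cell
  | 0, _, _ => .par (.lsep R)
  | k + 1, g, h => if h < 3 ^ k * g then lineR k g h else
      if h = 3 ^ k * g then .apex R h else .par (.sep R)

/-- The right side of a triangle of height `3 ^ k * g`, at height `h`. -/
def lineL : ℕ → ℤ → ℤ → Cell
  | 0, _, _ => .par (.lsep L)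
  | k + 1, g, h => if h < 2 * (3 ^ k * g) then lineL k (2 * g) h else
      if h = 2 * (3 ^ k * g) then .apex L h else .par (.sep L)

/-- The part of row `h` on the right of a `d`-line between an apex at height `S` and the next one at
height `3 * S`. The argument `y` is the distance to the `d`-line. The signal sent out by the upper
apex reaches the `d`-line at height `2 * S`, and after `S` more steps it reaches the lower apex. -/
def rowR (S y h : ℤ) : Cell :=
  if y < 2 * S - h then .bg (.near R) else
  if y = 2 * S - h then .par (.outw R y) else
  if y < 3 * h - 6 * S then .bg (.near R) else
  if y = 3 * h - 6 * S then .par (.inw R) else .bg (.far R)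

/-- The part of row `h` on the left of a `d`-line between an apex at height `2 * S` and the next one
at height `3 * S`. The argument `y` is the distance to the `d`-line. The signal sent out by the
upper apex reaches the `d`-line at height `5 * S / 2`. At height `h` it has made
`(5 * S - 2 * h) / 2` steps from there, which is congruent to `-y` modulo `3`. -/
def rowL (S y h : ℤ) : Cell :=
  if y < 20 * S - 8 * h then .bg (.near L) else
  if y = 20 * S - 8 * h then .par (.outw L (-y : ℤ)) else
  if y < 12 * h - 30 * S then .bg (.near L) else
  if y = 12 * h - 30 * S then .par (.inw L) else .bg (.far L)

/-- The region between a `d`-line and `lineR k g` on its right. -/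
def wedgeR : ℕ → ℤ → ℤ → ℤ → Cell
  | 0, _, _, _ => .bg (.near R)
  | k + 1, g, y, h => if y < 2 * (3 ^ k * g) - h then wedgeR k g y h else rowR (3 ^ k * g) y h

/-- The region between a `d`-line and `lineL k g` on its left. -/
def wedgeL : ℕ → ℤ → ℤ → ℤ → Cell
  | 0, _, _, _ => .bg (.near L)
  | k + 1, g, y, h => if y < 20 * (3 ^ k * g) - 8 * h then wedgeL k (2 * g) y h else
      rowL (3 ^ k * g) y h

theorem LevR.le {k : ℕ} {g S : ℤ} (hg : 0 < g) (h : LevR k g S) : g ≤ S ∧ 3 * S ≤ 3 ^ k * g := by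
  induction k with
  | zero => cases h
  | succ k ih =>
    have h1 : g ≤ 3 ^ k * g := by nlinarith [one_le_pow₀ (show (1 : ℤ) ≤ 3 by norm_num) (n := k)]
    have e : (3 : ℤ) ^ (k + 1) * g = 3 * (3 ^ k * g) := by ring
    rcases h with rfl | h
    · omega
    · have := ih h
      omega

/-- The next apex above. -/
theorem LevR.next {k : ℕ} {g S : ℤ} (h : LevR k g S) : 3 * S = 3 ^ k * g ∨ LevR k g (3 * S) := by
  induction k with
  | zero => cases h
  | succ k ih =>
    have e : (3 : ℤ) ^ (k + 1) * g = 3 * (3 ^ k * g) := by ring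
    rcases h with rfl | h
    · exact .inl e.symm
    · exact .inr (ih h)

theorem levR_top (k : ℕ) (g : ℤ) : 3 ^ k * g = g ∨ ∃ S, LevR k g S ∧ 3 ^ k * g = 3 * S := by
  cases k with
  | zero => simp
  | succ k => exact .inr ⟨3 ^ k * g, .inl rfl, by ring⟩

/-- The next apex below. -/
theorem LevR.prev {k : ℕ} {g S : ℤ} (h : LevR k g S) : S = g ∨ ∃ S', LevR k g S' ∧ S = 3 * S' := by
  induction k with
  | zero => cases h
  | succ k ih =>
    rcases h with rfl | h
    · rcases levR_top k g with h1 | ⟨S, h1, h2⟩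
      · exact .inl h1
      · exact .inr ⟨S, .inr h1, h2⟩
    · rcases ih h with h1 | ⟨S, h1, h2⟩
      · exact .inl h1
      · exact .inr ⟨S, .inr h1, h2⟩

/-- A height is below the lowest apex, between two consecutive ones, or above the last one. -/
theorem levR_cases (k : ℕ) (g h : ℤ) :
    h < g ∨ (∃ S, LevR k g S ∧ S ≤ h ∧ h < 3 * S) ∨ 3 ^ k * g ≤ h := by
  induction k with
  | zero => simp; omega
  | succ k ih =>
    rcases ih with h1 | ⟨S, h1, h2⟩ | h1
    · exact .inl h1
    · exact .inr (.inl ⟨S, .inr h1, h2⟩)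
    · by_cases h2 : h < 3 * (3 ^ k * g)
      · exact .inr (.inl ⟨_, .inl rfl, h1, h2⟩)
      · right; right
        rw [pow_succ]; linarith

theorem wedgeR_high {k : ℕ} {g y h : ℤ} (hg : 0 < g) (hh : 3 ^ k * g ≤ h) (hy : 0 < y)
    (hy' : y < 2 * (3 ^ k * g) - h) : wedgeR k g y h = .bg (.near R) := by
  cases k with
  | zero => rfl
  | succ k =>
    have e : (3 : ℤ) ^ (k + 1) * g = 3 * (3 ^ k * g) := by ring
    have hp : 0 < 3 ^ k * g := by positivity
    rw [wedgeR, rowR, if_neg (by omega), if_neg (by omega), if_neg (by omega), if_pos (by omega)]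

theorem wedgeR_low {k : ℕ} {g y h : ℤ} (hg : 0 < g) (hh : h < g) (hy : y < h) :
    wedgeR k g y h = .bg (.near R) := by
  induction k with
  | zero => rfl
  | succ k ih =>
    have h1 : g ≤ 3 ^ k * g := by nlinarith [one_le_pow₀ (show (1 : ℤ) ≤ 3 by norm_num) (n := k)]
    rw [wedgeR, if_pos (by omega), ih]

theorem wedgeR_lev {k : ℕ} {g S y h : ℤ} (hg : 0 < g) (hS : LevR k g S) (h1 : S ≤ h)
    (h2 : h < 3 * S) (hy : 0 < y) (hy' : y < h) : wedgeR k g y h = rowR S y h := by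
  induction k with
  | zero => cases hS
  | succ k ih =>
    rcases hS with rfl | hS
    · rw [wedgeR]
      split_ifs with h3
      · rw [wedgeR_high hg h1 hy h3, rowR, if_pos h3]
      · rfl
    · have := (hS.le hg).2
      rw [wedgeR, if_pos (by omega), ih hS]

theorem lineR_low {k : ℕ} {g h : ℤ} (hg : 0 < g) (hh : h < g) :
    lineR k g h = .par (.lsep R) := by
  induction k with
  | zero => rfl
  | succ k ih =>
    have h1 : g ≤ 3 ^ k * g := by nlinarith [one_le_pow₀ (show (1 : ℤ) ≤ 3 by norm_num) (n := k)]
    rw [lineR, if_pos (by omega), ih]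

theorem lineR_lev {k : ℕ} {g S h : ℤ} (hg : 0 < g) (hS : LevR k g S) (h1 : S ≤ h)
    (h2 : h < 3 * S) : lineR k g h = if h = S then .apex R h else .par (.sep R) := by
  induction k with
  | zero => cases hS
  | succ k ih =>
    rcases hS with rfl | hS
    · rw [lineR, if_neg (by omega)]
    · have := (hS.le hg).2
      rw [lineR, if_pos (by omega), ih hS]

theorem LevR.eq {k : ℕ} {g S S' h : ℤ} (hg : 0 < g) (hS : LevR k g S) (hS' : LevR k g S')
    (h1 : S ≤ h) (h2 : h < 3 * S) (h3 : S' ≤ h) (h4 : h < 3 * S') : S = S' := by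
  induction k with
  | zero => cases hS
  | succ k ih =>
    rcases hS with rfl | hS <;> rcases hS' with rfl | hS'
    · rfl
    · have := (hS'.le hg).2; omega
    · have := (hS.le hg).2; omega
    · exact ih hS hS'

/-- A signal leaving a cell continues in the next row, and it has the required distance from what
is in front of it. -/
def Leaves (c : ℤ → ℤ → Cell) (x h : ℤ) (p : Par) : Prop :=
  (c (x + p.vel) (h - 1)).inn p = true ∧
    ∀ j : ℤ, 0 < j → j < p.sweep → (c (x + p.dir * j) h).blank = true

/-- The region on the right of a `d`-line in column `m`, up to the left side of the triangle of
height `3 ^ k * g` with left corner `(m, 0)`, and above this triangle up to the prolongation of its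
right side. -/
structure RightZone (c : ℤ → ℤ → Cell) (m : ℤ) (k : ℕ) (g : ℤ) : Prop where
  base : c m 0 = .mark
  axis : ∀ h, 0 < h → 2 * h < 3 * (3 ^ k * g) →
    ((∃ S, LevR k g S ∧ h = 2 * S) ∧ c m h = .hit R) ∨
    ((¬ ∃ S, LevR k g S ∧ h = 2 * S) ∧ (c m h = .par .d ∨ c m h = .hit L))
  wedge : ∀ y h, 0 < y → y < h → y < 3 * (3 ^ k * g) - 2 * h → c (m + y) h = wedgeR k g y h
  line : ∀ h, 0 < h → h < 3 ^ k * g → c (m + h) h = lineR k g h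
  top : ∃ s, c (m + 3 ^ k * g) (3 ^ k * g) = .apex s (3 ^ k * g : ℤ)

theorem cast_three_mul (S : ℤ) : ((3 * S : ℤ) : ZMod 3) = 0 := by
  rw [Int.cast_mul, show ((3 : ℤ) : ZMod 3) = 0 from rfl, zero_mul]

theorem cast_ne_zero {g : ℤ} (hg : ¬ 3 ∣ g) : ((g : ℤ) : ZMod 3) ≠ 0 := fun h =>
  hg ((ZMod.intCast_zmod_eq_zero_iff_dvd g 3).1 h)

theorem RightZone.apex {m : ℤ} {k : ℕ} {g A : ℤ} (hz : RightZone c m k g) (hg : 0 < g)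
    (hA : A = 3 ^ k * g ∨ LevR k g A) : ∃ s, c (m + A) A = .apex s (A : ZMod 3) := by
  rcases hA with rfl | hA
  · exact hz.top
  · have := hA.le hg
    rw [hz.line A (by omega) (by omega), lineR_lev hg hA le_rfl (by omega), if_pos rfl]
    exact ⟨R, rfl⟩

theorem RightZone.row {m : ℤ} {k : ℕ} {g S y h : ℤ} (hz : RightZone c m k g) (hg : 0 < g)
    (hS : LevR k g S) (h1 : S ≤ h) (h2 : h < 3 * S) (hy : 0 < y) (hy' : y < h) :
    c (m + y) h = rowR S y h := by
  have := (hS.le hg).2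
  rw [hz.wedge y h hy hy' (by omega), wedgeR_lev hg hS h1 h2 hy hy']

theorem RightZone.sep {m : ℤ} {k : ℕ} {g S h : ℤ} (hz : RightZone c m k g) (hg : 0 < g)
    (hS : LevR k g S) (h1 : S < h) (h2 : h < 3 * S) : c (m + h) h = .par (.sep R) := by
  have := hS.le hg
  rw [hz.line h (by omega) (by omega), lineR_lev hg hS h1.le h2, if_neg (by omega)]

theorem RightZone.hit {m : ℤ} {k : ℕ} {g S : ℤ} (hz : RightZone c m k g) (hg : 0 < g)
    (hS : LevR k g S) : c m (2 * S) = .hit R := by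
  have := hS.le hg
  rcases hz.axis (2 * S) (by omega) (by omega) with h | h
  · exact h.2
  · exact absurd ⟨S, hS, rfl⟩ h.1

/-- The cells which a signal on the right of a `d`-line can enter. -/
theorem inn_side_R : ∀ (t : Cell) (p : Par), p.side = some R → t.inn p = true →
    (t = .mark → p = .lsep R) ∧ (∀ s, t = .hit s → s = R ∧ p = .inw R) ∧ t ≠ .par .d ∧
    (∀ s k, t = .apex s k → s = R ∧ (p = .sep R ∨ p = .outw R k)) := by decide +kernel

/-- Every signal on the right of a `d`-line comes from somewhere. -/
theorem RightZone.inn {m : ℤ} {k : ℕ} {g y h : ℤ} {p : Par} (hz : RightZone c m k g) (hg : 2 ≤ g)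
    (hg3 : ¬ 3 ∣ g) (hy : 0 ≤ y) (hyh : y ≤ h) (hreg : y < 3 * (3 ^ k * g) - 2 * h)
    (hp : p.side = some R) (hi : (c (m + y) h).inn p = true) :
    (c (m + (y - p.vel)) (h + 1)).out p = true := by
  have hg0 : 0 < g := by omega
  have hgk : g ≤ 3 ^ k * g := by
    nlinarith [one_le_pow₀ (show (1 : ℤ) ≤ 3 by norm_num) (n := k)]
  obtain ⟨i1, i2, i3, i4⟩ := inn_side_R _ p hp hi
  -- the line `lsep R` below the lowest apex, which is at height `g`
  have hlsep : ∀ h, 0 < h → h ≤ g → (c (m + h) h).out (.lsep R) = true := by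
    intro h h1 h2
    rcases h2.lt_or_eq with h2 | rfl
    · rw [hz.line h h1 (by omega), lineR_low hg0 h2]; rfl
    · have : h = 3 ^ k * h ∨ LevR k h h := by
        rcases levR_cases k h h with h2 | ⟨S, h2, h3, h4⟩ | h2
        · omega
        · have := h2.le hg0
          obtain rfl : S = h := by omega
          exact .inr h2
        · exact .inl (by omega)
      obtain ⟨s, hs⟩ := hz.apex hg0 this
      rw [hs]; simp [Cell.out, cast_ne_zero hg3]
  -- the line `sep R` and the signal `inw R`, which start from the same apex
  have htop : ∀ S, LevR k g S → ∃ s, c (m + 3 * S) (3 * S) = .apex s 0 := by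
    intro S hS
    obtain ⟨s, hs⟩ := hz.apex hg0 (hS.next.imp id id)
    rw [cast_three_mul] at hs
    exact ⟨s, hs⟩
  have hsep : ∀ S, LevR k g S → ∀ h, S < h → h ≤ 3 * S → (c (m + h) h).out (.sep R) = true := by
    intro S hS h h1 h2
    rcases h2.lt_or_eq with h2 | rfl
    · rw [hz.sep hg0 hS h1 h2]; rfl
    · obtain ⟨s, hs⟩ := htop S hS
      rw [hs]; cases s <;> rfl
  have hinw : ∀ S, LevR k g S → ∀ h, 2 * S < h → h ≤ 3 * S →
      (c (m + (3 * h - 6 * S)) h).out (.inw R) = true := by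
    intro S hS h h1 h2
    have := hS.le hg0
    rcases h2.lt_or_eq with h2 | rfl
    · rw [hz.row hg0 hS (by omega) h2 (by omega) (by omega), rowR, if_neg (by omega),
        if_neg (by omega), if_neg (by omega), if_pos rfl]; rfl
    · obtain ⟨s, hs⟩ := htop S hS
      rw [show 3 * (3 * S) - 6 * S = 3 * S by ring, hs]; cases s <;> rfl
  have houtw : ∀ S, LevR k g S → ∀ y h, 0 ≤ y → S < h → y = 2 * S - h →
      (c (m + y) h).out (.outw R (y + 1 : ℤ)) = true := by
    intro S hS y h hy h1 h2
    have := hS.le hg0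
    rcases hy.eq_or_lt with rfl | hy
    · rw [add_zero, show h = 2 * S by omega, hz.hit hg0 hS]
      simp [Cell.out]
    · rw [hz.row hg0 hS (by omega) (by omega) hy (by omega), rowR, if_neg (by omega), if_pos h2]
      simp [Cell.out]
  rcases hy.eq_or_lt with rfl | hy
  · rw [add_zero] at *
    rcases hyh.eq_or_lt with rfl | hh
    · obtain rfl := i1 hz.base
      exact hlsep 1 (by omega) (by omega)
    · rcases hz.axis h hh (by omega) with ⟨⟨S, hS, rfl⟩, h2⟩ | ⟨-, h2 | h2⟩
      · obtain ⟨-, rfl⟩ := i2 _ h2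
        have := hS.le hg0
        have := hinw S hS (2 * S + 1) (by omega) (by omega)
        rwa [show 3 * (2 * S + 1) - 6 * S = 0 - (Par.inw R).vel by simp [Par.vel]; ring] at this
      · exact absurd h2 i3
      · cases (i2 _ h2).1
  rcases hyh.lt_or_eq with hyh | rfl
  · have hblank : (c (m + y) h).blank = false := not_blank_of_inn _ _ hi
    rcases levR_cases k g h with h1 | ⟨S, hS, h1, h2⟩ | h1
    · rw [hz.wedge y h hy hyh hreg, wedgeR_low hg0 h1 hyh] at hblank
      cases hblank
    · have hle := hS.le hg0
      rw [hz.row hg0 hS h1 h2 hy hyh, rowR] at hi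
      split_ifs at hi with j1 j2 j3 j4
      · cases hi
      · obtain rfl := inn_par hi
        have := houtw S hS (y - 1) (h + 1) (by omega) (by omega) (by omega)
        rwa [sub_add_cancel] at this
      · cases hi
      · obtain rfl := inn_par hi
        have := hinw S hS (h + 1) (by omega) (by omega)
        rwa [show 3 * (h + 1) - 6 * S = y - (Par.inw R).vel by simp [Par.vel]; omega] at this
      · cases hi
    · rw [hz.wedge y h hy hyh hreg, wedgeR_high hg0 h1 hy (by omega)] at hblank
      cases hblank
  · rcases levR_cases k g y with h1 | ⟨S, hS, h1, h2⟩ | h1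
    · rw [hz.line y hy (by omega), lineR_low hg0 h1] at hi
      obtain rfl := inn_par hi
      exact hlsep (y + 1) (by omega) (by omega)
    · have hle := hS.le hg0
      rw [hz.line y hy (by omega), lineR_lev hg0 hS h1 h2] at hi
      have hs := hsep S hS (y + 1) (by omega) (by omega)
      split_ifs at hi with h3
      · rcases inn_apex hi with rfl | rfl
        · exact hs
        · have := houtw S hS (y - 1) (y + 1) (by omega) (by omega) (by omega)
          rwa [sub_add_cancel] at this
      · obtain rfl := inn_par hi
        exact hs
    · omega

/-- The cells which a signal on the right of a `d`-line can leave. -/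
theorem out_side_R : ∀ (t : Cell) (p : Par), p.side = some R → t.out p = true →
    (∀ s, t = .hit s → s = R ∧ p = .outw R 1) ∧ t ≠ .par .d ∧
    (∀ s k, t = .apex s k → (p = .lsep R ∧ k ≠ 0) ∨ ((p = .sep R ∨ p = .inw R) ∧ k = 0)) := by
  decide +kernel

theorem rowR_far {S y h : ℤ} (h1 : 2 * S - h < y) (h2 : 3 * h - 6 * S < y) :
    rowR S y h = .bg (.far R) := by
  rw [rowR, if_neg (by omega), if_neg (by omega), if_neg (by omega), if_neg (by omega)]

theorem rowR_near {S y h : ℤ} (h1 : y < 2 * S - h ∨ (2 * S - h < y ∧ y < 3 * h - 6 * S)) :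
    rowR S y h = .bg (.near R) := by
  rcases h1 with h1 | h1
  · rw [rowR, if_pos (by omega)]
  · rw [rowR, if_neg (by omega), if_neg (by omega), if_pos (by omega)]

theorem RightZone.lsep {m : ℤ} {k : ℕ} {g h : ℤ} (hz : RightZone c m k g) (hg : 0 < g)
    (h1 : 0 < h) (h2 : h < g) : c (m + h) h = .par (.lsep R) := by
  have hgk : g ≤ 3 ^ k * g := by
    nlinarith [one_le_pow₀ (show (1 : ℤ) ≤ 3 by norm_num) (n := k)]
  rw [hz.line h h1 (by omega), lineR_low hg h2]

/-- Every signal on the right of a `d`-line continues. -/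
theorem RightZone.leaves {m : ℤ} {k : ℕ} {g y h : ℤ} {p : Par} (hz : RightZone c m k g) (hg : 2 ≤ g)
    (hg3 : ¬ 3 ∣ g) (hy : 0 ≤ y) (hyh : y ≤ h) (hh : 0 < h)
    (hreg : y < 3 * (3 ^ k * g) - 2 * h ∨ (y = h ∧ h = 3 ^ k * g))
    (hp : p.side = some R) (hi : (c (m + y) h).out p = true) : Leaves c (m + y) h p := by
  have hg0 : 0 < g := by omega
  have hgk : g ≤ 3 ^ k * g := by
    nlinarith [one_le_pow₀ (show (1 : ℤ) ≤ 3 by norm_num) (n := k)]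
  obtain ⟨i1, i2, i3⟩ := out_side_R _ p hp hi
  have hlsep : ∀ h, 0 < h → h ≤ g → (c (m + (h - 1)) (h - 1)).inn (.lsep R) = true := by
    intro h h1 h2
    rcases (show 0 ≤ h - 1 by omega).eq_or_lt with h3 | h3
    · rw [← h3, add_zero, hz.base]; rfl
    · rw [hz.lsep hg0 h3 (by omega)]; rfl
  have houtw : ∀ S, LevR k g S → ∀ y h, S ≤ h → 0 < y → y = 2 * S - h →
      (c (m + y) h).inn (.outw R (y : ℤ)) = true := by
    intro S hS y h h1 hy h2
    have := hS.le hg0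
    rcases h1.eq_or_lt with rfl | h1
    · rw [show y = S by omega, hz.line S (by omega) (by omega),
        lineR_lev hg0 hS le_rfl (by omega), if_pos rfl]
      simp [Cell.inn]
    · rw [hz.row hg0 hS h1.le (by omega) hy (by omega), rowR, if_neg (by omega), if_pos h2]
      simp [Cell.inn]
  have hinw : ∀ S, LevR k g S → ∀ h, 2 * S ≤ h → h < 3 * S →
      (c (m + (3 * h - 6 * S)) h).inn (.inw R) = true := by
    intro S hS h h1 h2
    have := hS.le hg0
    rcases h1.eq_or_lt with rfl | h1
    · rw [show m + (3 * (2 * S) - 6 * S) = m by ring, hz.hit hg0 hS]; rfl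
    · rw [hz.row hg0 hS (by omega) h2 (by omega) (by omega), rowR, if_neg (by omega),
        if_neg (by omega), if_neg (by omega), if_pos rfl]; rfl
  have hsep : ∀ S, LevR k g S → ∀ h, S ≤ h → h < 3 * S →
      (c (m + h) h).inn (.sep R) = true := by
    intro S hS h h1 h2
    have := hS.le hg0
    rcases h1.eq_or_lt with rfl | h1
    · rw [hz.line _ (by omega) (by omega), lineR_lev hg0 hS le_rfl h2, if_pos rfl]; rfl
    · rw [hz.sep hg0 hS h1 h2]; rfl
  rcases hy.eq_or_lt with rfl | hy
  · rw [add_zero] at *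
    rcases hz.axis h hh (by omega) with ⟨⟨S, hS, rfl⟩, h2⟩ | ⟨-, h2 | h2⟩
    · obtain ⟨-, rfl⟩ := i1 _ h2
      have := hS.le hg0
      refine ⟨?_, fun j j1 j2 => ?_⟩
      · have := houtw S hS 1 (2 * S - 1) (by omega) (by omega) (by omega)
        rwa [Int.cast_one] at this
      · change j < 2 at j2
        obtain rfl : j = 1 := by omega
        change (c (m + 1) (2 * S)).blank = true
        rw [hz.row hg0 hS (by omega) (by omega) (by omega) (by omega),
          rowR_far (by omega) (by omega)]
        rfl
    · exact absurd h2 i2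
    · cases (i1 _ h2).1
  rcases hyh.lt_or_eq with hyh | rfl
  · have hblank : (c (m + y) h).blank = false := not_blank_of_out _ _ hi
    rcases levR_cases k g h with h1 | ⟨S, hS, h1, h2⟩ | h1
    · rw [hz.wedge y h hy hyh (by omega), wedgeR_low hg0 h1 hyh] at hblank
      cases hblank
    · have hle := hS.le hg0
      rw [hz.row hg0 hS h1 h2 hy hyh, rowR] at hi
      split_ifs at hi with j1 j2 j3 j4
      · cases hi
      · obtain rfl : p = .outw R (y + 1 : ℤ) := by simpa [Cell.out, eq_comm] using hi
        refine ⟨?_, fun j j1 j2 => ?_⟩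
        · rw [add_assoc]
          exact houtw S hS (y + 1) (h - 1) (by omega) (by omega) (by omega)
        · change j < 2 at j2
          obtain rfl : j = 1 := by omega
          change (c (m + y + 1) h).blank = true
          rw [add_assoc, hz.row hg0 hS h1 h2 (by omega) (by omega), rowR_far (by omega) (by omega)]
          rfl
      · cases hi
      · obtain rfl : p = .inw R := by simpa [Cell.out, eq_comm] using hi
        refine ⟨?_, fun j j1 j2 => ?_⟩
        · have := hinw S hS (h - 1) (by omega) (by omega)
          rwa [show m + (3 * (h - 1) - 6 * S) = m + y + (Par.inw R).vel by
            simp [Par.vel]; omega] at this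
        · change j < 3 at j2
          rw [show m + y + (Par.inw R).dir * j = m + (y - j) by simp [Par.dir, Side.sg]; ring,
            hz.row hg0 hS h1 h2 (by omega) (by omega), rowR_near (by omega)]
          rfl
      · cases hi
    · rw [hz.wedge y h hy hyh (by omega), wedgeR_high hg0 h1 hy (by omega)] at hblank
      cases hblank
  · have hleaf : y ≤ g → p = .lsep R → Leaves c (m + y) y p := by
      rintro h1 rfl
      refine ⟨?_, fun j j1 j2 => ?_⟩
      · have := hlsep y hy h1
        rwa [← add_sub_assoc] at this
      · change j < 1 at j2
        omega
    have hS3 : ∀ S, LevR k g S → y = 3 * S → p = .sep R ∨ p = .inw R → Leaves c (m + y) y p := by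
      rintro S hS rfl (rfl | rfl)
      · have := hS.le hg0
        refine ⟨?_, fun j j1 j2 => ?_⟩
        · have := hsep S hS (3 * S - 1) (by omega) (by omega)
          rwa [← add_sub_assoc] at this
        · change j < 1 at j2
          omega
      · have := hS.le hg0
        refine ⟨?_, fun j j1 j2 => ?_⟩
        · have := hinw S hS (3 * S - 1) (by omega) (by omega)
          rwa [show m + (3 * (3 * S - 1) - 6 * S) = m + 3 * S + (Par.inw R).vel by
            simp [Par.vel]; ring] at this
        · change j < 3 at j2
          rw [show m + 3 * S + (Par.inw R).dir * j = m + (3 * S - j) by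
            simp [Par.dir, Side.sg]; ring]
          rcases hS.next with h1 | h1
          · rw [hz.wedge _ _ (by omega) (by omega) (by omega),
              wedgeR_high hg0 h1.ge (by omega) (by omega)]
            rfl
          · rw [hz.row hg0 h1 le_rfl (by omega) (by omega) (by omega), rowR_near (by omega)]
            rfl
    have hapex : (y = g ∨ ∃ S, LevR k g S ∧ y = 3 * S) → (∃ s, c (m + y) y = .apex s (y : ZMod 3)) →
        Leaves c (m + y) y p := by
      rintro (rfl | ⟨S, hS, h1⟩) ⟨s, hs⟩
      · rcases i3 _ _ hs with ⟨h1, -⟩ | ⟨-, h1⟩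
        · exact hleaf le_rfl h1
        · exact absurd h1 (cast_ne_zero hg3)
      · rcases i3 _ _ hs with ⟨-, h2⟩ | ⟨h2, -⟩
        · rw [h1, cast_three_mul] at h2
          exact absurd rfl h2
        · exact hS3 S hS h1 h2
    rcases levR_cases k g y with h1 | ⟨S, hS, h1, h2⟩ | h1
    · rw [hz.lsep hg0 hy h1] at hi
      exact hleaf h1.le (by simpa [Cell.out, eq_comm] using hi)
    · have hle := hS.le hg0
      rcases h1.eq_or_lt with rfl | h1
      · exact hapex hS.prev (hz.apex hg0 (.inr hS))
      · rw [hz.sep hg0 hS h1 h2] at hi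
        obtain rfl : p = .sep R := by simpa [Cell.out, eq_comm] using hi
        refine ⟨?_, fun j j1 j2 => ?_⟩
        · have := hsep S hS (y - 1) (by omega) (by omega)
          rwa [← add_sub_assoc] at this
        · change j < 1 at j2
          omega
    · obtain rfl : y = 3 ^ k * g := by omega
      exact hapex (levR_top k g) hz.top

/-- The background colours on the right of a `d`-line fit together. -/
theorem RightZone.color {m : ℤ} {k : ℕ} {g y h : ℤ} (hz : RightZone c m k g) (hg : 2 ≤ g)
    (hy : 0 ≤ y) (hyh : y < h)
    (hreg : y + 1 < 3 * (3 ^ k * g) - 2 * h ∨ h ≤ 3 ^ k * g ∨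
      (y + 1 = 3 * (3 ^ k * g) - 2 * h ∧ (c (m + (y + 1)) h).col L = .near R)) :
    (c (m + y) h).col R = (c (m + (y + 1)) h).col L := by
  have hg0 : 0 < g := by omega
  have hgk : g ≤ 3 ^ k * g := by
    nlinarith [one_le_pow₀ (show (1 : ℤ) ≤ 3 by norm_num) (n := k)]
  -- rows with a single colour
  have hnear : (∀ y, 0 < y → y < h → y < 3 * (3 ^ k * g) - 2 * h → c (m + y) h = .bg (.near R)) →
      (¬ ∃ S, LevR k g S ∧ h = 2 * S) →
      ((h ≤ 3 ^ k * g ∧ (c (m + h) h).col L = .near R) ∨ 3 ^ k * g < h) →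
      (c (m + y) h).col R = (c (m + (y + 1)) h).col L := by
    intro h1 h2 h3
    have e1 : (c (m + y) h).col R = .near R := by
      rcases hy.eq_or_lt with rfl | hy
      · rw [add_zero]
        rcases hz.axis h hyh (by omega) with h4 | ⟨-, h4 | h4⟩
        · exact absurd h4.1 h2
        · rw [h4]; rfl
        · rw [h4]; rfl
      · rw [h1 y hy hyh (by omega)]; rfl
    rw [e1]
    by_cases h5 : y + 1 < h ∧ y + 1 < 3 * (3 ^ k * g) - 2 * h
    · rw [h1 (y + 1) (by omega) h5.1 h5.2]; rfl
    · rcases h3 with h3 | h3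
      · rw [show y + 1 = h by omega, h3.2]
      · rcases hreg with h4 | h4 | h4
        · omega
        · omega
        · rw [h4.2]
  rcases levR_cases k g h with h1 | ⟨S, hS, h1, h2⟩ | h1
  · refine hnear (fun y h3 h4 h5 => ?_) ?_ (.inl ⟨by omega, ?_⟩)
    · rw [hz.wedge y h h3 h4 h5, wedgeR_low hg0 h1 h4]
    · rintro ⟨S, hS, rfl⟩
      have := hS.le hg0
      omega
    · rw [hz.lsep hg0 (by omega) h1]; rfl
  · have hle := hS.le hg0
    -- the colour far from the `d`-line
    have hlast : (c (m + h) h).col L = (if h = S then .near R else .far R) := by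
      split_ifs with h3
      · obtain ⟨s, hs⟩ := hz.apex hg0 (.inr hS)
        rw [h3, hs]; rfl
      · rw [hz.sep hg0 hS (by omega) h2]; rfl
    have hrow : ∀ y, 0 < y → y < h → c (m + y) h = rowR S y h := fun y => hz.row hg0 hS h1 h2
    have hfirst : (c (m + 0) h).col R = if h = 2 * S then .far R else .near R := by
      rw [add_zero]
      split_ifs with h3
      · rw [h3, hz.hit hg0 hS]; rfl
      · rcases hz.axis h (by omega) (by omega) with ⟨⟨S', hS', rfl⟩, -⟩ | ⟨-, h4 | h4⟩
        · have := hS'.le hg0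
          exact absurd (by rw [hS.eq hg0 hS' h1 h2 (by omega) (by omega)]) h3
        · rw [h4]; rfl
        · rw [h4]; rfl
    have e1 : (c (m + y) h).col R = if y < 2 * S - h ∨ (2 * S - h < y ∧ y < 3 * h - 6 * S) then
        .near R else .far R := by
      rcases hy.eq_or_lt with rfl | hy
      · rw [hfirst]
        split_ifs <;> first | rfl | omega
      · rw [hrow y hy hyh, rowR]
        split_ifs <;> first | rfl | omega
    have e2 : (c (m + (y + 1)) h).col L = if y < 2 * S - h ∨ (2 * S - h < y ∧ y < 3 * h - 6 * S)
        then .near R else .far R := by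
      by_cases h3 : y + 1 < h
      · rw [hrow (y + 1) (by omega) h3, rowR]
        split_ifs <;> first | rfl | omega
      · rw [show y + 1 = h by omega, hlast]
        split_ifs <;> first | rfl | omega
    rw [e1, e2]
  · refine hnear (fun y h3 h4 h5 => ?_) ?_ ?_
    · rw [hz.wedge y h h3 h4 h5, wedgeR_high hg0 h1 h3 (by omega)]
    · rintro ⟨S, hS, rfl⟩
      have := hS.le hg0
      omega
    · rcases h1.eq_or_lt with h1 | h1
      · obtain ⟨s, hs⟩ := hz.top
        refine .inl ⟨h1.ge, ?_⟩
        rw [← h1, hs]; rfl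
      · exact .inr h1

/-! ### The left side of a `d`-line -/

theorem two_pow_le_three_pow_mul (k : ℕ) {g : ℤ} (hg : 0 < g) : 2 ^ k * g ≤ 3 ^ k * g :=
  mul_le_mul_of_nonneg_right (pow_le_pow_left₀ (by norm_num) (by norm_num) k) hg.le

theorem le_two_pow_mul (k : ℕ) {g : ℤ} (hg : 0 < g) : g ≤ 2 ^ k * g := by
  nlinarith [one_le_pow₀ (show (1 : ℤ) ≤ 2 by norm_num) (n := k)]

theorem LevL.le {k : ℕ} {g S : ℤ} (hg : 0 < g) (h : LevL k g S) :
    2 ^ k * g ≤ 2 * S ∧ 3 * S ≤ 3 ^ k * g := by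
  induction k generalizing g with
  | zero => cases h
  | succ k ih =>
    have h1 := two_pow_le_three_pow_mul k hg
    have h2 : 0 < 3 ^ k * g := by positivity
    have e : (3 : ℤ) ^ (k + 1) * g = 3 * (3 ^ k * g) := by ring
    have e' : (2 : ℤ) ^ (k + 1) * g = 2 * (2 ^ k * g) := by ring
    have e1 : (3 : ℤ) ^ k * (2 * g) = 2 * (3 ^ k * g) := by ring
    have e2 : (2 : ℤ) ^ k * (2 * g) = 2 * (2 ^ k * g) := by ring
    rcases h with rfl | h
    · omega
    · have := ih (by omega) h
      omega

theorem LevL.two_dvd {k : ℕ} {g S : ℤ} (hg : 2 ∣ g) (h : LevL k g S) : 2 ∣ S := by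
  induction k generalizing g with
  | zero => cases h
  | succ k ih =>
    rcases h with rfl | h
    · exact Dvd.dvd.mul_left hg _
    · exact ih (Dvd.intro _ rfl) h

theorem LevL.next {k : ℕ} {g S : ℤ} (h : LevL k g S) :
    3 * S = 3 ^ k * g ∨ ∃ S', LevL k g S' ∧ 2 * S' = 3 * S := by
  induction k generalizing g with
  | zero => cases h
  | succ k ih =>
    rcases h with rfl | h
    · left; ring
    · right
      rcases ih h with h1 | ⟨S', h1, h2⟩
      · exact ⟨3 ^ k * g, .inl rfl, by rw [h1]; ring⟩
      · exact ⟨S', .inr h1, h2⟩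

theorem levL_top (k : ℕ) (g : ℤ) :
    3 ^ k * g = 2 ^ k * g ∨ ∃ S, LevL k g S ∧ 3 ^ k * g = 3 * S := by
  cases k with
  | zero => simp
  | succ k => exact .inr ⟨3 ^ k * g, .inl rfl, by ring⟩

theorem LevL.prev {k : ℕ} {g S : ℤ} (h : LevL k g S) :
    2 * S = 2 ^ k * g ∨ ∃ S', LevL k g S' ∧ 2 * S = 3 * S' := by
  induction k generalizing g with
  | zero => cases h
  | succ k ih =>
    rcases h with rfl | h
    · rcases levL_top k (2 * g) with h1 | ⟨S, h1, h2⟩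
      · left; rw [show 2 * (3 ^ k * g) = 3 ^ k * (2 * g) by ring, h1]; ring
      · exact .inr ⟨S, .inr h1, by rw [← h2]; ring⟩
    · rcases ih h with h1 | ⟨S, h1, h2⟩
      · left; rw [h1]; ring
      · exact .inr ⟨S, .inr h1, h2⟩

theorem levL_cases (k : ℕ) (g h : ℤ) :
    h < 2 ^ k * g ∨ (∃ S, LevL k g S ∧ 2 * S ≤ h ∧ h < 3 * S) ∨ 3 ^ k * g ≤ h := by
  induction k generalizing g with
  | zero => simp; omega
  | succ k ih =>
    rcases ih (2 * g) with h1 | ⟨S, h1, h2⟩ | h1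
    · left; rw [pow_succ]; linarith
    · exact .inr (.inl ⟨S, .inr h1, h2⟩)
    · by_cases h2 : h < 3 * (3 ^ k * g)
      · exact .inr (.inl ⟨_, .inl rfl, by linarith, h2⟩)
      · right; right
        rw [pow_succ]; linarith

theorem LevL.eq {k : ℕ} {g S S' h : ℤ} (hg : 0 < g) (hS : LevL k g S) (hS' : LevL k g S')
    (h1 : 2 * S ≤ h) (h2 : h < 3 * S) (h3 : 2 * S' ≤ h) (h4 : h < 3 * S') : S = S' := by
  induction k generalizing g with
  | zero => cases hS
  | succ k ih =>
    have e : (3 : ℤ) ^ k * (2 * g) = 2 * (3 ^ k * g) := by ring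
    rcases hS with rfl | hS <;> rcases hS' with rfl | hS'
    · rfl
    · have := (hS'.le (by omega)).2; omega
    · have := (hS.le (by omega)).2; omega
    · exact ih (by omega) hS hS'

theorem wedgeL_high {k : ℕ} {g y h : ℤ} (hg : 0 < g) (hh : 3 ^ k * g ≤ h) (hy : 0 < y)
    (hy' : y < 10 * (3 ^ k * g) - 8 * h ∨ y < 3 * (3 ^ k * g) - h) :
    wedgeL k g y h = .bg (.near L) := by
  cases k with
  | zero => rfl
  | succ k =>
    have e : (3 : ℤ) ^ (k + 1) * g = 3 * (3 ^ k * g) := by ring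
    have hp : 0 < 3 ^ k * g := by positivity
    rw [wedgeL, rowL, if_neg (by omega), if_neg (by omega), if_neg (by omega), if_pos (by omega)]

theorem wedgeL_low {k : ℕ} {g y h : ℤ} (hg : 0 < g) (hh : h < 2 ^ k * g) (hy : y < 2 * h) :
    wedgeL k g y h = .bg (.near L) := by
  induction k generalizing g with
  | zero => rfl
  | succ k ih =>
    have h1 := two_pow_le_three_pow_mul k hg
    have e : (2 : ℤ) ^ (k + 1) * g = 2 * (2 ^ k * g) := by ring
    rw [wedgeL, if_pos (by omega), ih (by omega) (by linarith)]

theorem wedgeL_lev {k : ℕ} {g S y h : ℤ} (hg : 0 < g) (hS : LevL k g S) (h1 : 2 * S ≤ h)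
    (h2 : h < 3 * S) (hy : 0 < y) (hy' : y < 2 * h) : wedgeL k g y h = rowL S y h := by
  induction k generalizing g with
  | zero => cases hS
  | succ k ih =>
    have e : (3 : ℤ) ^ k * (2 * g) = 2 * (3 ^ k * g) := by ring
    rcases hS with rfl | hS
    · rw [wedgeL]
      split_ifs with h3
      · rw [wedgeL_high (by omega) (by omega) hy (.inl (by omega)), rowL, if_pos h3]
      · rfl
    · have := (hS.le (by omega)).2
      rw [wedgeL, if_pos (by omega), ih (by omega) hS]

theorem lineL_low {k : ℕ} {g h : ℤ} (hg : 0 < g) (hh : h < 2 ^ k * g) :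
    lineL k g h = .par (.lsep L) := by
  induction k generalizing g with
  | zero => rfl
  | succ k ih =>
    have h1 := two_pow_le_three_pow_mul k hg
    have e : (2 : ℤ) ^ (k + 1) * g = 2 * (2 ^ k * g) := by ring
    rw [lineL, if_pos (by omega), ih (by omega) (by linarith)]

theorem lineL_lev {k : ℕ} {g S h : ℤ} (hg : 0 < g) (hS : LevL k g S) (h1 : 2 * S ≤ h)
    (h2 : h < 3 * S) : lineL k g h = if h = 2 * S then .apex L h else .par (.sep L) := by
  induction k generalizing g with
  | zero => cases hS
  | succ k ih =>
    have e : (3 : ℤ) ^ k * (2 * g) = 2 * (3 ^ k * g) := by ring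
    rcases hS with rfl | hS
    · rw [lineL, if_neg (by omega)]
    · have := (hS.le (by omega)).2
      rw [lineL, if_pos (by omega), ih (by omega) hS]

/-- The region on the left of a `d`-line in column `m`, up to the right side of the triangle of
height `3 ^ k * g` with right corner `(m, 0)`, and above this triangle up to the prolongation of
its left side. -/
structure LeftZone (c : ℤ → ℤ → Cell) (m : ℤ) (k : ℕ) (g : ℤ) : Prop where
  base : c m 0 = .mark
  axis : ∀ h, 0 < h → h < 3 * (3 ^ k * g) →
    ((∃ S, LevL k g S ∧ 2 * h = 5 * S) ∧ c m h = .hit L) ∨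
    ((¬ ∃ S, LevL k g S ∧ 2 * h = 5 * S) ∧ (c m h = .par .d ∨ c m h = .hit R))
  wedge : ∀ y h, 0 < y → y < 2 * h → y < 3 * (3 ^ k * g) - h → c (m - y) h = wedgeL k g y h
  line : ∀ h, 0 < h → h < 3 ^ k * g → c (m - 2 * h) h = lineL k g h
  top : ∃ s, c (m - 2 * (3 ^ k * g)) (3 ^ k * g) = .apex s (3 ^ k * g : ℤ)

theorem cast_congr {a b : ℤ} (h : 3 ∣ b - a) : (a : ZMod 3) = b :=
  (ZMod.intCast_eq_intCast_iff_dvd_sub a b 3).2 h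

theorem not_three_dvd_two_pow_mul {k : ℕ} {g : ℤ} (hg : ¬ 3 ∣ g) : ¬ (3 : ℤ) ∣ 2 ^ k * g :=
  fun h => hg ((IsCoprime.pow_right (by norm_num : IsCoprime (3 : ℤ) 2)).dvd_of_dvd_mul_left h)

theorem LeftZone.apex {m : ℤ} {k : ℕ} {g A : ℤ} (hz : LeftZone c m k g) (hg : 0 < g)
    (hA : A = 3 ^ k * g ∨ ∃ S, LevL k g S ∧ A = 2 * S) :
    ∃ s, c (m - 2 * A) A = .apex s (A : ZMod 3) := by
  rcases hA with rfl | ⟨S, hS, rfl⟩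
  · exact hz.top
  · have := hS.le hg
    have := le_two_pow_mul k hg
    rw [hz.line _ (by omega) (by omega), lineL_lev hg hS le_rfl (by omega), if_pos rfl]
    exact ⟨L, rfl⟩

theorem LeftZone.row {m : ℤ} {k : ℕ} {g S y h : ℤ} (hz : LeftZone c m k g) (hg : 0 < g)
    (hS : LevL k g S) (h1 : 2 * S ≤ h) (h2 : h < 3 * S) (hy : 0 < y) (hy' : y < 2 * h) :
    c (m - y) h = rowL S y h := by
  have := (hS.le hg).2
  rw [hz.wedge y h hy hy' (by omega), wedgeL_lev hg hS h1 h2 hy hy']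

theorem LeftZone.sep {m : ℤ} {k : ℕ} {g S h : ℤ} (hz : LeftZone c m k g) (hg : 0 < g)
    (hS : LevL k g S) (h1 : 2 * S < h) (h2 : h < 3 * S) : c (m - 2 * h) h = .par (.sep L) := by
  have := hS.le hg
  have := le_two_pow_mul k hg
  rw [hz.line h (by omega) (by omega), lineL_lev hg hS h1.le h2, if_neg (by omega)]

theorem LeftZone.lsep {m : ℤ} {k : ℕ} {g h : ℤ} (hz : LeftZone c m k g) (hg : 0 < g)
    (h1 : 0 < h) (h2 : h < 2 ^ k * g) : c (m - 2 * h) h = .par (.lsep L) := by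
  have := two_pow_le_three_pow_mul k hg
  rw [hz.line h h1 (by omega), lineL_low hg h2]

theorem LeftZone.hit {m : ℤ} {k : ℕ} {g S h : ℤ} (hz : LeftZone c m k g) (hg : 0 < g)
    (hS : LevL k g S) (hh : 2 * h = 5 * S) : c m h = .hit L := by
  have := hS.le hg
  have := le_two_pow_mul k hg
  rcases hz.axis h (by omega) (by omega) with h | h
  · exact h.2
  · exact absurd ⟨S, hS, hh⟩ h.1

/-- The cells which a signal on the left of a `d`-line can enter. -/
theorem inn_side_L : ∀ (t : Cell) (p : Par), p.side = some L → t.inn p = true →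
    (t = .mark → p = .lsep L) ∧ (∀ s, t = .hit s → s = L ∧ p = .inw L) ∧ t ≠ .par .d ∧
    (∀ s k, t = .apex s k → s = L ∧ (p = .sep L ∨ p = .outw L k)) := by decide +kernel

/-- The cells which a signal on the left of a `d`-line can leave. -/
theorem out_side_L : ∀ (t : Cell) (p : Par), p.side = some L → t.out p = true →
    (∀ s, t = .hit s → s = L ∧ p = .outw L 1) ∧ t ≠ .par .d ∧
    (∀ s k, t = .apex s k → (p = .lsep L ∧ k ≠ 0) ∨ ((p = .sep L ∨ p = .inw L) ∧ k = 0)) := by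
  decide +kernel

theorem rowL_far {S y h : ℤ} (h1 : 20 * S - 8 * h < y) (h2 : 12 * h - 30 * S < y) :
    rowL S y h = .bg (.far L) := by
  rw [rowL, if_neg (by omega), if_neg (by omega), if_neg (by omega), if_neg (by omega)]

theorem rowL_near {S y h : ℤ}
    (h1 : y < 20 * S - 8 * h ∨ (20 * S - 8 * h < y ∧ y < 12 * h - 30 * S)) :
    rowL S y h = .bg (.near L) := by
  rcases h1 with h1 | h1
  · rw [rowL, if_pos (by omega)]
  · rw [rowL, if_neg (by omega), if_neg (by omega), if_pos (by omega)]

/-- Every signal on the left of a `d`-line comes from somewhere. -/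
theorem LeftZone.inn {m : ℤ} {k : ℕ} {g y h : ℤ} {p : Par} (hz : LeftZone c m k g) (hg : 2 ≤ g)
    (hg2 : 2 ∣ g) (hg3 : ¬ 3 ∣ g) (hy : 0 ≤ y) (hyh : y ≤ 2 * h) (hreg : y < 3 * (3 ^ k * g) - h)
    (hp : p.side = some L) (hi : (c (m - y) h).inn p = true) :
    (c (m - (y + p.vel)) (h + 1)).out p = true := by
  have hg0 : 0 < g := by omega
  have hgk := two_pow_le_three_pow_mul k hg0
  have hgk' := le_two_pow_mul k hg0
  obtain ⟨i1, i2, i3, i4⟩ := inn_side_L _ p hp hi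
  have hlsep : ∀ h, 0 < h → h ≤ 2 ^ k * g → (c (m - 2 * h) h).out (.lsep L) = true := by
    intro h h1 h2
    rcases h2.lt_or_eq with h2 | h2
    · rw [hz.lsep hg0 h1 h2]; rfl
    · have h3 : h = 3 ^ k * g ∨ ∃ S, LevL k g S ∧ h = 2 * S := by
        rcases levL_cases k g h with h3 | ⟨S, h3, h4, h5⟩ | h3
        · omega
        · have := h3.le hg0
          exact .inr ⟨S, h3, by omega⟩
        · exact .inl (by omega)
      obtain ⟨s, hs⟩ := hz.apex hg0 h3
      have : ((h : ℤ) : ZMod 3) ≠ 0 := cast_ne_zero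
        (by rw [h2]; exact not_three_dvd_two_pow_mul hg3)
      rw [hs]; simp [Cell.out, this]
  have htop : ∀ S, LevL k g S → ∃ s, c (m - 6 * S) (3 * S) = .apex s 0 := by
    intro S hS
    have h3 : 3 * S = 3 ^ k * g ∨ ∃ S', LevL k g S' ∧ 3 * S = 2 * S' :=
      hS.next.imp id fun ⟨S', h1, h2⟩ => ⟨S', h1, h2.symm⟩
    obtain ⟨s, hs⟩ := hz.apex hg0 h3
    rw [cast_three_mul, show 2 * (3 * S) = 6 * S by ring] at hs
    exact ⟨s, hs⟩
  have hsep : ∀ S, LevL k g S → ∀ h, 2 * S < h → h ≤ 3 * S →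
      (c (m - 2 * h) h).out (.sep L) = true := by
    intro S hS h h1 h2
    rcases h2.lt_or_eq with h2 | rfl
    · rw [hz.sep hg0 hS h1 h2]; rfl
    · obtain ⟨s, hs⟩ := htop S hS
      rw [show 2 * (3 * S) = 6 * S by ring, hs]; cases s <;> rfl
  have hinw : ∀ S, LevL k g S → ∀ h, 5 * S < 2 * h → h ≤ 3 * S →
      (c (m - (12 * h - 30 * S)) h).out (.inw L) = true := by
    intro S hS h h1 h2
    have := hS.le hg0
    rcases h2.lt_or_eq with h2 | rfl
    · rw [hz.row hg0 hS (by omega) h2 (by omega) (by omega), rowL, if_neg (by omega),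
        if_neg (by omega), if_neg (by omega), if_pos rfl]; rfl
    · obtain ⟨s, hs⟩ := htop S hS
      rw [show 12 * (3 * S) - 30 * S = 6 * S by ring, hs]; cases s <;> rfl
  have houtw : ∀ S, LevL k g S → ∀ y h, 0 ≤ y → 2 * S < h → y = 20 * S - 8 * h → ∀ κ : ℤ,
      3 ∣ κ - (-y + 1) → (c (m - y) h).out (.outw L (κ : ZMod 3)) = true := by
    intro S hS y h hy h1 h2 κ hκ
    have := hS.le hg0
    rw [← cast_congr hκ]
    rcases hy.eq_or_lt with rfl | hy
    · rw [sub_zero, hz.hit hg0 hS (by omega)]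
      simp [Cell.out]
    · rw [hz.row hg0 hS (by omega) (by omega) hy (by omega), rowL, if_neg (by omega), if_pos h2]
      simp [Cell.out]
  rcases hy.eq_or_lt with rfl | hy
  · rw [sub_zero] at *
    rcases (show 0 ≤ h by omega).eq_or_lt with rfl | hh
    · obtain rfl := i1 hz.base
      exact hlsep 1 (by omega) (by omega)
    · rcases hz.axis h hh (by omega) with ⟨⟨S, hS, h1⟩, h2⟩ | ⟨-, h2 | h2⟩
      · obtain ⟨-, rfl⟩ := i2 _ h2
        have := hS.le hg0
        have := hinw S hS (h + 1) (by omega) (by omega)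
        rwa [show 12 * (h + 1) - 30 * S = 0 + (Par.inw L).vel by simp [Par.vel]; omega] at this
      · exact absurd h2 i3
      · cases (i2 _ h2).1
  rcases hyh.lt_or_eq with hyh | rfl
  · have hblank : (c (m - y) h).blank = false := not_blank_of_inn _ _ hi
    rcases levL_cases k g h with h1 | ⟨S, hS, h1, h2⟩ | h1
    · rw [hz.wedge y h hy hyh hreg, wedgeL_low hg0 h1 hyh] at hblank
      cases hblank
    · have hle := hS.le hg0
      have hS2 := hS.two_dvd hg2
      rw [hz.row hg0 hS h1 h2 hy hyh, rowL] at hi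
      split_ifs at hi with j1 j2 j3 j4
      · cases hi
      · obtain rfl := inn_par hi
        have := houtw S hS (y - 8) (h + 1) (by omega) (by omega) (by omega) (-y) ⟨-3, by ring⟩
        rwa [show y - 8 = y + (Par.outw L ((-y : ℤ) : ZMod 3)).vel from rfl] at this
      · cases hi
      · obtain rfl := inn_par hi
        have := hinw S hS (h + 1) (by omega) (by omega)
        rwa [show 12 * (h + 1) - 30 * S = y + (Par.inw L).vel by simp [Par.vel]; omega] at this
      · cases hi
    · rw [hz.wedge y h hy hyh hreg, wedgeL_high hg0 h1 hy (.inr hreg)] at hblank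
      cases hblank
  · have hpos : 0 < h := by omega
    rcases levL_cases k g h with h1 | ⟨S, hS, h1, h2⟩ | h1
    · rw [hz.lsep hg0 hpos h1] at hi
      obtain rfl := inn_par hi
      have := hlsep (h + 1) (by omega) (by omega)
      rwa [show 2 * (h + 1) = 2 * h + 2 by ring] at this
    · have hle := hS.le hg0
      have hS2 := hS.two_dvd hg2
      rw [hz.line h hpos (by omega), lineL_lev hg0 hS h1 h2] at hi
      have hs := hsep S hS (h + 1) (by omega) (by omega)
      rw [show 2 * (h + 1) = 2 * h + 2 by ring] at hs
      split_ifs at hi with h3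
      · rcases inn_apex hi with rfl | rfl
        · exact hs
        · exact houtw S hS (2 * h - 8) (h + 1) (by omega) (by omega) (by omega) h
            ⟨h - 3, by ring⟩
      · obtain rfl := inn_par hi
        exact hs
    · omega

/-- Every signal on the left of a `d`-line continues. -/
theorem LeftZone.leaves {m : ℤ} {k : ℕ} {g y h : ℤ} {p : Par} (hz : LeftZone c m k g) (hg : 2 ≤ g)
    (hg2 : 2 ∣ g) (hg3 : ¬ 3 ∣ g) (hy : 0 ≤ y) (hyh : y ≤ 2 * h) (hh : 0 < h)
    (hreg : y < 3 * (3 ^ k * g) - h ∨ (y = 2 * h ∧ h = 3 ^ k * g))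
    (hp : p.side = some L) (hi : (c (m - y) h).out p = true) : Leaves c (m - y) h p := by
  have hg0 : 0 < g := by omega
  have hgk := two_pow_le_three_pow_mul k hg0
  have hgk' := le_two_pow_mul k hg0
  obtain ⟨i1, i2, i3⟩ := out_side_L _ p hp hi
  have hlsep : ∀ h, 0 < h → h ≤ 2 ^ k * g → (c (m - 2 * h + 2) (h - 1)).inn (.lsep L) = true := by
    intro h h1 h2
    rw [show m - 2 * h + 2 = m - 2 * (h - 1) by ring]
    rcases (show 0 ≤ h - 1 by omega).eq_or_lt with h3 | h3
    · rw [← h3, mul_zero, sub_zero, hz.base]; rfl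
    · rw [hz.lsep hg0 h3 (by omega)]; rfl
  have houtw : ∀ S, LevL k g S → ∀ y h, 2 * S ≤ h → 0 < y → y = 20 * S - 8 * h → ∀ κ : ℤ,
      3 ∣ κ + y → (c (m - y) h).inn (.outw L (κ : ZMod 3)) = true := by
    intro S hS y h h1 hy h2 κ hκ
    have := hS.le hg0
    rcases h1.eq_or_lt with h1 | h1
    · rw [show y = 2 * h by omega, hz.line h (by omega) (by omega),
        lineL_lev hg0 hS h1.le (by omega), if_pos h1.symm,
        cast_congr (a := κ) (b := h) (by omega)]
      simp [Cell.inn]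
    · rw [hz.row hg0 hS h1.le (by omega) hy (by omega), rowL, if_neg (by omega), if_pos h2,
        cast_congr (a := κ) (b := -y) (by omega)]
      simp [Cell.inn]
  have hinw : ∀ S, LevL k g S → ∀ h, 5 * S ≤ 2 * h → h < 3 * S →
      (c (m - (12 * h - 30 * S)) h).inn (.inw L) = true := by
    intro S hS h h1 h2
    have := hS.le hg0
    rcases h1.eq_or_lt with h1 | h1
    · rw [show m - (12 * h - 30 * S) = m by omega, hz.hit hg0 hS h1.symm]; rfl
    · rw [hz.row hg0 hS (by omega) h2 (by omega) (by omega), rowL, if_neg (by omega),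
        if_neg (by omega), if_neg (by omega), if_pos rfl]; rfl
  have hsep : ∀ S, LevL k g S → ∀ h, 2 * S ≤ h → h < 3 * S →
      (c (m - 2 * h) h).inn (.sep L) = true := by
    intro S hS h h1 h2
    have := hS.le hg0
    rcases h1.eq_or_lt with rfl | h1
    · rw [hz.line _ (by omega) (by omega), lineL_lev hg0 hS le_rfl h2, if_pos rfl]; rfl
    · rw [hz.sep hg0 hS h1 h2]; rfl
  rcases hy.eq_or_lt with rfl | hy
  · rw [sub_zero] at *
    rcases hz.axis h hh (by omega) with ⟨⟨S, hS, h1⟩, h2⟩ | ⟨-, h2 | h2⟩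
    · obtain ⟨-, rfl⟩ := i1 _ h2
      have := hS.le hg0
      have hS2 := hS.two_dvd hg2
      refine ⟨?_, fun j j1 j2 => ?_⟩
      · have := houtw S hS 8 (h - 1) (by omega) (by omega) (by omega) 1 (by norm_num)
        rwa [Int.cast_one] at this
      · change j < 10 at j2
        rw [show m + (Par.outw L 1).dir * j = m - j by simp [Par.dir, Side.sg]; ring,
          hz.row hg0 hS (by omega) (by omega) (by omega) (by omega),
          rowL_far (by omega) (by omega)]
        rfl
    · exact absurd h2 i2
    · cases (i1 _ h2).1
  rcases hyh.lt_or_eq with hyh | rfl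
  · have hblank : (c (m - y) h).blank = false := not_blank_of_out _ _ hi
    rcases levL_cases k g h with h1 | ⟨S, hS, h1, h2⟩ | h1
    · rw [hz.wedge y h hy hyh (by omega), wedgeL_low hg0 h1 hyh] at hblank
      cases hblank
    · have hle := hS.le hg0
      have hS2 := hS.two_dvd hg2
      rw [hz.row hg0 hS h1 h2 hy hyh, rowL] at hi
      split_ifs at hi with j1 j2 j3 j4
      · cases hi
      · obtain rfl : p = .outw L (-y + 1 : ℤ) := by simpa [Cell.out, eq_comm] using hi
        refine ⟨?_, fun j j1 j2 => ?_⟩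
        · have := houtw S hS (y + 8) (h - 1) (by omega) (by omega) (by omega) (-y + 1) ⟨3, by ring⟩
          rwa [show m - (y + 8) = m - y + (Par.outw L ((-y + 1 : ℤ) : ZMod 3)).vel by
            simp [Par.vel]; ring] at this
        · change j < 10 at j2
          rw [show m - y + (Par.outw L ((-y + 1 : ℤ) : ZMod 3)).dir * j = m - (y + j) by
              simp [Par.dir, Side.sg]; ring,
            hz.row hg0 hS h1 h2 (by omega) (by omega), rowL_far (by omega) (by omega)]
          rfl
      · cases hi
      · obtain rfl : p = .inw L := by simpa [Cell.out, eq_comm] using hi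
        refine ⟨?_, fun j j1 j2 => ?_⟩
        · have := hinw S hS (h - 1) (by omega) (by omega)
          rwa [show m - (12 * (h - 1) - 30 * S) = m - y + (Par.inw L).vel by
            simp [Par.vel]; omega] at this
        · change j < 12 at j2
          rw [show m - y + (Par.inw L).dir * j = m - (y - j) by simp [Par.dir, Side.sg]; ring,
            hz.row hg0 hS h1 h2 (by omega) (by omega), rowL_near (by omega)]
          rfl
      · cases hi
    · rw [hz.wedge y h hy hyh (by omega), wedgeL_high hg0 h1 hy (by omega)] at hblank
      cases hblank
  · -- the cells next to an apex, on its right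
    have hnext : (h < 2 ^ k * g ∨ (∃ S, LevL k g S ∧ h = 2 * S) ∨ h = 3 ^ k * g) → ∀ y, 0 < y →
        y < 2 * h → (c (m - y) h).blank = true := by
      rintro (h1 | ⟨S, hS, h1⟩ | h1) y h3 h4
      · rw [hz.wedge y h h3 h4 (by omega), wedgeL_low hg0 h1 h4]; rfl
      · rw [hz.row hg0 hS h1.ge (by omega) h3 h4, rowL_near (by omega)]; rfl
      · rw [hz.wedge y h h3 h4 (by omega), wedgeL_high hg0 h1.ge h3 (by omega)]; rfl
    have hleaf : h ≤ 2 ^ k * g → (c (m - (2 * h - 1)) h).blank = true → p = .lsep L →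
        Leaves c (m - 2 * h) h p := by
      rintro h1 h2 rfl
      refine ⟨hlsep h hh h1, fun j j1 j2 => ?_⟩
      change j < 2 at j2
      rw [show m - 2 * h + (Par.lsep L).dir * j = m - (2 * h - 1) by
        simp [Par.dir, Side.sg]; omega, h2]
    have hS3 : ∀ S, LevL k g S → h = 3 * S → (∀ y, 0 < y → y < 2 * h → (c (m - y) h).blank = true) →
        p = .sep L ∨ p = .inw L → Leaves c (m - 2 * h) h p := by
      rintro S hS rfl h2 (rfl | rfl)
      · have := hS.le hg0
        refine ⟨?_, fun j j1 j2 => ?_⟩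
        · have := hsep S hS (3 * S - 1) (by omega) (by omega)
          rwa [show m - 2 * (3 * S - 1) = m - 2 * (3 * S) + 2 by ring] at this
        · change j < 2 at j2
          rw [show m - 2 * (3 * S) + (Par.sep L).dir * j = m - (2 * (3 * S) - 1) by
            simp [Par.dir, Side.sg]; omega]
          exact h2 _ (by omega) (by omega)
      · have := hS.le hg0
        have hS2 := hS.two_dvd hg2
        refine ⟨?_, fun j j1 j2 => ?_⟩
        · have := hinw S hS (3 * S - 1) (by omega) (by omega)
          rwa [show m - (12 * (3 * S - 1) - 30 * S) = m - 2 * (3 * S) + (Par.inw L).vel by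
            simp [Par.vel]; ring] at this
        · change j < 12 at j2
          rw [show m - 2 * (3 * S) + (Par.inw L).dir * j = m - (2 * (3 * S) - j) by
            simp [Par.dir, Side.sg]; ring]
          exact h2 _ (by omega) (by omega)
    have hapex : (h = 2 ^ k * g ∨ ∃ S, LevL k g S ∧ h = 3 * S) →
        (∀ y, 0 < y → y < 2 * h → (c (m - y) h).blank = true) →
        (∃ s, c (m - 2 * h) h = .apex s (h : ZMod 3)) → Leaves c (m - 2 * h) h p := by
      rintro (h1 | ⟨S, hS, h1⟩) h2 ⟨s, hs⟩
      · rcases i3 _ _ hs with ⟨h3, -⟩ | ⟨-, h3⟩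
        · exact hleaf h1.le (h2 _ (by omega) (by omega)) h3
        · exact absurd h3 (cast_ne_zero (by rw [h1]; exact not_three_dvd_two_pow_mul hg3))
      · rcases i3 _ _ hs with ⟨-, h3⟩ | ⟨h3, -⟩
        · rw [h1, cast_three_mul] at h3
          exact absurd rfl h3
        · exact hS3 S hS h1 h2 h3
    rcases levL_cases k g h with h1 | ⟨S, hS, h1, h2⟩ | h1
    · rw [hz.lsep hg0 hh h1] at hi
      exact hleaf h1.le (hnext (.inl h1) _ (by omega) (by omega))
        (by simpa [Cell.out, eq_comm] using hi)
    · have hle := hS.le hg0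
      rcases h1.eq_or_lt with rfl | h1
      · exact hapex hS.prev (hnext (.inr (.inl ⟨S, hS, rfl⟩)))
          (hz.apex hg0 (.inr ⟨S, hS, rfl⟩))
      · rw [hz.sep hg0 hS h1 h2] at hi
        obtain rfl : p = .sep L := by simpa [Cell.out, eq_comm] using hi
        refine ⟨?_, fun j j1 j2 => ?_⟩
        · have := hsep S hS (h - 1) (by omega) (by omega)
          rwa [show m - 2 * (h - 1) = m - 2 * h + 2 by ring] at this
        · change j < 2 at j2
          rw [show m - 2 * h + (Par.sep L).dir * j = m - (2 * h - 1) by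
            simp [Par.dir, Side.sg]; omega, hz.row hg0 hS h1.le h2 (by omega) (by omega),
            rowL_far (by omega) (by omega)]
          rfl
    · obtain rfl : h = 3 ^ k * g := by omega
      exact hapex (levL_top k g) (hnext (.inr (.inr rfl))) hz.top

/-- The background colours on the left of a `d`-line fit together. -/
theorem LeftZone.color {m : ℤ} {k : ℕ} {g y h : ℤ} (hz : LeftZone c m k g) (hg : 2 ≤ g)
    (hg2 : 2 ∣ g) (hh : 0 < h) (hy : 0 ≤ y) (hyh : y < 2 * h)
    (hreg : y + 1 < 3 * (3 ^ k * g) - h ∨ h ≤ 3 ^ k * g ∨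
      (y + 1 = 3 * (3 ^ k * g) - h ∧ (c (m - (y + 1)) h).col R = .near L)) :
    (c (m - (y + 1)) h).col R = (c (m - y) h).col L := by
  have hg0 : 0 < g := by omega
  have hgk := two_pow_le_three_pow_mul k hg0
  have hgk' := le_two_pow_mul k hg0
  have hnear : (∀ y, 0 < y → y < 2 * h → y < 3 * (3 ^ k * g) - h → c (m - y) h = .bg (.near L)) →
      (¬ ∃ S, LevL k g S ∧ 2 * h = 5 * S) →
      ((h ≤ 3 ^ k * g ∧ (c (m - 2 * h) h).col R = .near L) ∨ 3 ^ k * g < h) →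
      (c (m - (y + 1)) h).col R = (c (m - y) h).col L := by
    intro h1 h2 h3
    have e1 : (c (m - y) h).col L = .near L := by
      rcases hy.eq_or_lt with rfl | hy
      · rw [sub_zero]
        rcases hz.axis h hh (by omega) with h4 | ⟨-, h4 | h4⟩
        · exact absurd h4.1 h2
        · rw [h4]; rfl
        · rw [h4]; rfl
      · rw [h1 y hy hyh (by omega)]; rfl
    rw [e1]
    by_cases h5 : y + 1 < 2 * h ∧ y + 1 < 3 * (3 ^ k * g) - h
    · rw [h1 (y + 1) (by omega) h5.1 h5.2]; rfl
    · rcases h3 with h3 | h3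
      · rw [show y + 1 = 2 * h by omega, h3.2]
      · rcases hreg with h4 | h4 | h4
        · omega
        · omega
        · rw [h4.2]
  rcases levL_cases k g h with h1 | ⟨S, hS, h1, h2⟩ | h1
  · refine hnear (fun y h3 h4 h5 => ?_) ?_ (.inl ⟨by omega, ?_⟩)
    · rw [hz.wedge y h h3 h4 h5, wedgeL_low hg0 h1 h4]
    · rintro ⟨S, hS, h3⟩
      have := hS.le hg0
      omega
    · rw [hz.lsep hg0 hh h1]; rfl
  · have hle := hS.le hg0
    have hlast : (c (m - 2 * h) h).col R = (if h = 2 * S then .near L else .far L) := by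
      split_ifs with h3
      · obtain ⟨s, hs⟩ := hz.apex hg0 (.inr ⟨S, hS, rfl⟩)
        rw [h3, hs]; rfl
      · rw [hz.sep hg0 hS (by omega) h2]; rfl
    have hrow : ∀ y, 0 < y → y < 2 * h → c (m - y) h = rowL S y h := fun y =>
      hz.row hg0 hS h1 h2
    have hfirst : (c (m - 0) h).col L = if 2 * h = 5 * S then .far L else .near L := by
      rw [sub_zero]
      split_ifs with h3
      · rw [hz.hit hg0 hS h3]; rfl
      · rcases hz.axis h hh (by omega) with ⟨⟨S', hS', h4⟩, -⟩ | ⟨-, h4 | h4⟩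
        · have := hS'.le hg0
          exact absurd (by rw [hS.eq hg0 hS' h1 h2 (by omega) (by omega)]; exact h4) h3
        · rw [h4]; rfl
        · rw [h4]; rfl
    have e1 : (c (m - y) h).col L = if y < 20 * S - 8 * h ∨
        (20 * S - 8 * h < y ∧ y < 12 * h - 30 * S) then .near L else .far L := by
      rcases hy.eq_or_lt with rfl | hy
      · rw [hfirst]
        split_ifs <;> first | rfl | omega
      · rw [hrow y hy hyh, rowL]
        split_ifs <;> first | rfl | omega
    have e2 : (c (m - (y + 1)) h).col R = if y < 20 * S - 8 * h ∨
        (20 * S - 8 * h < y ∧ y < 12 * h - 30 * S) then .near L else .far L := by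
      by_cases h3 : y + 1 < 2 * h
      · rw [hrow (y + 1) (by omega) h3, rowL]
        split_ifs <;> first | rfl | omega
      · rw [show y + 1 = 2 * h by omega, hlast]
        split_ifs <;> first | rfl | omega
    rw [e1, e2]
  · refine hnear (fun y h3 h4 h5 => ?_) ?_ ?_
    · rw [hz.wedge y h h3 h4 h5, wedgeL_high hg0 h1 h3 (.inr h5)]
    · rintro ⟨S, hS, h3⟩
      have := hS.le hg0
      omega
    · rcases h1.eq_or_lt with h1 | h1
      · obtain ⟨s, hs⟩ := hz.top
        refine .inl ⟨h1.ge, ?_⟩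
        rw [← h1, hs]; rfl
      · exact .inr h1

/-! ### Triangles -/

open Classical in
/-- The `d`-line of a triangle of height `3 ^ (k + 1) * g`, at height `h`. On its right there is a
triangle of height `3 ^ k * (2 * g)`, and on its left one of height `3 ^ k * g`. -/
noncomputable def axis (k : ℕ) (g h : ℤ) : Cell :=
  if h = 0 then .mark else
  if ∃ S, LevR k (2 * g) S ∧ h = 2 * S then .hit R else
  if ∃ S, LevL k g S ∧ 2 * h = 5 * S then .hit L else .par .d

/-- The triangle of height `3 ^ k * g` with corners `(0, 0)` and `(3 * (3 ^ k * g), 0)`, without its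
sides. Its `d`-line divides the base in the ratio `1 : 2`, and there is a triangle of the same kind
on each side of it. -/
noncomputable def tri : ℕ → ℤ → ℤ → ℤ → Cell
  | 0, _, _, _ => .bg .E
  | k + 1, g, x, h =>
    if x < 3 * (3 ^ k * g) - 2 * h then tri k g x h else
    if 3 * (3 ^ k * g) + h < x then tri k (2 * g) (x - 3 * (3 ^ k * g)) h else
    if x = 3 * (3 ^ k * g) then axis k g h else
    if 3 * (3 ^ k * g) < x then
      if x = 3 * (3 ^ k * g) + h then lineR k (2 * g) h
      else wedgeR k (2 * g) (x - 3 * (3 ^ k * g)) h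
    else
      if x = 3 * (3 ^ k * g) - 2 * h then lineL k g h
      else wedgeL k g (3 * (3 ^ k * g) - x) h

/-- The numbers that serve as parameter `g`. The parameter is even in order that the signals on the
left of a `d`-line reach it at integral heights. It is not divisible by `3`, so that the smallest
triangles are not divided, nor by `5`, so that the signals from the left and from the right never
reach a `d`-line at the same height. -/
structure Scale (g : ℤ) : Prop where
  two_le : 2 ≤ g
  two_dvd : 2 ∣ g
  three : ¬ 3 ∣ g
  five : ¬ 5 ∣ g

theorem Scale.double {g : ℤ} (hg : Scale g) : Scale (2 * g) :=
  ⟨by linarith [hg.two_le], Dvd.intro _ rfl, by have := hg.three; omega, by have := hg.five; omega⟩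

/-- The configuration `c` contains a triangle with left corner `(a, 0)`. -/
structure Triangle (c : ℤ → ℤ → Cell) (a : ℤ) (k : ℕ) (g : ℤ) : Prop where
  inside : ∀ x h, 0 ≤ h → h < x → x < 3 * (3 ^ k * g) - 2 * h → c (a + x) h = tri k g x h
  left : ∀ h, 0 < h → h < 3 ^ k * g → c (a + h) h = lineR k g h
  right : ∀ h, 0 < h → h < 3 ^ k * g → c (a + (3 * (3 ^ k * g) - 2 * h)) h = lineL k g h
  top : ∃ s, c (a + 3 ^ k * g) (3 ^ k * g) = .apex s (3 ^ k * g : ℤ)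
  corner_left : c a 0 = .mark
  corner_right : c (a + 3 * (3 ^ k * g)) 0 = .mark

theorem LevR.not_five_dvd {k : ℕ} {g S : ℤ} (hg : ¬ 5 ∣ g) (h : LevR k g S) : ¬ 5 ∣ S := by
  induction k with
  | zero => cases h
  | succ k ih =>
    rcases h with rfl | h
    · exact fun hd => hg ((IsCoprime.pow_right
        (by norm_num : IsCoprime (5 : ℤ) 3)).dvd_of_dvd_mul_left hd)
    · exact ih h

theorem axis_cases {k : ℕ} {g h : ℤ} (hg : Scale g) (hh : 0 < h) :
    ((∃ S, LevR k (2 * g) S ∧ h = 2 * S) ∧ (¬ ∃ S, LevL k g S ∧ 2 * h = 5 * S) ∧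
      axis k g h = .hit R) ∨
    ((¬ ∃ S, LevR k (2 * g) S ∧ h = 2 * S) ∧ (∃ S, LevL k g S ∧ 2 * h = 5 * S) ∧
      axis k g h = .hit L) ∨
    ((¬ ∃ S, LevR k (2 * g) S ∧ h = 2 * S) ∧ (¬ ∃ S, LevL k g S ∧ 2 * h = 5 * S) ∧
      axis k g h = .par .d) := by
  unfold axis
  rw [if_neg hh.ne']
  by_cases h1 : ∃ S, LevR k (2 * g) S ∧ h = 2 * S
  · refine .inl ⟨h1, ?_, if_pos h1⟩
    obtain ⟨S, hS, rfl⟩ := h1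
    rintro ⟨S', -, h2⟩
    have := hS.not_five_dvd hg.double.five
    omega
  · rw [if_neg h1]
    by_cases h2 : ∃ S, LevL k g S ∧ 2 * h = 5 * S
    · exact .inr (.inl ⟨h1, h2, if_pos h2⟩)
    · exact .inr (.inr ⟨h1, h2, if_neg h2⟩)

theorem axis_inn_out_d {k : ℕ} {g h : ℤ} (hg : Scale g) (hh : 0 < h) :
    (axis k g h).inn .d = true ∧ (axis k g h).out .d = true := by
  rcases axis_cases (k := k) hg hh with ⟨-, -, h1⟩ | ⟨-, -, h1⟩ | ⟨-, -, h1⟩ <;> rw [h1] <;>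
    exact ⟨rfl, rfl⟩

theorem Scale.pos {g : ℤ} (hg : Scale g) : 0 < g := by linarith [hg.two_le]

theorem Scale.two_le_height {g : ℤ} (hg : Scale g) (k : ℕ) : 2 ≤ 3 ^ k * g := by
  have := hg.two_le
  have := hg.pos
  nlinarith [one_le_pow₀ (show (1 : ℤ) ≤ 3 by norm_num) (n := k)]

theorem height_double (k : ℕ) (g : ℤ) : (3 : ℤ) ^ k * (2 * g) = 2 * (3 ^ k * g) := by ring

theorem height_succ (k : ℕ) (g : ℤ) : (3 : ℤ) ^ (k + 1) * g = 3 * (3 ^ k * g) := by ring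

namespace Triangle

variable {a g x h : ℤ} {k : ℕ} {p : Par}

theorem leftChild (hg : Scale g) (ht : Triangle c a (k + 1) g) : Triangle c a k g := by
  have e := height_succ k g
  have hk := hg.two_le_height k
  refine ⟨fun x h h1 h2 h3 => ?_, fun h h1 h2 => ?_, fun h h1 h2 => ?_, ⟨R, ?_⟩, ht.corner_left, ?_⟩
  · rw [ht.inside x h h1 h2 (by omega), tri, if_pos h3]
  · rw [ht.left h h1 (by omega), lineR, if_pos h2]
  · rw [ht.inside _ h h1.le (by omega) (by omega), tri, if_neg (by omega), if_neg (by omega),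
      if_neg (by omega), if_neg (by omega), if_pos rfl]
  · rw [ht.left _ (by omega) (by omega), lineR, if_neg (by omega), if_pos rfl]
  · rw [ht.inside _ 0 le_rfl (by omega) (by omega), tri, if_neg (by omega), if_neg (by omega),
      if_pos rfl, axis, if_pos rfl]

theorem rightChild (hg : Scale g) (ht : Triangle c a (k + 1) g) :
    Triangle c (a + 3 * (3 ^ k * g)) k (2 * g) := by
  have e := height_succ k g
  have e' := height_double k g
  have hk := hg.two_le_height k
  refine ⟨fun x h h1 h2 h3 => ?_, fun h h1 h2 => ?_, fun h h1 h2 => ?_, ⟨L, ?_⟩, ?_, ?_⟩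
  · rw [add_assoc, ht.inside _ h h1 (by omega) (by omega), tri, if_neg (by omega),
      if_pos (by omega), add_sub_cancel_left]
  · rw [add_assoc, ht.inside _ h h1.le (by omega) (by omega), tri, if_neg (by omega),
      if_neg (by omega), if_neg (by omega), if_pos (by omega), if_pos rfl]
  · rw [add_assoc, show 3 * (3 ^ k * g) + (3 * (3 ^ k * (2 * g)) - 2 * h) =
      3 * (3 ^ (k + 1) * g) - 2 * h by omega, ht.right h h1 (by omega), lineL, if_pos (by omega)]
  · rw [show a + 3 * (3 ^ k * g) + 3 ^ k * (2 * g) =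
      a + (3 * (3 ^ (k + 1) * g) - 2 * (3 ^ k * (2 * g))) by omega,
      ht.right _ (by omega) (by omega), lineL, if_neg (by omega), if_pos (by omega)]
  · exact (ht.leftChild hg).corner_right
  · have := ht.corner_right
    rwa [show a + 3 * (3 ^ (k + 1) * g) = a + 3 * (3 ^ k * g) + 3 * (3 ^ k * (2 * g)) by omega]
      at this

theorem axis_eq (hg : Scale g) (ht : Triangle c a (k + 1) g) (h1 : 0 ≤ h)
    (h2 : h < 3 * (3 ^ k * g)) : c (a + 3 * (3 ^ k * g)) h = axis k g h := by
  have e := height_succ k g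
  have hk := hg.two_le_height k
  rw [ht.inside _ h h1 (by omega) (by omega), tri, if_neg (by omega), if_neg (by omega),
    if_pos rfl]

theorem rightZone (hg : Scale g) (ht : Triangle c a (k + 1) g) :
    RightZone c (a + 3 * (3 ^ k * g)) k (2 * g) := by
  have e := height_succ k g
  have e' := height_double k g
  have hk := hg.two_le_height k
  have hR := ht.rightChild hg
  refine ⟨hR.corner_left, fun h h1 h2 => ?_, fun y h h1 h2 h3 => ?_, hR.left, hR.top⟩
  · rw [ht.axis_eq hg h1.le (by omega)]
    rcases axis_cases (k := k) hg h1 with ⟨i1, i2, i3⟩ | ⟨i1, i2, i3⟩ | ⟨i1, i2, i3⟩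
    · exact .inl ⟨i1, i3⟩
    · exact .inr ⟨i1, .inr i3⟩
    · exact .inr ⟨i1, .inl i3⟩
  · rw [add_assoc, ht.inside _ h (by omega) (by omega) (by omega), tri, if_neg (by omega),
      if_neg (by omega), if_neg (by omega), if_pos (by omega), if_neg (by omega),
      add_sub_cancel_left]

theorem leftZone (hg : Scale g) (ht : Triangle c a (k + 1) g) :
    LeftZone c (a + 3 * (3 ^ k * g)) k g := by
  have e := height_succ k g
  have hk := hg.two_le_height k
  have hL := ht.leftChild hg
  refine ⟨hL.corner_right, fun h h1 h2 => ?_, fun y h h1 h2 h3 => ?_, fun h h1 h2 => ?_, ?_⟩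
  · rw [ht.axis_eq hg h1.le (by omega)]
    rcases axis_cases (k := k) hg h1 with ⟨i1, i2, i3⟩ | ⟨i1, i2, i3⟩ | ⟨i1, i2, i3⟩
    · exact .inr ⟨i2, .inr i3⟩
    · exact .inl ⟨i2, i3⟩
    · exact .inr ⟨i2, .inl i3⟩
  · rw [add_sub_assoc, ht.inside _ h (by omega) (by omega) (by omega), tri, if_neg (by omega),
      if_neg (by omega), if_neg (by omega), if_neg (by omega), if_neg (by omega), sub_sub_cancel]
  · rw [add_sub_assoc, hL.right h h1 h2]
  · have := hL.top
    rwa [show a + 3 * (3 ^ k * g) - 2 * (3 ^ k * g) = a + 3 ^ k * g by ring]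

theorem side_cases (p : Par) : p = .d ∨ p.side = some L ∨ p.side = some R := by
  revert p; decide +kernel

theorem wedgeL_inn_out {k : ℕ} {g y h : ℤ} (hpq : (wedgeL k g y h).inn p = true ∨
    (wedgeL k g y h).out p = true) : p.side = some L := by
  have aux : ∀ (t : Cell) (p : Par), (t = .bg (.near L) ∨ t = .bg (.far L) ∨ t = .par (.inw L) ∨
      ∃ k, t = .par (.outw L k)) → t.inn p = true ∨ t.out p = true → p.side = some L := by
    decide +kernel
  refine aux _ p ?_ hpq
  clear hpq
  induction k generalizing g with
  | zero => simp [wedgeL]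
  | succ k ih =>
    rw [wedgeL, rowL]
    split_ifs <;> simp [ih]

theorem wedgeR_inn_out {k : ℕ} {g y h : ℤ} (hpq : (wedgeR k g y h).inn p = true ∨
    (wedgeR k g y h).out p = true) : p.side = some R := by
  have aux : ∀ (t : Cell) (p : Par), (t = .bg (.near R) ∨ t = .bg (.far R) ∨ t = .par (.inw R) ∨
      ∃ k, t = .par (.outw R k)) → t.inn p = true ∨ t.out p = true → p.side = some R := by
    decide +kernel
  refine aux _ p ?_ hpq
  clear hpq
  induction k with
  | zero => simp [wedgeR]
  | succ k ih =>
    rw [wedgeR, rowR]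
    split_ifs <;> simp [ih]

theorem lineR_cases (k : ℕ) (g h : ℤ) : lineR k g h = .par (.lsep R) ∨
    lineR k g h = .par (.sep R) ∨ lineR k g h = .apex R (h : ZMod 3) := by
  induction k with
  | zero => simp [lineR]
  | succ k ih =>
    rw [lineR]
    split_ifs <;> simp [ih]

theorem lineL_cases (k : ℕ) (g h : ℤ) : lineL k g h = .par (.lsep L) ∨
    lineL k g h = .par (.sep L) ∨ lineL k g h = .apex L (h : ZMod 3) := by
  induction k generalizing g with
  | zero => simp [lineL]
  | succ k ih =>
    rw [lineL]
    split_ifs <;> simp [ih]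

theorem lineR_inn {k : ℕ} {g h : ℤ} (hp : (lineR k g h).inn p = true) : p.side = some R := by
  rcases lineR_cases k g h with h1 | h1 | h1 <;> rw [h1] at hp
  · rw [inn_par hp]; rfl
  · rw [inn_par hp]; rfl
  · rcases inn_apex hp with rfl | rfl <;> rfl

theorem lineL_inn {k : ℕ} {g h : ℤ} (hp : (lineL k g h).inn p = true) : p.side = some L := by
  rcases lineL_cases k g h with h1 | h1 | h1 <;> rw [h1] at hp
  · rw [inn_par hp]; rfl
  · rw [inn_par hp]; rfl
  · rcases inn_apex hp with rfl | rfl <;> rfl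

/-- The cells inside a triangle that has a `d`-line. -/
theorem cases_inside (hg : Scale g) (h0 : 0 ≤ h) (h1 : h < x)
    (h2 : x < 3 * (3 ^ (k + 1) * g) - 2 * h) :
    (h < x ∧ x < 3 * (3 ^ k * g) - 2 * h) ∨
    (x = 3 * (3 ^ k * g) - 2 * h ∧ 0 < h ∧ h < 3 ^ k * g) ∨
    (∃ y, x = 3 * (3 ^ k * g) - y ∧ 0 < y ∧ y < 2 * h ∧ y < 3 * (3 ^ k * g) - h) ∨
    (x = 3 * (3 ^ k * g) ∧ h < 3 * (3 ^ k * g)) ∨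
    (∃ y, x = 3 * (3 ^ k * g) + y ∧ 0 < y ∧ y < h ∧ y < 3 * (3 ^ k * (2 * g)) - 2 * h) ∨
    (x = 3 * (3 ^ k * g) + h ∧ 0 < h ∧ h < 3 ^ k * (2 * g)) ∨
    (∃ y, x = 3 * (3 ^ k * g) + y ∧ h < y ∧ y < 3 * (3 ^ k * (2 * g)) - 2 * h) := by
  have e := height_succ k g
  have e' := height_double k g
  have hk := hg.two_le_height k
  rw [e] at h2
  rw [e']
  generalize 3 ^ k * g = G at *
  by_cases c1 : x < 3 * G - 2 * h
  · exact .inl ⟨h1, c1⟩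
  by_cases c2 : x = 3 * G
  · exact .inr (.inr (.inr (.inl ⟨c2, by omega⟩)))
  by_cases c3 : x = 3 * G - 2 * h
  · exact .inr (.inl ⟨c3, by omega, by omega⟩)
  by_cases c4 : x < 3 * G
  · exact .inr (.inr (.inl ⟨3 * G - x, by omega, by omega, by omega, by omega⟩))
  by_cases c5 : x < 3 * G + h
  · exact .inr (.inr (.inr (.inr (.inl ⟨x - 3 * G, by omega, by omega, by omega, by omega⟩))))
  by_cases c6 : x = 3 * G + h
  · exact .inr (.inr (.inr (.inr (.inr (.inl ⟨c6, by omega, by omega⟩)))))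
  · exact .inr (.inr (.inr (.inr (.inr (.inr ⟨x - 3 * G, by omega, by omega, by omega⟩)))))

/-- Every signal inside a triangle comes from somewhere. -/
theorem inn (hg : Scale g) (ht : Triangle c a k g) (h0 : 0 ≤ h) (h1 : h < x)
    (h2 : x < 3 * (3 ^ k * g) - 2 * h) (hp : (c (a + x) h).inn p = true) :
    (c (a + x - p.vel) (h + 1)).out p = true := by
  induction k generalizing a g x with
  | zero =>
    rw [ht.inside x h h0 h1 h2] at hp
    cases hp
  | succ k ih =>
    have e := height_succ k g
    have e' := height_double k g
    have hk := hg.two_le_height k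
    have hLZ := ht.leftZone hg
    have hRZ := ht.rightZone hg
    have hLC := ht.leftChild hg
    have hRC := ht.rightChild hg
    rcases cases_inside hg h0 h1 h2 with ⟨i1, i2⟩ | ⟨rfl, i1, i2⟩ | ⟨y, rfl, i1, i2, i3⟩ |
      ⟨rfl, i1⟩ | ⟨y, rfl, i1, i2, i3⟩ | ⟨rfl, i1, i2⟩ | ⟨y, rfl, i1, i2⟩
    · exact ih hg hLC i1 i2 hp
    · rw [← add_sub_assoc] at hp ⊢
      rw [sub_sub]
      refine hLZ.inn hg.two_le hg.two_dvd hg.three (by omega) le_rfl (by omega) ?_ hp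
      rw [hLZ.line h i1 i2] at hp
      exact lineL_inn hp
    · rw [← add_sub_assoc] at hp ⊢
      rw [sub_sub]
      refine hLZ.inn hg.two_le hg.two_dvd hg.three i1.le i2.le i3 ?_ hp
      rw [hLZ.wedge y h i1 i2 i3] at hp
      exact wedgeL_inn_out (.inl hp)
    · rcases side_cases p with rfl | hs | hs
      · rw [vel_d, sub_zero]
        by_cases h3 : h + 1 < 3 * (3 ^ k * g)
        · rw [ht.axis_eq hg (by omega) h3]
          exact (axis_inn_out_d hg (by omega)).2
        · obtain ⟨s, hs⟩ := ht.top
          rw [e, cast_three_mul] at hs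
          rw [show h + 1 = 3 * (3 ^ k * g) by omega, hs]
          rfl
      · have := hLZ.inn (h := h) hg.two_le hg.two_dvd hg.three (y := 0) le_rfl (by omega)
          (by omega) hs (by simpa using hp)
        rwa [zero_add] at this
      · have := hRZ.inn (h := h) hg.double.two_le hg.double.three (y := 0) le_rfl (by omega)
          (by omega) hs (by simpa using hp)
        rwa [zero_sub, ← sub_eq_add_neg] at this
    · rw [← add_assoc] at hp ⊢
      rw [add_sub_assoc]
      refine hRZ.inn hg.double.two_le hg.double.three i1.le i2.le i3 ?_ hp
      rw [hRZ.wedge y h i1 i2 i3] at hp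
      exact wedgeR_inn_out (.inl hp)
    · rw [← add_assoc] at hp ⊢
      rw [add_sub_assoc]
      refine hRZ.inn hg.double.two_le hg.double.three (by omega) le_rfl (by omega) ?_ hp
      rw [hRZ.line h i1 i2] at hp
      exact lineR_inn hp
    · rw [← add_assoc] at hp ⊢
      exact ih hg.double hRC i1 i2 hp

/-- The `d`-line of a triangle continues below its apex. -/
theorem leaves_top (hg : Scale g) (ht : Triangle c a k g)
    (hp : (c (a + 3 ^ k * g) (3 ^ k * g)).out .d = true) :
    Leaves c (a + 3 ^ k * g) (3 ^ k * g) .d := by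
  refine ⟨?_, fun j j1 j2 => by change j < 1 at j2; omega⟩
  rw [vel_d, add_zero]
  cases k with
  | zero =>
    obtain ⟨s, hs⟩ := ht.top
    rw [hs] at hp
    have := cast_ne_zero hg.three
    simp [Cell.out, this] at hp
  | succ k =>
    have hk := hg.two_le_height k
    rw [height_succ, ht.axis_eq hg (by omega) (by omega)]
    exact (axis_inn_out_d hg (by omega)).1

theorem out_sep_side : ∀ (s : Side) (t : Cell), (t = .par (.sep s) ∨ t = .par (.lsep s)) →
    ∀ p : Par, t.out p = true → p.side = some s := by decide +kernel

/-- At an apex on the left side of a triangle, the signals that run into the triangle continue. -/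
theorem leaves_left (hg : Scale g) (ht : Triangle c a k g) (h1 : 0 < h) (h2 : h < 3 ^ k * g)
    (hs : p.side ≠ some R) (hp : (c (a + h) h).out p = true) : Leaves c (a + h) h p := by
  induction k generalizing a g with
  | zero =>
    rw [ht.left h h1 h2] at hp
    exact absurd (out_sep_side R _ (.inr rfl) p hp) hs
  | succ k ih =>
    have e := height_succ k g
    have hLC := ht.leftChild hg
    rcases lt_trichotomy h (3 ^ k * g) with h3 | rfl | h3
    · exact ih hg hLC h3 hp
    · rcases side_cases p with rfl | hs' | hs'
      · exact hLC.leaves_top hg hp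
      · have := (ht.leftZone hg).leaves (y := 2 * (3 ^ k * g)) hg.two_le hg.two_dvd hg.three
          (by omega) le_rfl h1 (.inr ⟨rfl, rfl⟩) hs'
        rw [show a + 3 * (3 ^ k * g) - 2 * (3 ^ k * g) = a + 3 ^ k * g by ring] at this
        exact this hp
      · exact absurd hs' hs
    · rw [ht.left h h1 h2, lineR, if_neg (by omega), if_neg (by omega)] at hp
      exact absurd (out_sep_side R _ (.inl rfl) p hp) hs

/-- At an apex on the right side of a triangle, the signals that run into the triangle continue. -/
theorem leaves_right (hg : Scale g) (ht : Triangle c a k g) (h1 : 0 < h) (h2 : h < 3 ^ k * g)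
    (hs : p.side ≠ some L) (hp : (c (a + (3 * (3 ^ k * g) - 2 * h)) h).out p = true) :
    Leaves c (a + (3 * (3 ^ k * g) - 2 * h)) h p := by
  induction k generalizing a g with
  | zero =>
    rw [ht.right h h1 h2] at hp
    exact absurd (out_sep_side L _ (.inr rfl) p hp) hs
  | succ k ih =>
    have e := height_succ k g
    have e' := height_double k g
    have hRC := ht.rightChild hg
    have ex : a + (3 * (3 ^ (k + 1) * g) - 2 * h) =
        a + 3 * (3 ^ k * g) + (3 * (3 ^ k * (2 * g)) - 2 * h) := by omega
    rcases lt_trichotomy h (3 ^ k * (2 * g)) with h3 | rfl | h3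
    · rw [ex] at hp ⊢
      exact ih hg.double hRC h3 hp
    · have ex' : a + (3 * (3 ^ (k + 1) * g) - 2 * (3 ^ k * (2 * g))) =
        a + 3 * (3 ^ k * g) + 3 ^ k * (2 * g) := by omega
      rw [ex'] at hp ⊢
      rcases side_cases p with rfl | hs' | hs'
      · exact hRC.leaves_top hg.double hp
      · exact absurd hs' hs
      · exact (ht.rightZone hg).leaves hg.double.two_le hg.double.three
          h1.le le_rfl h1 (.inr ⟨rfl, rfl⟩) hs' hp
    · rw [ht.right h h1 h2, lineL, if_neg (by omega), if_neg (by omega)] at hp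
      exact absurd (out_sep_side L _ (.inl rfl) p hp) hs

/-- Every signal inside a triangle continues. -/
theorem leaves (hg : Scale g) (ht : Triangle c a k g) (h0 : 0 ≤ h) (h1 : h < x)
    (h2 : x < 3 * (3 ^ k * g) - 2 * h) (hp : (c (a + x) h).out p = true) :
    Leaves c (a + x) h p := by
  induction k generalizing a g x with
  | zero =>
    rw [ht.inside x h h0 h1 h2] at hp
    cases hp
  | succ k ih =>
    have e := height_succ k g
    have e' := height_double k g
    have hk := hg.two_le_height k
    have hLZ := ht.leftZone hg
    have hRZ := ht.rightZone hg
    have hLC := ht.leftChild hg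
    have hRC := ht.rightChild hg
    rcases cases_inside hg h0 h1 h2 with ⟨i1, i2⟩ | ⟨rfl, i1, i2⟩ | ⟨y, rfl, i1, i2, i3⟩ |
      ⟨rfl, i1⟩ | ⟨y, rfl, i1, i2, i3⟩ | ⟨rfl, i1, i2⟩ | ⟨y, rfl, i1, i2⟩
    · exact ih hg hLC i1 i2 hp
    · by_cases hs : p.side = some L
      · rw [← add_sub_assoc] at hp ⊢
        exact hLZ.leaves hg.two_le hg.two_dvd hg.three (by omega) le_rfl i1 (.inl (by omega)) hs hp
      · exact hLC.leaves_right hg i1 i2 hs hp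
    · rw [← add_sub_assoc] at hp ⊢
      refine hLZ.leaves hg.two_le hg.two_dvd hg.three i1.le i2.le (by omega) (.inl i3) ?_ hp
      rw [hLZ.wedge y h i1 i2 i3] at hp
      exact wedgeL_inn_out (.inr hp)
    · rcases h0.eq_or_lt with rfl | h0
      · rw [ht.axis_eq hg le_rfl i1, axis, if_pos rfl] at hp
        cases hp
      rcases side_cases p with rfl | hs | hs
      · refine ⟨?_, fun j j1 j2 => by change j < 1 at j2; omega⟩
        rw [vel_d, add_zero]
        rcases (show 0 ≤ h - 1 by omega).eq_or_lt with h3 | h3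
        · rw [← h3, hLC.corner_right]; rfl
        · rw [ht.axis_eq hg (by omega) (by omega)]
          exact (axis_inn_out_d hg h3).1
      · have := hLZ.leaves hg.two_le hg.two_dvd hg.three (y := 0) (h := h) le_rfl (by omega) h0
          (.inl (by omega)) hs (by simpa using hp)
        rwa [sub_zero] at this
      · have := hRZ.leaves hg.double.two_le hg.double.three (y := 0) (h := h) le_rfl (by omega) h0
          (.inl (by omega)) hs (by simpa using hp)
        rwa [add_zero] at this
    · rw [← add_assoc] at hp ⊢
      refine hRZ.leaves hg.double.two_le hg.double.three i1.le i2.le (by omega) (.inl i3) ?_ hp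
      rw [hRZ.wedge y h i1 i2 i3] at hp
      exact wedgeR_inn_out (.inr hp)
    · rw [← add_assoc] at hp ⊢
      by_cases hs : p.side = some R
      · exact hRZ.leaves hg.double.two_le hg.double.three (by omega) le_rfl i1 (.inl (by omega)) hs
          hp
      · exact hRC.leaves_left hg.double i1 i2 hs hp
    · rw [← add_assoc] at hp ⊢
      exact ih hg.double hRC i1 i2 hp

/-- The background colours in a triangle fit together. -/
theorem color (hg : Scale g) (ht : Triangle c a k g) (h0 : 0 < h) (hh : h < 3 ^ k * g)
    (h1 : h ≤ x) (h2 : x < 3 * (3 ^ k * g) - 2 * h) :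
    (c (a + x) h).col R = (c (a + x + 1) h).col L := by
  induction k generalizing a g x with
  | zero =>
    have e1 : (c (a + x) h).col R = .E := by
      rcases h1.eq_or_lt with rfl | h1
      · rw [ht.left h h0 hh]; rfl
      · rw [ht.inside x h h0.le h1 h2]; rfl
    have e2 : (c (a + (x + 1)) h).col L = .E := by
      by_cases h3 : x + 1 < 3 * (3 ^ 0 * g) - 2 * h
      · rw [ht.inside _ h h0.le (by omega) h3]; rfl
      · rw [show x + 1 = 3 * (3 ^ 0 * g) - 2 * h by omega, ht.right h h0 hh]; rfl
    rw [e1, add_assoc, e2]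
  | succ k ih =>
    have e := height_succ k g
    have e' := height_double k g
    have hk := hg.two_le_height k
    rw [e] at hh h2
    by_cases c1 : x < 3 * (3 ^ k * g) - 2 * h
    · exact ih hg (ht.leftChild hg) (by omega) h1 c1
    by_cases c2 : x < 3 * (3 ^ k * g)
    · have := (ht.leftZone hg).color (y := 3 * (3 ^ k * g) - x - 1) (h := h) hg.two_le hg.two_dvd h0
        (by omega) (by omega) ?_
      · rwa [show a + 3 * (3 ^ k * g) - (3 * (3 ^ k * g) - x - 1 + 1) = a + x by ring,
          show a + 3 * (3 ^ k * g) - (3 * (3 ^ k * g) - x - 1) = a + x + 1 by ring] at this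
      · by_cases c3 : h ≤ 3 ^ k * g
        · exact .inr (.inl c3)
        · rcases h1.eq_or_lt with rfl | h1
          · refine .inr (.inr ⟨by omega, ?_⟩)
            rw [show a + 3 * (3 ^ k * g) - (3 * (3 ^ k * g) - h - 1 + 1) = a + h by ring,
              ht.left h h0 (by omega), lineR, if_neg (by omega), if_neg (by omega)]
            rfl
          · exact .inl (by omega)
    by_cases c3 : x < 3 * (3 ^ k * g) + h
    · have := (ht.rightZone hg).color (y := x - 3 * (3 ^ k * g)) (h := h) hg.double.two_le
        (by omega) (by omega) ?_
      · rwa [show a + 3 * (3 ^ k * g) + (x - 3 * (3 ^ k * g)) = a + x by ring,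
          show a + 3 * (3 ^ k * g) + (x - 3 * (3 ^ k * g) + 1) = a + x + 1 by ring] at this
      · by_cases c4 : h ≤ 3 ^ k * (2 * g)
        · exact .inr (.inl c4)
        · by_cases c5 : x + 1 < 3 * (3 * (3 ^ k * g)) - 2 * h
          · exact .inl (by omega)
          · refine .inr (.inr ⟨by omega, ?_⟩)
            rw [show a + 3 * (3 ^ k * g) + (x - 3 * (3 ^ k * g) + 1) =
              a + (3 * (3 ^ (k + 1) * g) - 2 * h) by omega, ht.right h h0 (by omega), lineL,
              if_neg (by omega), if_neg (by omega)]
            rfl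
    · have := ih (x := x - 3 * (3 ^ k * g)) hg.double (ht.rightChild hg) (by omega) (by omega)
        (by omega)
      rwa [show a + 3 * (3 ^ k * g) + (x - 3 * (3 ^ k * g)) = a + x by ring] at this

end Triangle

/-! ### The configurations of the descending chain -/

section Configuration

variable {g x h : ℤ} {p : Par}

open Classical in
/-- A configuration with parameter `g`: the union of the triangles with left corner `(0, 0)` and
heights `3 ^ k * g`, for all `k`. On the left of the column of this corner there is only the line
`lsep L`. -/
noncomputable def conf (g x h : ℤ) : Cell :=
  if h < 0 then .bg .E else
  if x < -2 * h then .bg .E else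
  if x < 0 then if x = -2 * h then .par (.lsep L) else .bg (.near L) else
  if x = 0 then
    if h = 0 then .mark else if ∃ k, ∃ S, LevR k g S ∧ h = 2 * S then .hit R else .par .d else
  if x < h then wedgeR (x + 2 * h).toNat g x h else
  if x = h then lineR (x + 2 * h).toNat g h else tri (x + 2 * h).toNat g x h

theorem lt_three_pow (n : ℤ) : n < 3 ^ n.toNat := by
  have h1 := Nat.lt_pow_self (n := n.toNat) (show 1 < 3 by norm_num)
  have h2 := Int.self_le_toNat n
  zify at h1
  omega

theorem lt_height (hg : 0 < g) (n : ℤ) : n < 3 ^ n.toNat * g := by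
  have h1 := lt_three_pow n
  have h2 : (0 : ℤ) < 3 ^ n.toNat := by positivity
  nlinarith

theorem height_mono {k l : ℕ} (hg : 0 < g) (hkl : k ≤ l) : (3 : ℤ) ^ k * g ≤ 3 ^ l * g := by
  gcongr
  norm_num

/-- The triangle of height `3 ^ k * g` is the left part of all larger ones. -/
theorem tri_eq {k l : ℕ} (hg : 0 < g) (hx : x < 3 * (3 ^ k * g) - 2 * h) (hkl : k ≤ l) :
    tri l g x h = tri k g x h := by
  induction l, hkl using Nat.le_induction with
  | base => rfl
  | succ l hkl ih =>
    have := height_mono hg hkl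
    rw [tri, if_pos (by omega), ih]

theorem lineR_eq {k l : ℕ} (hg : 0 < g) (hx : h < 3 ^ k * g) (hkl : k ≤ l) :
    lineR l g h = lineR k g h := by
  induction l, hkl using Nat.le_induction with
  | base => rfl
  | succ l hkl ih =>
    have := height_mono hg hkl
    rw [lineR, if_pos (by omega), ih]

theorem wedgeR_eq {k l : ℕ} (hg : 0 < g) (hx : x < 2 * (3 ^ k * g) - h) (hkl : k ≤ l) :
    wedgeR l g x h = wedgeR k g x h := by
  induction l, hkl using Nat.le_induction with
  | base => rfl
  | succ l hkl ih =>
    have := height_mono hg hkl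
    rw [wedgeR, if_pos (by omega), ih]

theorem levR_iff {k : ℕ} {S : ℤ} : LevR k g S ↔ ∃ j < k, S = 3 ^ j * g := by
  induction k with
  | zero => simp [LevR]
  | succ k ih =>
    simp only [LevR, ih, Nat.lt_succ_iff_lt_or_eq]
    constructor
    · rintro (h | ⟨j, h1, h2⟩)
      · exact ⟨k, .inr rfl, h⟩
      · exact ⟨j, .inl h1, h2⟩
    · rintro ⟨j, h1 | rfl, h2⟩
      · exact .inr ⟨j, h1, h2⟩
      · exact .inl h2

theorem LevR.of_lt {k l : ℕ} {S : ℤ} (hg : 0 < g) (hS : LevR l g S) (h1 : S < 3 ^ k * g) :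
    LevR k g S := by
  rw [levR_iff] at *
  obtain ⟨j, -, rfl⟩ := hS
  refine ⟨j, ?_, rfl⟩
  by_contra hj
  have := height_mono hg (not_lt.1 hj)
  omega

theorem conf_tri (hg : 0 < g) (k : ℕ) (h0 : 0 ≤ h) (h1 : h < x)
    (h2 : x < 3 * (3 ^ k * g) - 2 * h) : conf g x h = tri k g x h := by
  rw [conf, if_neg (by omega), if_neg (by omega), if_neg (by omega), if_neg (by omega),
    if_neg (by omega), if_neg (by omega)]
  rcases le_total k (x + 2 * h).toNat with h3 | h3
  · exact tri_eq hg h2 h3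
  · have := lt_height hg (x + 2 * h)
    exact (tri_eq hg (by omega) h3).symm

theorem conf_lineR (hg : 0 < g) (k : ℕ) (h0 : 0 < h) (h1 : h < 3 ^ k * g) :
    conf g h h = lineR k g h := by
  rw [conf, if_neg (by omega), if_neg (by omega), if_neg (by omega), if_neg (by omega),
    if_neg (by omega), if_pos rfl]
  rcases le_total k (h + 2 * h).toNat with h3 | h3
  · exact lineR_eq hg h1 h3
  · have := lt_height hg (h + 2 * h)
    exact (lineR_eq hg (by omega) h3).symm

theorem conf_wedgeR (hg : 0 < g) (k : ℕ) (h0 : 0 < x) (h1 : x < h)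
    (h2 : x < 3 * (3 ^ k * g) - 2 * h) : conf g x h = wedgeR k g x h := by
  rw [conf, if_neg (by omega), if_neg (by omega), if_neg (by omega), if_neg (by omega),
    if_pos (by omega)]
  rcases le_total k (x + 2 * h).toNat with h3 | h3
  · exact wedgeR_eq hg (by omega) h3
  · have := lt_height hg (x + 2 * h)
    exact (wedgeR_eq hg (by omega) h3).symm

theorem conf_corner : conf g 0 0 = .mark := by simp [conf]

theorem conf_axis (hh : 0 < h) : ((∃ k S, LevR k g S ∧ h = 2 * S) ∧ conf g 0 h = .hit R) ∨
    ((¬ ∃ k S, LevR k g S ∧ h = 2 * S) ∧ conf g 0 h = .par .d) := by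
  by_cases h1 : ∃ k, ∃ S, LevR k g S ∧ h = 2 * S
  · refine .inl ⟨h1, ?_⟩
    rw [conf, if_neg (by omega), if_neg (by omega), if_neg (by omega), if_pos rfl, if_neg hh.ne',
      if_pos h1]
  · refine .inr ⟨h1, ?_⟩
    rw [conf, if_neg (by omega), if_neg (by omega), if_neg (by omega), if_pos rfl, if_neg hh.ne',
      if_neg h1]

theorem conf_axis_d (h0 : 0 ≤ h) :
    (conf g 0 h).inn .d = true ∧ (0 < h → (conf g 0 h).out .d = true) := by
  rcases h0.eq_or_lt with rfl | h0
  · rw [conf_corner]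
    exact ⟨rfl, fun h => absurd h (lt_irrefl _)⟩
  · rcases conf_axis (g := g) h0 with ⟨-, h1⟩ | ⟨-, h1⟩ <;> rw [h1] <;> exact ⟨rfl, fun _ => rfl⟩

theorem conf_neg (hh : h < 0) : conf g x h = .bg .E := by rw [conf, if_pos hh]

theorem conf_left (hx : x < -2 * h) : conf g x h = .bg .E := by
  rw [conf, if_pos hx, ite_self]

theorem conf_lsep (hh : 0 < h) : conf g (-2 * h) h = .par (.lsep L) := by
  rw [conf, if_neg (by omega), if_neg (by omega), if_pos (by omega), if_pos rfl]

theorem conf_near (h1 : -2 * h < x) (h2 : x < 0) : conf g x h = .bg (.near L) := by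
  rw [conf, if_neg (by omega), if_neg (by omega), if_pos h2, if_neg (by omega)]

theorem conf_apex (hg : 0 < g) (k : ℕ) :
    conf g (3 ^ k * g) (3 ^ k * g) = .apex R (3 ^ k * g : ℤ) := by
  have e := height_succ k g
  have : 0 < 3 ^ k * g := by positivity
  rw [conf_lineR hg (k + 1) (by omega) (by omega), lineR, if_neg (lt_irrefl _), if_pos rfl]

theorem triangle_conf (hg : Scale g) (k : ℕ) : Triangle (conf g) 0 k g := by
  have e := height_succ k g
  have hk := hg.two_le_height k
  refine ⟨fun x h h0 h1 h2 => ?_, fun h h1 h2 => ?_, fun h h1 h2 => ?_, ⟨R, ?_⟩, conf_corner, ?_⟩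
  · rw [zero_add, conf_tri hg.pos k h0 h1 h2]
  · rw [zero_add, conf_lineR hg.pos k h1 h2]
  · rw [zero_add, conf_tri hg.pos (k + 1) (by omega) (by omega) (by omega), tri,
      if_neg (by omega), if_neg (by omega), if_neg (by omega), if_neg (by omega), if_pos rfl]
  · rw [zero_add, conf_apex hg.pos]
  · rw [zero_add, conf_tri hg.pos (k + 1) le_rfl (by omega) (by omega), tri, if_neg (by omega),
      if_neg (by omega), if_pos rfl, axis, if_pos rfl]

theorem rightZone_conf (hg : Scale g) (k : ℕ) : RightZone (conf g) 0 k g := by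
  have ht := triangle_conf hg k
  refine ⟨conf_corner, fun h h1 h2 => ?_, fun y h h1 h2 h3 => ?_, ht.left, ht.top⟩
  · rcases conf_axis (g := g) h1 with ⟨⟨l, S, h3, h4⟩, h5⟩ | ⟨h3, h4⟩
    · have := h3.le hg.pos
      exact .inl ⟨⟨S, h3.of_lt hg.pos (by have := hg.pos; omega), h4⟩, h5⟩
    · exact .inr ⟨fun h5 => h3 ⟨k, h5⟩, .inl h4⟩
  · rw [zero_add, conf_wedgeR hg.pos k h1 h2 h3]

/-- The cells of a configuration `conf g`. -/
theorem conf_cases (x : ℤ) {h : ℤ} (h0 : 0 ≤ h) : (x < -2 * h ∧ x < 0) ∨ (x = -2 * h ∧ 0 < h) ∨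
    (-2 * h < x ∧ x < 0) ∨ x = 0 ∨ (0 < x ∧ x < h) ∨ (x = h ∧ 0 < h) ∨ h < x := by omega

/-- Every signal of `conf g` comes from somewhere. -/
theorem conf_inn (hg : Scale g) (hp : (conf g x h).inn p = true) :
    (conf g (x - p.vel) (h + 1)).out p = true := by
  have hpos := hg.pos
  obtain ⟨k, hk⟩ : ∃ k : ℕ, |x| + 2 * |h| < 3 ^ k * g := ⟨_, lt_height hpos _⟩
  have hx := le_abs_self x
  have hh := le_abs_self h
  have hx0 := abs_nonneg x
  have hh0 := abs_nonneg h
  have ht := triangle_conf hg k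
  have hz := rightZone_conf hg k
  rcases lt_or_ge h 0 with h0 | h0
  · rw [conf_neg h0] at hp; cases hp
  have hzone : 0 ≤ x → x ≤ h → p.side = some R → (conf g (x - p.vel) (h + 1)).out p = true := by
    intro h1 h2 h3
    have := hz.inn (y := x) (h := h) hg.two_le hg.three h1 h2 (by omega) h3 (by rwa [zero_add])
    rwa [zero_add] at this
  rcases conf_cases x h0 with ⟨h1, h2⟩ | ⟨rfl, h1⟩ | ⟨h1, h2⟩ | rfl | ⟨h1, h2⟩ | ⟨rfl, h1⟩ | h1
  · rw [conf_left h1] at hp; cases hp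
  · rw [conf_lsep h1] at hp
    obtain rfl := inn_par hp
    rw [show -2 * h - (Par.lsep L).vel = -2 * (h + 1) by simp [Par.vel]; ring,
      conf_lsep (by omega)]
    rfl
  · rw [conf_near h1 h2] at hp; cases hp
  · rcases Triangle.side_cases p with rfl | hs | hs
    · exact (conf_axis_d (by omega)).2 (by omega)
    · rcases h0.eq_or_lt with rfl | h0
      · rw [conf_corner] at hp
        obtain rfl : p = .lsep L := by clear hzone; revert p; decide +kernel
        rw [show 0 - (Par.lsep L).vel = -2 * (0 + 1) from rfl, conf_lsep (by omega)]
        rfl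
      · rcases conf_axis (g := g) h0 with ⟨-, h1⟩ | ⟨-, h1⟩ <;> rw [h1] at hp <;> exfalso <;>
          (clear hzone; revert p; decide +kernel)
    · exact hzone le_rfl h0 hs
  · refine hzone h1.le h2.le ?_
    rw [conf_wedgeR hpos k h1 h2 (by omega)] at hp
    exact Triangle.wedgeR_inn_out (.inl hp)
  · refine hzone h1.le le_rfl ?_
    rw [conf_lineR hpos k h1 (by omega)] at hp
    exact Triangle.lineR_inn hp
  · have := ht.inn (x := x) hg h0 h1 (by omega) (by rwa [zero_add])
    rwa [zero_add] at this

/-- Every signal of `conf g` continues. -/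
theorem conf_leaves (hg : Scale g) (hp : (conf g x h).out p = true) : Leaves (conf g) x h p := by
  have hpos := hg.pos
  obtain ⟨k, hk⟩ : ∃ k : ℕ, |x| + 2 * |h| < 3 ^ k * g := ⟨_, lt_height hpos _⟩
  have hx := le_abs_self x
  have hh := le_abs_self h
  have hx0 := abs_nonneg x
  have hh0 := abs_nonneg h
  have ht := triangle_conf hg k
  have hz := rightZone_conf hg k
  rcases lt_or_ge h 0 with h0 | h0
  · rw [conf_neg h0] at hp; cases hp
  have hzone : 0 ≤ x → x ≤ h → 0 < h → p.side = some R → Leaves (conf g) x h p := by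
    intro h1 h2 h3 h4
    have := hz.leaves (y := x) (h := h) hg.two_le hg.three h1 h2 h3 (.inl (by omega)) h4
      (by rwa [zero_add])
    rwa [zero_add] at this
  rcases conf_cases x h0 with ⟨h1, h2⟩ | ⟨rfl, h1⟩ | ⟨h1, h2⟩ | rfl | ⟨h1, h2⟩ | ⟨rfl, h1⟩ | h1
  · rw [conf_left h1] at hp; cases hp
  · rw [conf_lsep h1] at hp
    obtain rfl : p = .lsep L := by simpa [Cell.out, eq_comm] using hp
    refine ⟨?_, fun j j1 j2 => ?_⟩
    · rw [show -2 * h + (Par.lsep L).vel = -2 * (h - 1) by simp [Par.vel]; ring]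
      rcases (show 0 ≤ h - 1 by omega).eq_or_lt with h2 | h2
      · rw [← h2, mul_zero, conf_corner]; rfl
      · rw [conf_lsep h2]; rfl
    · change j < 2 at j2
      rw [show (Par.lsep L).dir = 1 from rfl, conf_near (by omega) (by omega)]
      rfl
  · rw [conf_near h1 h2] at hp; cases hp
  · rcases h0.eq_or_lt with rfl | h0
    · rw [conf_corner] at hp; cases hp
    rcases Triangle.side_cases p with rfl | hs | hs
    · refine ⟨(conf_axis_d (by omega)).1, fun j j1 j2 => ?_⟩
      change j < 1 at j2
      omega
    · rcases conf_axis (g := g) h0 with ⟨-, h1⟩ | ⟨-, h1⟩ <;> rw [h1] at hp <;> exfalso <;>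
          (clear hzone; revert p; decide +kernel)
    · exact hzone le_rfl h0.le h0 hs
  · refine hzone h1.le h2.le (by omega) ?_
    rw [conf_wedgeR hpos k h1 h2 (by omega)] at hp
    exact Triangle.wedgeR_inn_out (.inr hp)
  · by_cases hs : p.side = some R
    · exact hzone h1.le le_rfl h1 hs
    · have := ht.leaves_left (h := x) hg h1 (by omega) hs (by rwa [zero_add])
      rwa [zero_add] at this
  · have := ht.leaves (x := x) hg h0 h1 (by omega) (by rwa [zero_add])
    rwa [zero_add] at this

theorem tri_zero (k : ℕ) (g x : ℤ) : tri k g x 0 = .bg .E ∨ tri k g x 0 = .mark := by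
  induction k generalizing g x with
  | zero => exact .inl rfl
  | succ k ih =>
    rw [tri]
    by_cases h1 : x < 3 * (3 ^ k * g) - 2 * 0
    · rw [if_pos h1]; exact ih _ _
    rw [if_neg h1]
    by_cases h2 : 3 * (3 ^ k * g) + 0 < x
    · rw [if_pos h2]; exact ih _ _
    rw [if_neg h2, if_pos (by omega), axis, if_pos rfl]
    exact .inr rfl

theorem conf_zero (g x : ℤ) : conf g x 0 = .bg .E ∨ conf g x 0 = .mark := by
  rcases conf_cases x le_rfl with ⟨h1, h2⟩ | ⟨rfl, h1⟩ | ⟨h1, h2⟩ | rfl | ⟨h1, h2⟩ | ⟨rfl, h1⟩ | h1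
  · exact .inl (conf_left h1)
  · omega
  · omega
  · exact .inr conf_corner
  · omega
  · omega
  · rw [conf, if_neg (by omega), if_neg (by omega), if_neg (by omega), if_neg (by omega),
      if_neg (by omega), if_neg (by omega)]
    exact tri_zero _ _ _

/-- The background colours of `conf g` fit together. -/
theorem conf_color (hg : Scale g) (x h : ℤ) : (conf g x h).col R = (conf g (x + 1) h).col L := by
  have hpos := hg.pos
  obtain ⟨k, hk⟩ : ∃ k : ℕ, |x| + 2 * |h| < 3 ^ k * g := ⟨_, lt_height hpos _⟩
  have hx := le_abs_self x
  have hh := le_abs_self h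
  have hx0 := abs_nonneg x
  have hh0 := abs_nonneg h
  have ht := triangle_conf hg k
  have hz := rightZone_conf hg k
  rcases lt_trichotomy h 0 with h0 | rfl | h0
  · rw [conf_neg h0, conf_neg h0]; rfl
  · rcases conf_zero g x with h1 | h1 <;> rcases conf_zero g (x + 1) with h2 | h2 <;>
      rw [h1, h2] <;> rfl
  rcases lt_or_ge x (-2 * h) with h1 | h1
  · rw [conf_left h1]
    rcases (show x + 1 ≤ -2 * h by omega).lt_or_eq with h2 | h2
    · rw [conf_left h2]; rfl
    · rw [h2, conf_lsep h0]; rfl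
  rcases lt_or_ge x 0 with h2 | h2
  · have e1 : (conf g x h).col R = .near L := by
      rcases h1.eq_or_lt with rfl | h1
      · rw [conf_lsep h0]; rfl
      · rw [conf_near h1 h2]; rfl
    rw [e1]
    rcases (show x + 1 ≤ 0 by omega).lt_or_eq with h3 | h3
    · rw [conf_near (by omega) h3]; rfl
    · rw [h3]
      rcases conf_axis (g := g) h0 with ⟨-, h4⟩ | ⟨-, h4⟩ <;> rw [h4] <;> rfl
  rcases lt_or_ge x h with h3 | h3
  · have := hz.color (y := x) hg.two_le h2 h3 (.inr (.inl (by omega)))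
    rwa [zero_add, zero_add] at this
  · have := ht.color (x := x) hg h0 (by omega) h3 (by omega)
    rwa [zero_add] at this

theorem conf_lawful (hg : Scale g) : Lawful (conf g) := by
  refine fun x h => ⟨conf_color hg x h, fun p => ?_, fun p hp => (conf_leaves hg hp).2⟩
  rw [Bool.eq_iff_iff]
  refine ⟨conf_inn hg, fun hp => ?_⟩
  have := (conf_leaves hg hp).1
  rwa [sub_add_cancel, add_sub_cancel_right] at this

/-- A cell of a triangle can be a mark only in the base row, and an apex only from height `g` on. -/
theorem tri_event {k : ℕ} (hg : 0 < g) (h0 : 0 < h) : tri k g x h ≠ .mark ∧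
    ∀ s r, tri k g x h = .apex s r → g ≤ h := by
  have hR : ∀ (k : ℕ) (g : ℤ), 0 < g → lineR k g h ≠ .mark ∧
      ∀ s r, lineR k g h = .apex s r → g ≤ h := by
    intro k g hg
    rcases lt_or_ge h g with h1 | h1
    · rw [lineR_low hg h1]; simp
    · refine ⟨?_, fun _ _ _ => h1⟩
      rcases Triangle.lineR_cases k g h with h2 | h2 | h2 <;> rw [h2] <;> simp
  have hL : ∀ (k : ℕ) (g : ℤ), 0 < g → lineL k g h ≠ .mark ∧
      ∀ s r, lineL k g h = .apex s r → g ≤ h := by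
    intro k g hg
    rcases lt_or_ge h g with h1 | h1
    · rw [lineL_low hg (by linarith [le_two_pow_mul k hg])]; simp
    · refine ⟨?_, fun _ _ _ => h1⟩
      rcases Triangle.lineL_cases k g h with h2 | h2 | h2 <;> rw [h2] <;> simp
  have hwR : ∀ (k : ℕ) (g y : ℤ), wedgeR k g y h ≠ .mark ∧ ∀ s r, wedgeR k g y h ≠ .apex s r := by
    intro k g y
    induction k with
    | zero => simp [wedgeR]
    | succ k ih => rw [wedgeR, rowR]; split_ifs <;> simp [ih]
  have hwL : ∀ (k : ℕ) (g y : ℤ), wedgeL k g y h ≠ .mark ∧ ∀ s r, wedgeL k g y h ≠ .apex s r := by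
    intro k g y
    induction k generalizing g with
    | zero => simp [wedgeL]
    | succ k ih => rw [wedgeL, rowL]; split_ifs <;> simp [ih]
  have hA : ∀ (k : ℕ) (g : ℤ), axis k g h ≠ .mark ∧ ∀ s r, axis k g h ≠ .apex s r := by
    intro k g
    rw [axis, if_neg h0.ne']
    split_ifs <;> simp
  induction k generalizing g x with
  | zero => simp [tri]
  | succ k ih =>
    have hg2 : 0 < 2 * g := by omega
    rw [tri]
    split_ifs
    · exact ih hg
    · exact ⟨(ih hg2).1, fun s r hs => by have := (ih hg2).2 s r hs; omega⟩
    · exact ⟨(hA k g).1, fun s r hs => absurd hs ((hA k g).2 s r)⟩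
    · exact ⟨(hR k _ hg2).1, fun s r hs => by have := (hR k _ hg2).2 s r hs; omega⟩
    · exact ⟨(hwR k _ _).1, fun s r hs => absurd hs ((hwR k _ _).2 s r)⟩
    · exact hL k g hg
    · exact ⟨(hwL k _ _).1, fun s r hs => absurd hs ((hwL k _ _).2 s r)⟩

theorem conf_event (hg : 0 < g) (h0 : 0 < h) : conf g x h ≠ .mark ∧
    ∀ s r, conf g x h = .apex s r → g ≤ h := by
  rcases conf_cases x h0.le with ⟨h1, h2⟩ | ⟨rfl, h1⟩ | ⟨h1, h2⟩ | rfl | ⟨h1, h2⟩ | ⟨rfl, h1⟩ | h1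
  · rw [conf_left h1]; simp
  · rw [conf_lsep h1]; simp
  · rw [conf_near h1 h2]; simp
  · rcases conf_axis (g := g) h0 with ⟨-, h4⟩ | ⟨-, h4⟩ <;> rw [h4] <;> simp
  · obtain ⟨k, hk⟩ : ∃ k : ℕ, x + 2 * h < 3 ^ k * g := ⟨_, lt_height hg _⟩
    rw [conf_wedgeR hg k h1 h2 (by omega)]
    constructor
    · intro h3
      cases Triangle.wedgeR_inn_out (p := .d) (.inl (by rw [h3]; rfl))
    · intro s r h3
      exact absurd h3 (by
        clear hk h3
        induction k with
        | zero => simp [wedgeR]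
        | succ k ih => rw [wedgeR, rowR]; split_ifs <;> simp [ih])
  · obtain ⟨k, hk⟩ : ∃ k : ℕ, x < 3 ^ k * g := ⟨_, lt_height hg _⟩
    rw [conf_lineR hg k h1 hk]
    rcases lt_or_ge x g with h2 | h2
    · rw [lineR_low hg h2]; simp
    · refine ⟨?_, fun _ _ _ => h2⟩
      rcases Triangle.lineR_cases k g x with h2 | h2 | h2 <;> rw [h2] <;> simp
  · obtain ⟨k, hk⟩ : ∃ k : ℕ, x + 2 * h < 3 ^ k * g := ⟨_, lt_height hg _⟩
    rw [conf_tri hg k h0.le h1 (by omega)]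
    exact tri_event hg h0

/-- The configurations `conf g` belong to the shift. -/
theorem conf_valid (hg : Scale g) : Valid (conf g) := by
  refine fun x h => ⟨conf_lawful hg x h, fun hb => ?_⟩
  rcases lt_trichotomy h (-1) with h0 | rfl | h0
  · left
    rw [conf_neg (by omega), conf_neg (by omega)]
  · rw [show conf g x (-1) = .bg .E from conf_neg (by omega)]
    exact (conf_zero g x).imp id fun h1 => ⟨h1, rfl⟩
  · left
    have h1 : (conf g 0 h).blank = false := not_blank_of_inn _ _ (conf_axis_d (by omega)).1
    have h2 : ∀ z, conf g z (h + 1) ≠ .mark := fun z => (conf_event hg.pos (by omega)).1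
    rcases lt_or_ge x (-12) with h3 | h3
    · exact (conf_lawful hg).calm (s := R) (by simp [Side.sg]; omega) h1 h2 hb
    rcases lt_or_ge 12 x with h4 | h4
    · exact (conf_lawful hg).calm (s := L) (by simp [Side.sg]; omega) h1 h2 hb
    have := hb (-x) (by omega) (by omega)
    rw [add_neg_cancel, h1] at this
    cases this

/-- Near its right corner, a triangle contains nothing. -/
theorem tri_right {k : ℕ} (hg : 0 < g) (h0 : 0 ≤ h)
    (hx : 3 * (3 ^ k * g) - 3 * (2 ^ k * g) + h < x) : tri k g x h = .bg .E := by
  induction k generalizing g x with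
  | zero => rfl
  | succ k ih =>
    have e := height_succ k g
    have e' := height_double k g
    have e1 : (2 : ℤ) ^ (k + 1) * g = 2 * (2 ^ k * g) := by ring
    have e2 : (2 : ℤ) ^ k * (2 * g) = 2 * (2 ^ k * g) := by ring
    have := two_pow_le_three_pow_mul k hg
    rw [tri, if_neg (by omega), if_pos (by omega), ih (by omega) (by omega)]

/-- Around the corner that is common to the two parts of a large triangle, `conf g` looks like
`conf (2 * g)`. -/
theorem conf_double (hg : Scale g) (k : ℕ) (hx : -(2 ^ k * g) < x)
    (hx' : x < 2 ^ k * g) (hh : 2 * h < 2 ^ k * g) :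
    conf g (3 * (3 ^ k * g) + x) h = conf (2 * g) x h := by
  have hpos := hg.pos
  have e := height_succ k g
  have e' := height_double k g
  have hk := two_pow_le_three_pow_mul k hpos
  rcases lt_or_ge h 0 with h0 | h0
  · rw [conf_neg h0, conf_neg h0]
  have ht := triangle_conf hg (k + 1)
  have ht' := triangle_conf hg.double k
  have hRC := ht.rightChild hg
  have hRZ := ht.rightZone hg
  have hLZ := ht.leftZone hg
  rw [zero_add] at hRC hRZ hLZ
  rcases conf_cases x h0 with ⟨h1, h2⟩ | ⟨rfl, h1⟩ | ⟨h1, h2⟩ | rfl | ⟨h1, h2⟩ | ⟨rfl, h1⟩ | h1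
  · rw [conf_left h1, conf_tri hpos k h0 (by omega) (by omega), tri_right hpos h0 (by omega)]
  · have := hLZ.line h h1 (by omega)
    rw [lineL_low hpos (by omega)] at this
    rw [conf_lsep h1, ← this]
    congr 1
    ring
  · have := hLZ.wedge (-x) h (by omega) (by omega) (by omega)
    rw [wedgeL_low hpos (by omega) (by omega), sub_neg_eq_add] at this
    rw [conf_near h1 h2, this]
  · rcases h0.eq_or_lt with rfl | h0
    · rw [add_zero, hRZ.base, conf_corner]
    have e3 := ht.axis_eq (h := h) hg h0.le (by omega)
    rw [zero_add] at e3
    rw [add_zero, e3]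
    rcases axis_cases (k := k) hg h0 with ⟨i1, i2, i3⟩ | ⟨i1, ⟨S, i2, i3⟩, i4⟩ | ⟨i1, i2, i3⟩
    · rcases (rightZone_conf hg.double k).axis h h0 (by omega) with ⟨-, i4⟩ | ⟨i4, -⟩
      · rw [i3, i4]
      · exact absurd i1 i4
    · have := i2.le hpos
      omega
    · rcases (rightZone_conf hg.double k).axis h h0 (by omega) with ⟨i4, -⟩ | ⟨-, i4 | i4⟩
      · exact absurd i4 i1
      · rw [i3, i4]
      · rcases conf_axis (g := 2 * g) h0 with ⟨-, i5⟩ | ⟨-, i5⟩ <;> rw [i5] at i4 <;> cases i4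
  · rw [conf_wedgeR hg.double.pos k h1 h2 (by omega), hRZ.wedge x h h1 h2 (by omega)]
  · rw [conf_lineR hg.double.pos k h1 (by omega), hRC.left x h1 (by omega)]
  · rw [conf_tri hg.double.pos k h0 h1 (by omega), hRC.inside x h h0 h1 (by omega)]

end Configuration

/-! ### The subshift -/

instance : Inhabited Cell := ⟨.bg .E⟩

instance : TopologicalSpace Cell := ⊥

instance : DiscreteTopology Cell := ⟨rfl⟩

/-- A configuration of the plane, in coordinates in which the lines `a + b = h` are rows. -/
def rows (z : ℤ × ℤ → Cell) (x h : ℤ) : Cell := z (x, h - x)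

/-- The inverse of `rows`. -/
def plane (c : ℤ → ℤ → Cell) (n : ℤ × ℤ) : Cell := c n.1 (n.1 + n.2)

theorem rows_plane (c : ℤ → ℤ → Cell) : rows (plane c) = c := by
  funext x h
  simp [rows, plane]

theorem plane_rows (z : ℤ × ℤ → Cell) : plane (rows z) = z := by
  funext n
  simp [rows, plane]

theorem dir_bounds : ∀ p : Par, p.sweep ≤ 12 ∧ (p.dir = -1 ∨ p.dir = 0 ∨ p.dir = 1) := by
  decide +kernel

theorem Admissible.congr {x h x' h' : ℤ} (hc : Admissible c x h)
    (hcc : ∀ i j, -13 ≤ i → i ≤ 13 → 0 ≤ j → j ≤ 1 → c' (x' + i) (h' + j) = c (x + i) (h + j)) :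
    Admissible c' x' h' := by
  have h0 : ∀ i, -13 ≤ i → i ≤ 13 → c' (x' + i) h' = c (x + i) h := by
    intro i h1 h2
    simpa using hcc i 0 h1 h2 le_rfl zero_le_one
  have h1 : ∀ i, -13 ≤ i → i ≤ 13 → c' (x' + i) (h' + 1) = c (x + i) (h + 1) :=
    fun i h1 h2 => hcc i 1 h1 h2 zero_le_one le_rfl
  have e0 : c' x' h' = c x h := by simpa using h0 0
  have e1 : c' x' (h' + 1) = c x (h + 1) := by simpa using h1 0
  refine ⟨⟨?_, fun p => ?_, fun p hp j j1 j2 => ?_⟩, fun hb => ?_⟩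
  · rw [e0, h0 1 (by norm_num) (by norm_num), hc.color]
  · have := vel_le_sweep p
    rw [e0, sub_eq_add_neg, h1 _ (by omega) (by omega), hc.vert p, sub_eq_add_neg]
  · rw [e0] at hp
    have h3 := dir_bounds p
    have h4 : -13 ≤ p.dir * j ∧ p.dir * j ≤ 13 := by
      rcases h3.2 with h4 | h4 | h4 <;> rw [h4] <;> omega
    rw [h0 _ h4.1 h4.2]
    exact hc.clear p hp j j1 j2
  · rw [e0, e1]
    refine hc.calm fun i i1 i2 => ?_
    rw [← h0 i (by omega) (by omega)]
    exact hb i i1 i2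

/-- The cells that the local rule at the origin refers to lie in this rectangle. -/
noncomputable def window : Finset (ℤ × ℤ) := Finset.Icc (-13) 13 ×ˢ Finset.Icc (-13) 14

/-- The patterns on `window` that violate the local rule. -/
def violations : Set (Pattern Cell (ℤ × ℤ)) :=
  {p | p.support = window ∧ ¬ Admissible (rows p.config) 0 0}

theorem finite_violations : violations.Finite :=
  (finite_setOfPred_pattern_support_eq window).subset fun _ hp => hp.1

theorem admissible_rows_congr {z z' : ℤ × ℤ → Cell} {n n' : ℤ × ℤ}
    (h : ∀ w ∈ window, z' (n' + w) = z (n + w))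
    (hz : Admissible (rows z) n.1 (n.1 + n.2)) : Admissible (rows z') n'.1 (n'.1 + n'.2) := by
  refine hz.congr fun i j i1 i2 j1 j2 => ?_
  have := h (i, j - i) (by simp [window]; omega)
  have e : ∀ m : ℤ × ℤ, (m.1 + i, m.1 + m.2 + j - (m.1 + i)) = m + (i, j - i) := by
    intro m
    ext
    · rfl
    · change m.1 + m.2 + j - (m.1 + i) = m.2 + (j - i)
      ring
  rw [rows, rows, e, e]
  exact this

theorem mem_forbidden_violations {z : ℤ × ℤ → Cell} :
    z ∈ forbidden violations ↔ Valid (rows z) := by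
  constructor
  · intro hz x h
    by_contra hn
    have hW : ∀ w ∈ window, (Pattern.fromConfig (shift (x, h - x) z) window).config (0 + w) =
        z ((x, h - x) + w) := fun w hw => by
      rw [zero_add]
      exact if_pos hw
    refine hz (Pattern.fromConfig (shift (x, h - x) z) window) ⟨rfl, fun ha => hn ?_⟩ (x, h - x)
      fun w hw => ?_
    · simpa using admissible_rows_congr (n := 0) (n' := (x, h - x)) (fun w hw => (hW w hw).symm)
        (by simpa using ha)
    · rw [← hW w hw, zero_add]
  · rintro hz p ⟨hp, hn⟩ n ho
    refine hn ?_
    have := admissible_rows_congr (z' := p.config) (n := n) (n' := 0) (fun w hw => ?_) (hz _ _)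
    · simpa using this
    · rw [zero_add, ho w (hp ▸ hw)]

theorem countable_forbidden_violations : (forbidden violations).Countable := by
  refine (countable_setOf_valid.image plane).mono fun z hz => ?_
  exact ⟨rows z, mem_forbidden_violations.1 hz, plane_rows z⟩

theorem deterministic_forbidden_violations :
    PlanarShift.DeterministicInDirection (-1, -1) (forbidden violations) := by
  let A : Matrix.SpecialLinearGroup (Fin 2) ℤ := ⟨!![1, 0; 1, 1], by decide⟩
  have hA : A⁻¹ = ⟨!![1, 0; -1, 1], by decide⟩ := inv_eq_of_mul_eq_one_right (by decide)
  have ht : ∀ z : ℤ × ℤ → Cell, ∀ x h, PlanarShift.transform A z (x, h) = rows z x h := by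
    intro z x h
    rw [PlanarShift.transform, hA, rows]
    congr 1
    ext
    · change 1 * x + 0 * h = x
      ring
    · change -1 * x + 1 * h = h - x
      ring
  refine ⟨A, by decide, ?_⟩
  rintro _ ⟨y, hy, rfl⟩ _ ⟨z, hz, rfl⟩ hyz
  have := (mem_forbidden_violations.1 hy).eq_of_eq_above (mem_forbidden_violations.1 hz) (h₀ := 1)
    fun x h hh => by rw [← ht, ← ht]; exact hyz (x, h) hh
  rw [← plane_rows y, this, plane_rows]

/-- Every pattern of `conf (2 * g)` occurs in `conf g`. -/
theorem patterns_conf_double {g : ℤ} (hg : Scale g) :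
    PlanarShift.patterns (plane (conf (2 * g))) ⊆ PlanarShift.patterns (plane (conf g)) := by
  rintro p ⟨n, hn⟩
  let f : ℤ × ℤ → ℤ := fun w => |n.1 + w.1| + 2 * |n.1 + w.1 + (n.2 + w.2)|
  have hf : ∀ w, 0 ≤ f w := fun w => by positivity
  set k := (∑ w ∈ p.support, f w).toNat with hk
  have hB : ∑ w ∈ p.support, f w < 2 ^ k * g := by
    have h1 := Nat.lt_pow_self (n := k) (show 1 < 2 by norm_num)
    have h2 := Int.self_le_toNat (∑ w ∈ p.support, f w)
    zify at h1
    nlinarith [hg.two_le]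
  refine ⟨n + (3 * (3 ^ k * g), -(3 * (3 ^ k * g))), fun w hw => ?_⟩
  have h1 : f w ≤ ∑ w ∈ p.support, f w := Finset.single_le_sum (fun w _ => hf w) hw
  have h2 := neg_abs_le (n.1 + w.1)
  have h3 := le_abs_self (n.1 + w.1)
  have h4 := le_abs_self (n.1 + w.1 + (n.2 + w.2))
  have h5 := abs_nonneg (n.1 + w.1 + (n.2 + w.2))
  have h6 := abs_nonneg (n.1 + w.1)
  have h7 : f w = |n.1 + w.1| + 2 * |n.1 + w.1 + (n.2 + w.2)| := rfl
  rw [← hn w hw]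
  change conf g (n.1 + 3 * (3 ^ k * g) + w.1)
    (n.1 + 3 * (3 ^ k * g) + w.1 + (n.2 + -(3 * (3 ^ k * g)) + w.2)) =
    conf (2 * g) (n.1 + w.1) (n.1 + w.1 + (n.2 + w.2))
  rw [← conf_double hg k (x := n.1 + w.1) (h := n.1 + w.1 + (n.2 + w.2)) (by omega) (by omega)
    (by omega)]
  congr 1 <;> ring

/-- A mark and an apex at height `g` above its row occur in `conf g`. In `conf g'` the lowest apex
has height `g'`. -/
theorem le_of_patterns_conf {g g' : ℤ} (hg : Scale g) (hg' : Scale g')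
    (h : PlanarShift.patterns (plane (conf g)) ⊆ PlanarShift.patterns (plane (conf g'))) :
    g' ≤ g := by
  obtain ⟨n, hn⟩ := h (a := Pattern.fromConfig (plane (conf g)) {(0, 0), (g, 0)})
    ⟨0, fun w hw => by rw [zero_add]; exact (if_pos hw).symm⟩
  have hm : conf g' n.1 (n.1 + n.2) = .mark := by
    have h1 := hn (0, 0) (by simp [Pattern.fromConfig])
    simp only [Prod.mk_zero_zero, add_zero] at h1
    refine h1.trans ((if_pos (by simp)).trans ?_)
    simp [plane, conf_corner]
  have hrow : n.1 + n.2 = 0 := by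
    rcases lt_trichotomy (n.1 + n.2) 0 with h1 | h1 | h1
    · rw [conf_neg h1] at hm
      cases hm
    · exact h1
    · exact absurd hm (conf_event hg'.pos h1).1
  have ha : conf g' (n.1 + g) g = .apex R (g : ZMod 3) := by
    have h1 := hn (g, 0) (by simp [Pattern.fromConfig])
    refine Eq.trans ?_ (h1.trans ((if_pos (by simp)).trans ?_))
    · rw [plane]
      congr 1
      simp
      omega
    · simpa [plane] using conf_apex hg.pos 0
  exact (conf_event hg'.pos hg.pos).2 _ _ ha

theorem scale_two_pow (j : ℕ) : Scale (2 ^ (j + 1)) := by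
  refine ⟨?_, Dvd.intro_left _ (pow_succ 2 j).symm, fun h => ?_, fun h => ?_⟩
  · rw [pow_succ]
    linarith [one_le_pow₀ (show (1 : ℤ) ≤ 2 by norm_num) (n := j)]
  · have := Int.Prime.dvd_pow' Nat.prime_three h
    omega
  · have := Int.Prime.dvd_pow' Nat.prime_five h
    omega

/-- The configurations `conf (2 ^ (j + 1))` as points of the shift. -/
noncomputable def chainPoint (j : ℕ) :
    PlanarShift.Point (Subshift.ofForbidden violations) :=
  ⟨plane (conf (2 ^ (j + 1))), mem_forbidden_violations.2 <| by
    rw [rows_plane]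
    exact conf_valid (scale_two_pow j)⟩

theorem chainPoint_strictAnti : StrictAnti chainPoint := by
  refine strictAnti_nat_of_succ_lt fun j => lt_iff_le_not_ge.2 ⟨?_, fun h => ?_⟩
  · have := patterns_conf_double (scale_two_pow j)
    rwa [← pow_succ'] at this
  · have := le_of_patterns_conf (scale_two_pow j) (scale_two_pow (j + 1)) h
    exact absurd this (not_le.2 (pow_lt_pow_right₀ (by norm_num) (by omega)))

end TriangleShift

theorem mainTheorem1 :
    ∃ (S : Type) (_ : Finite S) (_ : Inhabited S) (_ : TopologicalSpace S)
      (_ : DiscreteTopology S) (X : Subshift S (ℤ × ℤ)),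
      PlanarShift.IsSFT X ∧
      X.carrier.Countable ∧
      PlanarShift.DeterministicInDirection (-1, -1) X.carrier ∧
      Nonempty (ℕᵒᵈ ↪o PlanarShift.SubpatternPoset X) := by
  refine ⟨TriangleShift.Cell, inferInstance, inferInstance, inferInstance, inferInstance,
    Subshift.ofForbidden TriangleShift.violations, ⟨_, TriangleShift.finite_violations, rfl⟩,
    TriangleShift.countable_forbidden_violations,
    TriangleShift.deterministic_forbidden_violations, ⟨OrderEmbedding.ofStrictMono
      (fun j => toAntisymmetrization (· ≤ ·) (TriangleShift.chainPoint (OrderDual.ofDual j)))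
      fun i j hij => ?_⟩⟩
  exact TriangleShift.chainPoint_strictAnti hij
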